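/- **Setting.** Let $\Lambda\subset\mathbb C$ be a period lattice with Weierstrass functions $\sigma$, $\zeta=\sigma'/\sigma$, $\wp$, and put $\phi(u,z)=\dfrac{\sigma(u-z)}{\sigma(u)\sigma(z)}$, $\phi_u=\partial\phi/\partial u$. Let $\theta_1,\dots,\theta_N\in\mathbb C$, $C_j=\theta_j^2/4$, and let $U\subset\mathbb C^N$ be an open set of times $t=(t_1,\dots,t_N)$. On the phase space with coordinates $q,p,A_j^3,A_j^{\pm}$ and Poisson bracket $\{q,p\}=1$, $\{A_j^3,A_k^\pm\}=\pm\delta_{jk}A_k^\pm$, $\{A_j^+,A_k^-\}=2\delta_{jk}A_k^3$ (all other brackets of coordinates zero), let $$L(z)=\begin{pmatrix}p&0\\0&-p\end{pmatrix}+\sum_{j=1}^N\begin{pmatrix}\zeta(z-t_j)A_j^3&\phi(q,z-t_j)A_j^-\\ \phi(-q,z-t_j)A_j^+&-\zeta(z-t_j)A_j^3\end{pmatrix},\qquad \mathcal H_j=\operatorname{Res}_{z=t_j}\tfrac12\operatorname{Tr}L(z)^2 .$$ A solution over $U$ of the *isomonodromic SU(2) Calogero–Gaudin system* consists of holomorphic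 functions $q,p,A_k^3,A_k^\pm,p_j$ of $t\in U$ with $q\notin\Lambda$ (and $t_j-t_k\notin\Lambda$ for $j\ne k$ on $U$), $(A_j^3)^2+A_j^+A_j^-=\theta_j^2/4$, $\sum_kA_k^3=0$, $\sum_jp_j=p$, such that for each $F\in\{q,p,A_k^3,A_k^\pm\}$ $$\frac{\partial F}{\partial t_j}=\{F,\mathcal H_j\}-2p_j\Bigl\{F,\sum_kA_k^3\Bigr\},$$ and, for $j\neq k$, $$\frac{\partial p_k}{\partial t_j}-\frac{\partial p_j}{\partial t_k}+\phi_u(q,t_j-t_k)A_j^+A_k^--\phi_u(q,t_k-t_j)A_j^-A_k^+=0 .$$ *Spectral Darboux coordinates* of such a solution are functions $\lambda_k,\mu_k$ ($k=1,\dots,N$) on $U$ with $\lambda_k$ continuous, such that $\lambda_1,\dots,\lambda_N$ are, at each time, the zeros of $L_{12}(z)$ modulo $\Lambda$, they are pairwise incongruent modulo $\Lambda$ and incongruent to the $t_j$, they are normalized by $\sum_k\lambda_k-\sum_kt_k=q$, and $\mu_k=L_{11}(\lambda_k)$. Put $Q(z)=\prod_l\sigma(z-\lambda_l)$, $P(z)=\prod_l\sigma(z-t_l)$,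 $q=\sum_l\lambda_l-\sum_lt_l$ and $$H_j=\sum_{k=1}^N\frac{Q(t_j)P(\lambda_k)\,\sigma\bigl(\sum_{l\ne k}\lambda_l-\sum_{l\ne j}t_l\bigr)}{P'(t_j)Q'(\lambda_k)\,\sigma(t_j-\lambda_k)\,\sigma\bigl(\sum_l\lambda_l-\sum_lt_l\bigr)}\Bigl(\mu_k^2+\bigl(\zeta(t_j-\lambda_k+q)-\zeta(t_j-\lambda_k)\bigr)\mu_k-\sum_{l=1}^NC_l\wp(\lambda_k-t_l)\Bigr),$$ where, with $w=t_j-\lambda_k+q=\sum_{l\ne k}\lambda_l-\sum_{l\ne j}t_l$, the product $\sigma(w)\zeta(w)$ is read as $\sigma'(w)$ (which also gives it a meaning where $w\in\Lambda$). Say that $(\lambda,t)$ is *in general position* if the $2N$ points $\lambda_k,t_j$ are pairwise incongruent modulo $\Lambda$ and $\sum_l\lambda_l-\sum_lt_l\notin\Lambda$. **Theorem.** Each $H_j$ is a holomorphic function of $(\lambda,\mu,t)$ with $(\lambda,t)$ in general position, and the isomonodromic SU(2) Calogero–Gaudin system is converted, in the spectral Darboux coordinates, to the non-autonomous Hamiltonian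 system $$\frac{\partial\lambda_k}{\partial t_j}=\frac{\partial H_j}{\partial\mu_k},\qquad\frac{\partial\mu_k}{\partial t_j}=-\frac{\partial H_j}{\partial\lambda_k}\qquad(j,k=1,\dots,N),$$ in the following sense. 1. If $\lambda_k,\mu_k$ are spectral Darboux coordinates of a solution of the isomonodromic system over $U$, then they are holomorphic, in general position, and satisfy this Hamiltonian system; moreover, along the solution, $$H_j=\mathcal H_j+p-A_j^3\Bigl(\sum_{k=1}^N\zeta(t_j-\lambda_k)-\sum_{k\ne j}\zeta(t_j-t_k)\Bigr)+\sum_{k\ne j}\zeta(t_j-t_k)A_k^3 .$$ 2. Conversely, every holomorphic solution of the Hamiltonian system over $U$, in general position, consists of the spectral Darboux coordinates of some solution of the isomonodromic system over $U$. 3. Two solutions of the isomonodromic system over $U$ with the same spectral Darboux coordinates have the same $q,p,A_j^3$, and at each time their $A_j^\pm$ are related by a diagonal gauge transformation $A_j^-\mapsto gA_j^-$, $A_j^+\mapsto g^{-1}A_j^+$ with $g\neq0$ independent of $j$. -/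

import Mathlib

open Filter Topology

noncomputable section

namespace CalogeroGaudin

/-! ### Weierstrass functions of a period lattice -/

/-- The Weierstrass sigma function
`σ(z) = z ∏_{l ≠ 0} (1 - z / l) exp (z / l + z² / (2 l²))`, the product being over the nonzero
lattice points. -/
def sigma (Λ : PeriodPair) (z : ℂ) : ℂ :=
  open Classical in
  z * ∏' l : Λ.lattice,
    if (l : ℂ) = 0 then 1
    else (1 - z / (l : ℂ)) * Complex.exp (z / (l : ℂ) + z ^ 2 / (2 * (l : ℂ) ^ 2))

/-- The Weierstrass zeta function `ζ = σ' / σ`. -/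
def zeta (Λ : PeriodPair) (z : ℂ) : ℂ := deriv (sigma Λ) z / sigma Λ z

/-- `φ(u, z) = σ(u - z) / (σ(u) σ(z))`. -/
def phi (Λ : PeriodPair) (u z : ℂ) : ℂ := sigma Λ (u - z) / (sigma Λ u * sigma Λ z)

/-- `φ_u = ∂φ/∂u`. -/
def phiU (Λ : PeriodPair) (u z : ℂ) : ℂ := deriv (fun v => phi Λ v z) u

/-- Residue at `a` of a function that is holomorphic in a punctured neighbourhood of `a`:
the value of `(2πi)⁻¹ ∮ f` over small circles around `a`. -/
def residue (f : ℂ → ℂ) (a : ℂ) : ℂ :=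
  limUnder (𝓝[>] (0 : ℝ))
    (fun r : ℝ => (2 * (Real.pi : ℂ) * Complex.I)⁻¹ * ∮ z in C(a, r), f z)

/-- `j`-th partial derivative of a function of `N` complex variables. -/
def pderiv {N : ℕ} (j : Fin N) (f : (Fin N → ℂ) → ℂ) (t : Fin N → ℂ) : ℂ :=
  deriv (fun s : ℂ => f (Function.update t j s)) (t j)

/-! ### Phase space and Poisson bracket -/

/-- A point of the (unreduced) phase space: Calogero variables `q, p` and spin variables
`A_j³, A_j⁺, A_j⁻`. -/
@[ext] structure Phase (N : ℕ) where
  q : ℂ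
  p : ℂ
  A3 : Fin N → ℂ
  Ap : Fin N → ℂ
  Am : Fin N → ℂ

variable {N : ℕ}

/-- `∂F/∂q`. -/
def dq (F : Phase N → ℂ) (x : Phase N) : ℂ := deriv (fun s => F { x with q := s }) x.q

/-- `∂F/∂p`. -/
def dp (F : Phase N → ℂ) (x : Phase N) : ℂ := deriv (fun s => F { x with p := s }) x.p

/-- `∂F/∂A_j³`. -/
def d3 (j : Fin N) (F : Phase N → ℂ) (x : Phase N) : ℂ :=
  pderiv j (fun a => F { x with A3 := a }) x.A3

/-- `∂F/∂A_j⁺`. -/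
def dPlus (j : Fin N) (F : Phase N → ℂ) (x : Phase N) : ℂ :=
  pderiv j (fun a => F { x with Ap := a }) x.Ap

/-- `∂F/∂A_j⁻`. -/
def dMinus (j : Fin N) (F : Phase N → ℂ) (x : Phase N) : ℂ :=
  pderiv j (fun a => F { x with Am := a }) x.Am

/-- The Poisson bracket with `{q, p} = 1`, `{A_j³, A_k^±} = ± δ_jk A_k^±`,
`{A_j⁺, A_k⁻} = 2 δ_jk A_k³`, all other brackets of the coordinates being zero. -/
def poisson (F G : Phase N → ℂ) (x : Phase N) : ℂ :=
  dq F x * dp G x - dp F x * dq G x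
    + ∑ j : Fin N,
      (x.Ap j * (d3 j F x * dPlus j G x - dPlus j F x * d3 j G x)
        - x.Am j * (d3 j F x * dMinus j G x - dMinus j F x * d3 j G x)
        + 2 * x.A3 j * (dPlus j F x * dMinus j G x - dMinus j F x * dPlus j G x))

/-! ### The isomonodromic SU(2) Calogero–Gaudin system -/

/-- The matrix `L(z)`. -/
def laxMatrix (Λ : PeriodPair) (t : Fin N → ℂ) (x : Phase N) (z : ℂ) : Matrix (Fin 2) (Fin 2) ℂ :=
  !![x.p, 0; 0, -x.p]
    + ∑ j : Fin N,
      !![zeta Λ (z - t j) * x.A3 j, phi Λ x.q (z - t j) * x.Am j;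
        phi Λ (-x.q) (z - t j) * x.Ap j, -(zeta Λ (z - t j) * x.A3 j)]

/-- The residue matrix `A_j`. -/
def spinMatrix (x : Phase N) (j : Fin N) : Matrix (Fin 2) (Fin 2) ℂ :=
  !![x.A3 j, x.Am j; x.Ap j, -x.A3 j]

/-- The quadratic Hamiltonian `𝓗_j = Res_{z = t_j} ½ Tr L(z)²`. -/
def quadHam (Λ : PeriodPair) (t : Fin N → ℂ) (j : Fin N) (x : Phase N) : ℂ :=
  residue (fun z => (1 / 2) * (laxMatrix Λ t x z ^ 2).trace) (t j)

/-- `∑ A_k³`. -/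
def totalSpin (x : Phase N) : ℂ := ∑ k : Fin N, x.A3 k

/-- The bracket of `F` with `𝓗_j - c ∑ A_k³`, where the multiplier `c` is inert. -/
def modBracket (Λ : PeriodPair) (t : Fin N → ℂ) (j : Fin N) (c : ℂ) (F : Phase N → ℂ)
    (x : Phase N) : ℂ :=
  poisson F (quadHam Λ t j) x - c * poisson F totalSpin x

/-- `X = (q, p, A)` and the multipliers `m j` (the `p_j`) form a holomorphic solution, over the set
`U` of times `t = (t_1, …, t_N)`, of the isomonodromic SU(2) Calogero–Gaudin system with spins on
the symplectic leaves `½ Tr A_j² = θ_j² / 4`. -/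
structure IsIsomonodromicSolution (Λ : PeriodPair) (θ : Fin N → ℂ) (U : Set (Fin N → ℂ))
    (X : (Fin N → ℂ) → Phase N) (m : Fin N → (Fin N → ℂ) → ℂ) : Prop where
  times_distinct : ∀ t ∈ U, ∀ j k, j ≠ k → t j - t k ∉ Λ.lattice
  q_notMem : ∀ t ∈ U, (X t).q ∉ Λ.lattice
  diff_q : DifferentiableOn ℂ (fun t => (X t).q) U
  diff_p : DifferentiableOn ℂ (fun t => (X t).p) U
  diff_A3 : ∀ k, DifferentiableOn ℂ (fun t => (X t).A3 k) U
  diff_Ap : ∀ k, DifferentiableOn ℂ (fun t => (X t).Ap k) U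
  diff_Am : ∀ k, DifferentiableOn ℂ (fun t => (X t).Am k) U
  diff_m : ∀ k, DifferentiableOn ℂ (m k) U
  leaf : ∀ t ∈ U, ∀ j, (1 / 2) * (spinMatrix (X t) j ^ 2).trace = θ j ^ 2 / 4
  spin_constraint : ∀ t ∈ U, ∑ k, (X t).A3 k = 0
  multiplier_constraint : ∀ t ∈ U, ∑ k, m k t = (X t).p
  flow_q : ∀ t ∈ U, ∀ j, pderiv j (fun s => (X s).q) t =
    modBracket Λ t j (2 * m j t) (fun x => x.q) (X t)
  flow_p : ∀ t ∈ U, ∀ j, pderiv j (fun s => (X s).p) t =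
    modBracket Λ t j (2 * m j t) (fun x => x.p) (X t)
  flow_A3 : ∀ t ∈ U, ∀ j k, pderiv j (fun s => (X s).A3 k) t =
    modBracket Λ t j (2 * m j t) (fun x => x.A3 k) (X t)
  flow_Ap : ∀ t ∈ U, ∀ j k, pderiv j (fun s => (X s).Ap k) t =
    modBracket Λ t j (2 * m j t) (fun x => x.Ap k) (X t)
  flow_Am : ∀ t ∈ U, ∀ j k, pderiv j (fun s => (X s).Am k) t =
    modBracket Λ t j (2 * m j t) (fun x => x.Am k) (X t)
  zero_curvature : ∀ t ∈ U, ∀ j k, j ≠ k →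
    pderiv j (m k) t - pderiv k (m j) t
      + phiU Λ (X t).q (t j - t k) * (X t).Ap j * (X t).Am k
      - phiU Λ (X t).q (t k - t j) * (X t).Am j * (X t).Ap k = 0

/-! ### Spectral Darboux coordinates -/

/-- Positions `l` and times `t` are in general position: all points `t_j`, `λ_k` are distinct
modulo the lattice, and `∑ λ - ∑ t` is not a period. -/
structure IsRegular (Λ : PeriodPair) (t l : Fin N → ℂ) : Prop where
  times_distinct : ∀ j k, j ≠ k → t j - t k ∉ Λ.lattice
  zeros_distinct : ∀ j k, j ≠ k → l j - l k ∉ Λ.lattice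
  zeros_ne_times : ∀ j k, l k - t j ∉ Λ.lattice
  sum_notMem : ∑ k, l k - ∑ k, t k ∉ Λ.lattice

/-- `lam k`, `mu k` are spectral Darboux coordinates of `X` over `U`: the `lam k` are continuous,
at each time they are the `N` zeros of `L₁₂` modulo the lattice (assumed distinct), normalized by
`∑ λ - ∑ t = q`, and `μ_k = L₁₁(λ_k)`. -/
structure IsSpectralDarboux (Λ : PeriodPair) (U : Set (Fin N → ℂ))
    (X : (Fin N → ℂ) → Phase N) (lam mu : Fin N → (Fin N → ℂ) → ℂ) : Prop where
  continuousOn : ∀ k, ContinuousOn (lam k) U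
  zeros : ∀ t ∈ U, ∀ z : ℂ, (∀ j, z - t j ∉ Λ.lattice) →
    (laxMatrix Λ t (X t) z 0 1 = 0 ↔ ∃ k, z - lam k t ∈ Λ.lattice)
  zeros_distinct : ∀ t ∈ U, ∀ j k, j ≠ k → lam j t - lam k t ∉ Λ.lattice
  zeros_ne_times : ∀ t ∈ U, ∀ j k, lam k t - t j ∉ Λ.lattice
  sum_eq : ∀ t ∈ U, ∑ k, lam k t - ∑ k, t k = (X t).q
  mu_eq : ∀ t ∈ U, ∀ k, mu k t = laxMatrix Λ t (X t) (lam k t) 0 0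

/-! ### The Hamiltonian system -/

/-- `∏ σ(z - a_k)`; this is `Q(z)` for `a = λ` and `P(z)` for `a = t`. -/
def sigmaProd (Λ : PeriodPair) (a : Fin N → ℂ) (z : ℂ) : ℂ := ∏ k : Fin N, sigma Λ (z - a k)

/-- The Hamiltonian `H_j` as a function of `(λ, μ, t)`, with
`w = t_j - λ_k + q = ∑_{l ≠ k} λ_l - ∑_{l ≠ j} t_l` and `C_l = θ_l² / 4`.
The product `σ(w) ζ(w)` is written as `σ'(w)`, so that the expression is meaningful
(by continuity) also where `σ(w) = 0`. -/
def specHam (Λ : PeriodPair) (θ : Fin N → ℂ) (j : Fin N) (l m t : Fin N → ℂ) : ℂ :=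
  ∑ k : Fin N,
    sigmaProd Λ l (t j) * sigmaProd Λ t (l k)
      / (deriv (sigmaProd Λ t) (t j) * deriv (sigmaProd Λ l) (l k) * sigma Λ (t j - l k)
          * sigma Λ (∑ i, l i - ∑ i, t i))
      * (sigma Λ (∑ i ∈ Finset.univ.erase k, l i - ∑ i ∈ Finset.univ.erase j, t i)
            * (m k ^ 2 - zeta Λ (t j - l k) * m k
              - ∑ i, θ i ^ 2 / 4 * Λ.weierstrassP (l k - t i))
          + deriv (sigma Λ) (∑ i ∈ Finset.univ.erase k, l i - ∑ i ∈ Finset.univ.erase j, t i)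
            * m k)

/-- `lam`, `mu` is a holomorphic solution over `U` (within general position) of
`∂λ_k/∂t_j = ∂H_j/∂μ_k`, `∂μ_k/∂t_j = -∂H_j/∂λ_k`. -/
structure IsHamiltonianSolution (Λ : PeriodPair) (θ : Fin N → ℂ) (U : Set (Fin N → ℂ))
    (lam mu : Fin N → (Fin N → ℂ) → ℂ) : Prop where
  regular : ∀ t ∈ U, IsRegular Λ t (fun k => lam k t)
  diff_lam : ∀ k, DifferentiableOn ℂ (lam k) U
  diff_mu : ∀ k, DifferentiableOn ℂ (mu k) U
  eq_lam : ∀ t ∈ U, ∀ j k, pderiv j (lam k) t =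
    pderiv k (fun m => specHam Λ θ j (fun i => lam i t) m t) (fun i => mu i t)
  eq_mu : ∀ t ∈ U, ∀ j k, pderiv j (mu k) t =
    -pderiv k (fun l => specHam Λ θ j l (fun i => mu i t) t) (fun i => lam i t)

end CalogeroGaudin

end

/-!
The proof separates the variables of the isomonodromic system. All of it rests on two Liouville
theorems for the lattice: a function with simple poles whose increments over periods are
multiples of the quasi-periods of `ζ` is a combination of shifted `ζ` functions
(`partial_fractions`), and a section without poles of a nontrivial line bundle of degree zero
vanishes (`eq_zero_of_multiplier`). Two consequences are used throughout. First, `L₁₂` and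
`Q / P` are sections of the same line bundle with the same zeros, so `L₁₂ = a Q / P` for a
constant `a` (`exists_eq_mul_ratioRes`, `phiSum_eq_ratio`). Second, an elliptic function with
simple poles at the `t_i` is determined by its values at the `λ_k`, even when only its total
residue is prescribed (`eq_of_values_eq`). Its interpolation basis is `lagrange`, and
`lagrangeZ` interpolates functions with a further pole at some `λ_m`.

*The Hamiltonians.* Written in terms of the residues of `lagrange` and `lagrangeZ`
(`specHam_eq`), the `H_j` are the residues at the `t_j` of an elliptic function with residues `-μ_k`
at the `λ_k` and constant terms there fixed by `μ_k` (`specHam_relation`). These separation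
relations characterize the `H_j`. The scalar second order equation obtained from `Y' = L Y` by
eliminating the second component has a potential with the same poles and constant terms at the
`λ_k`; comparing residues at the `t_i` gives the value of `H_j` along a solution
(`HasSpectralCoordinates.specHam_eq`).

*From the isomonodromic system to the Hamiltonian system.* With the brackets evaluated, the
flows take the Lax form `∂L/∂t_j = [M_j, L] + ∂M_j/∂z`, whose entries `laxDiag_flow` and
`laxUpper_flow` follow from the addition formula of `φ`. Differentiating `L₁₂(λ_k) = 0` and
`μ_k = L₁₁(λ_k)` in `t_j` and inserting the Lax form at `z = λ_k` gives the velocities of `λ_k`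
and `μ_k`. The first is `∂H_j/∂μ_k` by inspection (`pderiv_specHam_momentum`). For the second, the
separation relations are differentiated with respect to `λ_k` (`pderiv_specHam_position`), and
both the force and the velocity turn out to be the residue at `t_j` of elliptic functions with
the same values at the points `λ_m` (`HasSpectralCoordinates.neg_pderiv_specHam_position`). That
the `λ_k` are holomorphic follows from their continuity, as they are simple zeros of `L₁₂`
(`differentiableAt_of_implicit`).

*The converse.* Given `λ`, `μ`, interpolation defines a point of the phase space with
`L₁₂ = Q / P` and `L₁₁(λ_k) = μ_k` (`spectralPhase`). The computation above, read backwards, gives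
the Lax equation at the points `λ_k`. Its diagonal entry is determined by these values, which
yields the flows of `p` and `A_k³`; its upper entry is determined up to a multiple of `L₁₂`, and
this multiple defines the multiplier `p_j`
(`IsHamiltonianSolution.flow_p_A3`, `IsHamiltonianSolution.flow_Am`). The constraint
`∑ p_j = p` comes from the invariance under common translations of all times
(`IsHamiltonianSolution.sum_multiplier`), and the zero curvature equation for the `p_j` from the
equality of the mixed time derivatives of `L₁₂(z)` (`SatisfiesFlows.zero_curvature`).

*Uniqueness.* The coordinates fix `q`, the function `L₁₁`, and `L₁₂` up to the factor `a`, which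
is the diagonal gauge transformation (`IsSpectralDarboux.gauge_unique`).
-/

noncomputable section

namespace CalogeroGaudin

section

/-! ### The Weierstrass sigma function -/

/-- The primary factor `E(u) = (1 - u) exp (u + u² / 2)` is `1 + O(u³)`, since `E' = -u² exp(…)`.
This is what makes the product defining `σ` converge. -/
lemma norm_primary_sub_one_le {u : ℂ} (hu : ‖u‖ ≤ 1) :
    ‖(1 - u) * Complex.exp (u + u ^ 2 / 2) - 1‖ ≤ Real.exp 2 * ‖u‖ ^ 3 := by
  have hd : ∀ v : ℂ, HasDerivAt (fun v : ℂ => (1 - v) * Complex.exp (v + v ^ 2 / 2))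
      (-v ^ 2 * Complex.exp (v + v ^ 2 / 2)) v := by
    intro v
    have h1 : HasDerivAt (fun v : ℂ => v + v ^ 2 / 2) (1 + v) v := by
      have := (hasDerivAt_id v).add ((hasDerivAt_pow 2 v).div_const 2)
      refine this.congr_deriv ?_
      simp
    have := ((hasDerivAt_id v).const_sub 1).mul h1.cexp
    refine this.congr_deriv ?_
    simp only [id]
    ring
  have key := (convex_closedBall (0 : ℂ) ‖u‖).norm_image_sub_le_of_norm_hasDerivWithin_le
    (C := ‖u‖ ^ 2 * Real.exp 2)
    (fun x _ => (hd x).hasDerivWithinAt) ?_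
    (x := 0) (y := u) (by simp) (by simp)
  · simp only [sub_zero] at key
    refine le_trans (le_of_eq ?_) (key.trans (le_of_eq (by ring)))
    simp
  · intro x hx
    have hx' : ‖x‖ ≤ ‖u‖ := by simpa using hx
    rw [norm_mul, norm_neg, norm_pow, Complex.norm_exp]
    gcongr
    refine (Complex.re_le_norm _).trans ((norm_add_le _ _).trans ?_)
    have h2 : ‖x ^ 2 / 2‖ ≤ 1 := by
      rw [norm_div, norm_pow, RCLike.norm_ofNat]
      nlinarith [norm_nonneg x]
    linarith

/-- The nontrivial part `E(z / l) - 1` of the factor of `σ` at `l`, where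
`E(u) = (1 - u) exp (u + u² / 2)`; it is set to `0` at `l = 0`. -/
def sigmaFactor (Λ : PeriodPair) (l : Λ.lattice) (z : ℂ) : ℂ :=
  open Classical in
  if (l : ℂ) = 0 then 0
  else (1 - z / (l : ℂ)) * Complex.exp (z / (l : ℂ) + (z / l) ^ 2 / 2) - 1

/-- The entire function `σ(z) / z`. -/
def sigmaDiv (Λ : PeriodPair) (z : ℂ) : ℂ := ∏' l : Λ.lattice, (1 + sigmaFactor Λ l z)

lemma sigma_eq (Λ : PeriodPair) (z : ℂ) : sigma Λ z = z * sigmaDiv Λ z := by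
  unfold sigma sigmaDiv sigmaFactor
  congr 2
  ext l
  split_ifs with h
  · simp
  · rw [add_sub_cancel]
    congr 3
    field_simp

lemma norm_sigmaFactor_le (Λ : PeriodPair) {r : ℝ} {z : ℂ} (hz : ‖z‖ ≤ r) {l : Λ.lattice}
    (hl : r ≤ ‖(l : ℂ)‖) : ‖sigmaFactor Λ l z‖ ≤ Real.exp 2 * r ^ 3 * ‖l‖⁻¹ ^ 3 := by
  have hr : 0 ≤ r := (norm_nonneg z).trans hz
  unfold sigmaFactor
  split_ifs with h
  · simp only [norm_zero]
    positivity
  · have hl0 : 0 < ‖(l : ℂ)‖ := norm_pos_iff.mpr h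
    refine (norm_primary_sub_one_le ?_).trans ?_
    · rw [norm_div, div_le_one hl0]
      exact hz.trans hl
    · rw [norm_div, div_eq_mul_inv, mul_pow, mul_assoc]
      gcongr
      exact le_refl _

lemma summable_inv_cube (Λ : PeriodPair) (C : ℝ) :
    Summable (fun l : Λ.lattice => C * ‖l‖⁻¹ ^ 3) := by
  refine Summable.mul_left _ (ZLattice.summable_norm_pow_inv Λ.lattice 3 ?_)
  rw [Λ.finrank_lattice]; norm_num

lemma eventually_norm_ge (Λ : PeriodPair) (r : ℝ) : ∀ᶠ l : Λ.lattice in cofinite, r ≤ ‖(l : ℂ)‖ := by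
  refine (isCompact_iff_finite.mp (isCompact_closedBall (0 : Λ.lattice) r)).subset ?_
  intro l hl
  have hl' : ‖(l : ℂ)‖ < r := by simpa using hl
  simpa using hl'.le

lemma differentiable_sigmaFactor (Λ : PeriodPair) (l : Λ.lattice) :
    Differentiable ℂ (sigmaFactor Λ l) := by
  unfold sigmaFactor
  split_ifs with h
  · exact differentiable_const _
  · fun_prop

lemma hasProd_sigmaDiv (Λ : PeriodPair) :
    TendstoLocallyUniformlyOn (fun s z => ∏ l ∈ s, (1 + sigmaFactor Λ l z)) (sigmaDiv Λ)
      atTop Set.univ := by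
  rw [tendstoLocallyUniformlyOn_iff_forall_isCompact isOpen_univ]
  intro K _ hK
  obtain ⟨r, hr⟩ := hK.isBounded.exists_norm_le
  refine (Summable.hasProdUniformlyOn_one_add hK (summable_inv_cube Λ (Real.exp 2 * r ^ 3)) ?_
    (fun l => (differentiable_sigmaFactor Λ l).continuous.continuousOn)).tendstoUniformlyOn
  filter_upwards [eventually_norm_ge Λ r] with l hl z hz
  exact norm_sigmaFactor_le Λ (hr z hz) hl

lemma differentiable_sigmaDiv (Λ : PeriodPair) : Differentiable ℂ (sigmaDiv Λ) := by
  rw [← differentiableOn_univ]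
  refine (hasProd_sigmaDiv Λ).differentiableOn (.of_forall fun s => ?_) isOpen_univ
  exact (DifferentiableOn.fun_finsetProd fun l _ =>
    ((differentiable_sigmaFactor Λ l).const_add 1).differentiableOn)

lemma differentiable_sigma (Λ : PeriodPair) : Differentiable ℂ (sigma Λ) := by
  have : sigma Λ = fun z => z * sigmaDiv Λ z := funext (sigma_eq Λ)
  rw [this]
  exact differentiable_id.mul (differentiable_sigmaDiv Λ)

lemma one_add_sigmaFactor_ne_zero (Λ : PeriodPair) {z : ℂ} (hz : z ∈ Λ.lattice → z = 0)
    (l : Λ.lattice) : 1 + sigmaFactor Λ l z ≠ 0 := by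
  unfold sigmaFactor
  split_ifs with h
  · simp
  · rw [add_sub_cancel]
    refine mul_ne_zero ?_ (Complex.exp_ne_zero _)
    intro h0
    have hzl : z = l := by
      field_simp at h0
      linear_combination -h0
    exact h (hzl ▸ hz (hzl ▸ l.2))

lemma sigmaDiv_ne_zero (Λ : PeriodPair) {z : ℂ} (hz : z ∈ Λ.lattice → z = 0) :
    sigmaDiv Λ z ≠ 0 := by
  refine tprod_one_add_ne_zero_of_summable (one_add_sigmaFactor_ne_zero Λ hz) ?_
  refine (summable_inv_cube Λ (Real.exp 2 * ‖z‖ ^ 3)).of_norm_bounded_eventually ?_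
  filter_upwards [eventually_norm_ge Λ ‖z‖] with l hl
  rw [norm_norm]
  exact norm_sigmaFactor_le Λ le_rfl hl

@[simp] lemma sigmaDiv_zero (Λ : PeriodPair) : sigmaDiv Λ 0 = 1 := by
  simp [sigmaDiv, sigmaFactor]

@[simp] lemma sigma_zero (Λ : PeriodPair) : sigma Λ 0 = 0 := by simp [sigma_eq]

lemma sigma_ne_zero (Λ : PeriodPair) {z : ℂ} (hz : z ∉ Λ.lattice) : sigma Λ z ≠ 0 := by
  rw [sigma_eq]
  refine mul_ne_zero ?_ (sigmaDiv_ne_zero Λ fun h => absurd h hz)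
  rintro rfl
  exact hz (zero_mem _)

@[simp] lemma deriv_sigma_zero (Λ : PeriodPair) : deriv (sigma Λ) 0 = 1 := by
  have h : HasDerivAt (fun z => z * sigmaDiv Λ z) _ 0 :=
    (hasDerivAt_id (0 : ℂ)).mul (differentiable_sigmaDiv Λ 0).hasDerivAt
  have h2 : sigma Λ = fun z => z * sigmaDiv Λ z := funext (sigma_eq Λ)
  rw [h2, h.deriv]
  simp

lemma sigma_neg (Λ : PeriodPair) (z : ℂ) : sigma Λ (-z) = -sigma Λ z := by
  rw [sigma_eq, sigma_eq, sigmaDiv, sigmaDiv, ← (Equiv.neg Λ.lattice).tprod_eq]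
  rw [neg_mul]
  congr 3
  ext l
  simp [sigmaFactor]

lemma logDeriv_sigmaFactor (Λ : PeriodPair) {z : ℂ} (hz : z ∈ Λ.lattice → z = 0)
    (l : Λ.lattice) : logDeriv (fun z => 1 + sigmaFactor Λ l z) z =
      open Classical in if (l : ℂ) = 0 then 0 else 1 / (z - l) + 1 / l + z / l ^ 2 := by
  have hne := one_add_sigmaFactor_ne_zero Λ hz l
  unfold sigmaFactor at hne ⊢
  split_ifs with h
  · simp [logDeriv]
  · rw [if_neg h] at hne
    have h1 : HasDerivAt (fun z : ℂ => z / (l : ℂ) + (z / l) ^ 2 / 2) (1 / l + z / l ^ 2) z := by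
      have := ((hasDerivAt_id z).div_const (l : ℂ)).add
        ((((hasDerivAt_id z).div_const (l : ℂ)).pow 2).div_const 2)
      refine this.congr_deriv ?_
      have hl : (l : ℂ) ≠ 0 := h
      norm_num
      field_simp
    have h2 : HasDerivAt (fun z : ℂ => 1 + ((1 - z / (l : ℂ)) *
        Complex.exp (z / (l : ℂ) + (z / l) ^ 2 / 2) - 1)) _ z :=
      (((((hasDerivAt_id z).div_const (l : ℂ)).const_sub 1).mul h1.cexp).sub_const 1).const_add 1
    rw [logDeriv_apply, h2.deriv, div_eq_iff hne]
    rw [add_sub_cancel] at hne ⊢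
    have hzl : z - l ≠ 0 := by
      intro h0
      have hzl : z = l := by linear_combination h0
      exact h (hzl ▸ hz (hzl ▸ l.2))
    simp only [id]
    field_simp
    ring

lemma isOpen_compl_lattice_diff_zero (Λ : PeriodPair) :
    IsOpen {z : ℂ | z ∈ Λ.lattice → z = 0} := by
  have := Λ.isOpen_compl_lattice_sdiff (s := {0})
  convert this using 1
  ext z
  simp

/-- The second logarithmic derivative of `σ(z) / z` is `-(℘(z) - 1 / z²)`, by termwise
differentiation of the product; this links `σ` with Mathlib's `℘`. -/
lemma hasDerivAt_logDeriv_sigmaDiv (Λ : PeriodPair) {z : ℂ} (hz : z ∈ Λ.lattice → z = 0) :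
    HasDerivAt (logDeriv (sigmaDiv Λ)) (-Λ.weierstrassPExcept 0 z) z := by
  classical
  refine hasDerivAt_of_tendstoLocallyUniformlyOn (l := atTop)
    (f := fun (s : Finset Λ.lattice) (z : ℂ) => ∑ l ∈ s,
      if (l : ℂ) = 0 then 0 else 1 / (z - l) + 1 / (l : ℂ) + z / (l : ℂ) ^ 2)
    (f' := fun (s : Finset Λ.lattice) (z : ℂ) => -∑ l ∈ s,
      if (l : ℂ) = 0 then 0 else 1 / (z - l) ^ 2 - 1 / (l : ℂ) ^ 2)
    (g' := fun z => -Λ.weierstrassPExcept 0 z)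
    (isOpen_compl_lattice_diff_zero Λ) ?_ (.of_forall ?_) ?_ hz
  · have := (Λ.hasSumLocallyUniformly_weierstrassPExcept 0).hasSumLocallyUniformlyOn
      (s := {z : ℂ | z ∈ Λ.lattice → z = 0})
    have h2 : TendstoLocallyUniformlyOn _ _ _ _ := this
    exact h2.neg
  · intro s x hx
    simp only [Set.mem_ofPred_eq] at hx
    rw [← Finset.sum_neg_distrib]
    refine HasDerivAt.fun_sum fun l _ => ?_
    split_ifs with h
    · simpa using hasDerivAt_const x (0 : ℂ)
    · have hxl : x - l ≠ 0 := by
        intro h0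
        have hzl : x = l := by linear_combination h0
        exact h (hzl ▸ hx (hzl ▸ l.2))
      have h1 : HasDerivAt (fun z : ℂ => 1 / (z - l) + 1 / (l : ℂ) + z / l ^ 2) _ x :=
        ((((hasDerivAt_const x (1 : ℂ)).div ((hasDerivAt_id x).sub_const (l : ℂ)) hxl).add_const
          (1 / (l : ℂ)))).add ((hasDerivAt_id x).div_const ((l : ℂ) ^ 2))
      refine h1.congr_deriv ?_
      simp only [id]
      field_simp
      ring
  · intro x hx
    have h1 := Complex.logDeriv_tendsto isOpen_univ (Set.mem_univ x) (hasProd_sigmaDiv Λ)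
      (.of_forall fun s => DifferentiableOn.fun_finsetProd fun l _ =>
        ((differentiable_sigmaFactor Λ l).const_add 1).differentiableOn) (sigmaDiv_ne_zero Λ hx)
    refine h1.congr fun s => ?_
    rw [logDeriv_prod (fun l _ => one_add_sigmaFactor_ne_zero Λ hx l)
      (fun l _ => ((differentiable_sigmaFactor Λ l).const_add 1) x)]
    exact Finset.sum_congr rfl fun l _ => logDeriv_sigmaFactor Λ hx l

lemma zeta_eq (Λ : PeriodPair) {z : ℂ} (hz : z ∉ Λ.lattice) :
    zeta Λ z = 1 / z + logDeriv (sigmaDiv Λ) z := by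
  have hz0 : z ≠ 0 := by rintro rfl; exact hz (zero_mem _)
  have h2 : sigma Λ = fun z => z * sigmaDiv Λ z := funext (sigma_eq Λ)
  have hd : sigmaDiv Λ z ≠ 0 := sigmaDiv_ne_zero Λ fun h => absurd h hz
  have h : HasDerivAt (fun z => z * sigmaDiv Λ z) _ z :=
    (hasDerivAt_id z).mul (differentiable_sigmaDiv Λ z).hasDerivAt
  rw [zeta, h2, h.deriv, logDeriv_apply]
  simp only [id]
  field_simp

lemma hasDerivAt_zeta (Λ : PeriodPair) {z : ℂ} (hz : z ∉ Λ.lattice) :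
    HasDerivAt (zeta Λ) (-Λ.weierstrassP z) z := by
  have hz0 : z ≠ 0 := by rintro rfl; exact hz (zero_mem _)
  have h1 : HasDerivAt (fun z => 1 / z + logDeriv (sigmaDiv Λ) z) (-Λ.weierstrassP z) z := by
    have := ((hasDerivAt_const z (1 : ℂ)).div (hasDerivAt_id z) hz0).add
      (hasDerivAt_logDeriv_sigmaDiv Λ fun h => absurd h hz)
    refine this.congr_deriv ?_
    rw [← Λ.weierstrassPExcept_add 0 z]
    simp [neg_div]
  refine h1.congr_of_eventuallyEq ?_
  filter_upwards [Λ.isClosed_lattice.isOpen_compl.mem_nhds hz] with w hw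
  exact zeta_eq Λ hw

lemma hasDerivAt_sigma (Λ : PeriodPair) (z : ℂ) : HasDerivAt (sigma Λ) (deriv (sigma Λ) z) z :=
  (differentiable_sigma Λ z).hasDerivAt

lemma deriv_sigma_eq (Λ : PeriodPair) {z : ℂ} (hz : z ∉ Λ.lattice) :
    deriv (sigma Λ) z = zeta Λ z * sigma Λ z := by
  rw [zeta, div_mul_cancel₀ _ (sigma_ne_zero Λ hz)]

lemma deriv_sigma_neg (Λ : PeriodPair) (z : ℂ) : deriv (sigma Λ) (-z) = deriv (sigma Λ) z := by
  have h := (hasDerivAt_sigma Λ (-z)).comp z (hasDerivAt_neg z)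
  have h2 : sigma Λ ∘ Neg.neg = fun z => -sigma Λ z := funext (sigma_neg Λ)
  rw [h2] at h
  have := h.unique (hasDerivAt_sigma Λ z).neg
  linear_combination -this

lemma zeta_neg (Λ : PeriodPair) (z : ℂ) : zeta Λ (-z) = -zeta Λ z := by
  rw [zeta, zeta, deriv_sigma_neg, sigma_neg, div_neg]

/-! ### Quasi-periodicity -/

lemma countable_lattice (Λ : PeriodPair) : (Λ.lattice : Set ℂ).Countable := by
  have : Countable Λ.lattice := Λ.latticeEquivProd.toEquiv.countable_iff.mpr inferInstance
  exact Set.countable_coe_iff.mp this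

lemma isPreconnected_compl_lattice (Λ : PeriodPair) : IsPreconnected (Λ.lattice : Set ℂ)ᶜ := by
  refine ((countable_lattice Λ).isPathConnected_compl_of_one_lt_rank ?_).isConnected.isPreconnected
  rw [Complex.rank_real_complex]; norm_num

lemma dense_compl_lattice (Λ : PeriodPair) : Dense (Λ.lattice : Set ℂ)ᶜ :=
  (countable_lattice Λ).dense_compl ℝ

lemma add_notMem_iff (Λ : PeriodPair) {w z : ℂ} (hw : w ∈ Λ.lattice) :
    z + w ∉ Λ.lattice ↔ z ∉ Λ.lattice := not_congr (Submodule.add_mem_iff_left _ hw)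

/-- The quasi-period `η(w) = ζ(z + w) - ζ(z)` of `ζ`, read off at the half-period `z = ω₁ / 2`. -/
def eta (Λ : PeriodPair) (w : ℂ) : ℂ := zeta Λ (Λ.ω₁ / 2 + w) - zeta Λ (Λ.ω₁ / 2)

lemma zeta_add (Λ : PeriodPair) {w z : ℂ} (hw : w ∈ Λ.lattice) (hz : z ∉ Λ.lattice) :
    zeta Λ (z + w) = zeta Λ z + eta Λ w := by
  have hd : ∀ x ∈ (Λ.lattice : Set ℂ)ᶜ,
      HasDerivAt (fun x => zeta Λ (x + w) - zeta Λ x) 0 x := by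
    intro x hx
    have hx' : x ∉ Λ.lattice := hx
    have h1 := (hasDerivAt_zeta Λ ((add_notMem_iff Λ hw).mpr hx')).comp_add_const x w
    refine (h1.sub (hasDerivAt_zeta Λ hx')).congr_deriv ?_
    have := Λ.weierstrassP_add_coe x ⟨w, hw⟩
    simp only at this
    rw [this]; ring
  have := Λ.isClosed_lattice.isOpen_compl.is_const_of_deriv_eq_zero
    (isPreconnected_compl_lattice Λ)
    (fun x hx => (hd x hx).differentiableAt.differentiableWithinAt) (fun x hx => (hd x hx).deriv)
    (x := z) (y := Λ.ω₁ / 2) hz Λ.ω₁_div_two_notMem_lattice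
  rw [eta]
  linear_combination this

/-- `σ` is quasi-periodic, since `ζ` is so up to additive constants. The constant `c` is not needed
explicitly. -/
lemma exists_sigma_add (Λ : PeriodPair) {w : ℂ} (hw : w ∈ Λ.lattice) :
    ∃ c : ℂ, c ≠ 0 ∧ ∀ z, sigma Λ (z + w) = c * Complex.exp (eta Λ w * z) * sigma Λ z := by
  have hd : ∀ x ∈ (Λ.lattice : Set ℂ)ᶜ,
      HasDerivAt (fun x => sigma Λ (x + w) / sigma Λ x * Complex.exp (-(eta Λ w * x))) 0 x := by
    intro x hx
    have hx' : x ∉ Λ.lattice := hx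
    have hs := sigma_ne_zero Λ hx'
    have h1 := (hasDerivAt_sigma Λ (x + w)).comp_add_const x w
    have h2 := (h1.div (hasDerivAt_sigma Λ x) hs).mul
      ((hasDerivAt_id x).const_mul (eta Λ w)).fun_neg.cexp
    refine h2.congr_deriv ?_
    rw [deriv_sigma_eq Λ hx', deriv_sigma_eq Λ ((add_notMem_iff Λ hw).mpr hx'), zeta_add Λ hw hx']
    simp only [id, Pi.div_apply]
    field_simp
    ring
  obtain ⟨c, hc⟩ := Λ.isClosed_lattice.isOpen_compl.exists_is_const_of_deriv_eq_zero
    (isPreconnected_compl_lattice Λ)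
    (fun x hx => (hd x hx).differentiableAt.differentiableWithinAt) (fun x hx => (hd x hx).deriv)
  have key : ∀ z ∈ (Λ.lattice : Set ℂ)ᶜ,
      sigma Λ (z + w) = c * Complex.exp (eta Λ w * z) * sigma Λ z := by
    intro z hz
    rw [← hc z hz, Complex.exp_neg]
    have hs := sigma_ne_zero Λ hz
    field_simp
  refine ⟨c, ?_, ?_⟩
  · rintro rfl
    have h0 := Λ.ω₁_div_two_notMem_lattice
    have := key _ h0
    rw [zero_mul, zero_mul] at this
    exact sigma_ne_zero Λ ((add_notMem_iff Λ hw).mpr h0) this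
  · have hc1 : Continuous fun z => sigma Λ (z + w) :=
      (differentiable_sigma Λ).continuous.comp (continuous_add_const w)
    have hc2 : Continuous fun z => c * Complex.exp (eta Λ w * z) * sigma Λ z := by
      have := (differentiable_sigma Λ).continuous
      fun_prop
    exact fun z => congrFun (hc1.ext_on (dense_compl_lattice Λ) hc2 key) z

lemma sigma_coe (Λ : PeriodPair) {w : ℂ} (hw : w ∈ Λ.lattice) : sigma Λ w = 0 := by
  obtain ⟨c, _, h⟩ := exists_sigma_add Λ hw
  simpa using h 0

lemma sigma_eq_zero_iff (Λ : PeriodPair) {z : ℂ} : sigma Λ z = 0 ↔ z ∈ Λ.lattice :=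
  ⟨fun h => by by_contra hz; exact sigma_ne_zero Λ hz h, sigma_coe Λ⟩

lemma sigma_add_of_half_notMem (Λ : PeriodPair) {w : ℂ} (hw : w ∈ Λ.lattice)
    (hw2 : w / 2 ∉ Λ.lattice) (z : ℂ) :
    sigma Λ (z + w) = -Complex.exp (eta Λ w * (z + w / 2)) * sigma Λ z := by
  obtain ⟨c, _, h⟩ := exists_sigma_add Λ hw
  have h1 := h (-(w / 2))
  rw [show -(w / 2) + w = w / 2 by ring, sigma_neg] at h1
  have hs := sigma_ne_zero Λ hw2
  have h2 : c = -Complex.exp (eta Λ w * (w / 2)) := by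
    have h3 : (1 + c * Complex.exp (eta Λ w * -(w / 2))) * sigma Λ (w / 2) = 0 := by
      linear_combination h1
    have h4 := (mul_eq_zero.mp h3).resolve_right hs
    rw [mul_neg, Complex.exp_neg] at h4
    have he := Complex.exp_ne_zero (eta Λ w * (w / 2))
    field_simp at h4
    rw [← mul_div_assoc]
    linear_combination h4
  rw [h z, h2, mul_add, Complex.exp_add]
  ring

/-! ### Entire functions with additive quasi-periods -/

lemma exists_norm_le_of_periodic (Λ : PeriodPair) {f : ℂ → ℝ} (hf : Continuous f)
    (h1 : ∀ z, f (z + Λ.ω₁) = f z) (h2 : ∀ z, f (z + Λ.ω₂) = f z) : ∃ C, ∀ z, f z ≤ C := by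
  have hn1 : ∀ (n : ℤ) z, f (z + n * Λ.ω₁) = f z := by
    intro n z
    have : Function.Periodic f Λ.ω₁ := h1
    simpa using this.int_mul n z
  have hn2 : ∀ (n : ℤ) z, f (z + n * Λ.ω₂) = f z := by
    intro n z
    have : Function.Periodic f Λ.ω₂ := h2
    simpa using this.int_mul n z
  have hK : IsCompact (closure (ZSpan.fundamentalDomain Λ.basis)) :=
    (ZSpan.fundamentalDomain_isBounded Λ.basis).isCompact_closure
  obtain ⟨C, hC⟩ := hK.bddAbove_image hf.continuousOn
  refine ⟨C, fun z => ?_⟩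
  have hmem : (ZSpan.floor Λ.basis z : ℂ) ∈ Λ.lattice := by
    rw [Λ.lattice_eq_span_range_basis]
    exact (ZSpan.floor Λ.basis z).2
  obtain ⟨m, n, hmn⟩ := PeriodPair.mem_lattice.mp hmem
  have hz : z = ZSpan.fract Λ.basis z + m * Λ.ω₁ + n * Λ.ω₂ := by
    rw [ZSpan.fract_apply, ← hmn]; ring
  rw [hz, hn2, hn1]
  exact hC ⟨_, subset_closure (ZSpan.fract_mem_fundamentalDomain _ _), rfl⟩

lemma eq_const_of_periodic (Λ : PeriodPair) {f : ℂ → ℂ} (hf : Differentiable ℂ f)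
    (h1 : ∀ z, f (z + Λ.ω₁) = f z) (h2 : ∀ z, f (z + Λ.ω₂) = f z) (z w : ℂ) : f z = f w := by
  obtain ⟨C, hC⟩ := exists_norm_le_of_periodic Λ (f := fun z => ‖f z‖) hf.continuous.norm
    (fun z => by simp only [h1]) (fun z => by simp only [h2])
  refine hf.apply_eq_apply_of_bounded ?_ z w
  rw [isBounded_iff_forall_norm_le]
  exact ⟨C, by rintro _ ⟨z, rfl⟩; exact hC z⟩

/-- An entire function whose increments over periods are constant is affine. -/
lemma entire_quasiperiodic_affine (Λ : PeriodPair) {f : ℂ → ℂ} (hf : Differentiable ℂ f)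
    {κ : ℂ → ℂ} (h : ∀ w ∈ Λ.lattice, ∀ z, f (z + w) = f z + κ w) :
    ∃ a : ℂ, (∀ z, f z = f 0 + a * z) ∧ ∀ w ∈ Λ.lattice, κ w = a * w := by
  have hd : Differentiable ℂ (deriv f) := hf.deriv
  have hper : ∀ w ∈ Λ.lattice, ∀ z, deriv f (z + w) = deriv f z := by
    intro w hw z
    have h1 := (hf (z + w)).hasDerivAt.comp_add_const z w
    have h2 := (hf z).hasDerivAt.add_const (κ w)
    have h3 : (fun z => f (z + w)) = fun z => f z + κ w := funext (h w hw)
    rw [h3] at h1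
    exact h1.unique h2
  have hconst := eq_const_of_periodic Λ hd (hper _ Λ.ω₁_mem_lattice) (hper _ Λ.ω₂_mem_lattice)
  have key : ∀ z, f z = f 0 + deriv f 0 * z := by
    have h0 : ∀ z, HasDerivAt (fun z => f z - deriv f 0 * z) 0 z := by
      intro z
      refine ((hf z).hasDerivAt.sub ((hasDerivAt_id z).const_mul (deriv f 0))).congr_deriv ?_
      rw [hconst z 0]; ring
    intro z
    have := is_const_of_deriv_eq_zero (fun z => (h0 z).differentiableAt) (fun z => (h0 z).deriv) z 0
    linear_combination this
  refine ⟨deriv f 0, key, fun w hw => ?_⟩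
  have := h w hw 0
  rw [zero_add, key w] at this
  linear_combination -this

/-- The quasi-periods of `ζ` do not depend `ℂ`-linearly on the period. This replaces the Legendre
relation. If `η(w) = c w`, then `|σ(z) exp(-c z² / 2)|` is doubly periodic, so that
`σ(z) exp(-c z² / 2)` is constant, hence zero. -/
lemma eq_zero_of_eta_linear (Λ : PeriodPair) {s c : ℂ}
    (h : ∀ w ∈ Λ.lattice, s * eta Λ w = c * w) : s = 0 := by
  by_contra hs
  set d := c / s with hd
  have he : ∀ w ∈ Λ.lattice, eta Λ w = d * w := by
    intro w hw
    rw [hd]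
    field_simp
    linear_combination h w hw
  set f : ℂ → ℂ := fun z => Complex.exp (-(d * z ^ 2 / 2)) * sigma Λ z with hf
  have hfd : Differentiable ℂ f := by
    have := differentiable_sigma Λ
    fun_prop
  have hper : ∀ w ∈ Λ.lattice, w / 2 ∉ Λ.lattice → ∀ z, ‖f (z + w)‖ = ‖f z‖ := by
    intro w hw hw2 z
    have : f (z + w) = -f z := by
      simp only [hf]
      rw [sigma_add_of_half_notMem Λ hw hw2, he w hw]
      rw [← mul_assoc, mul_neg, ← Complex.exp_add, neg_mul]
      congr 3
      ring
    rw [this, norm_neg]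
  obtain ⟨C, hC⟩ := exists_norm_le_of_periodic Λ (f := fun z => ‖f z‖) hfd.continuous.norm
    (hper _ Λ.ω₁_mem_lattice Λ.ω₁_div_two_notMem_lattice)
    (hper _ Λ.ω₂_mem_lattice Λ.ω₂_div_two_notMem_lattice)
  have hbd : Bornology.IsBounded (Set.range f) := by
    rw [isBounded_iff_forall_norm_le]
    exact ⟨C, by rintro _ ⟨z, rfl⟩; exact hC z⟩
  have := hfd.apply_eq_apply_of_bounded hbd (Λ.ω₁ / 2) 0
  simp only [hf, sigma_zero, mul_zero] at this
  exact mul_ne_zero (Complex.exp_ne_zero _) (sigma_ne_zero Λ Λ.ω₁_div_two_notMem_lattice) this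

end

section

/-! ### Laurent expansions with poles of order at most two -/

/-- `f = s / (z - a)² + r / (z - a) + g` near `a` (the point `a` itself excluded), where `g` is
analytic at `a` and `g a = c`. -/
def HasLaurent (f : ℂ → ℂ) (a s r c : ℂ) : Prop :=
  ∃ g : ℂ → ℂ, AnalyticAt ℂ g a ∧ g a = c ∧
    ∀ᶠ z in 𝓝[≠] a, f z = s / (z - a) ^ 2 + r / (z - a) + g z

lemma analyticAt_dslope {f : ℂ → ℂ} {a : ℂ} (hf : AnalyticAt ℂ f a) :
    AnalyticAt ℂ (dslope f a) a := by
  obtain ⟨s, hs, hd⟩ := hf.exists_mem_nhds_analyticOnNhd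
  exact ((Complex.differentiableOn_dslope hs).mpr hd.differentiableOn).analyticAt hs

namespace HasLaurent

variable {f h : ℂ → ℂ} {a s r c s' r' c' : ℂ}

lemma of_analyticAt (hf : AnalyticAt ℂ f a) : HasLaurent f a 0 0 (f a) :=
  ⟨f, hf, rfl, .of_forall fun z => by simp⟩

lemma congr (hf : HasLaurent f a s r c) (hfh : f =ᶠ[𝓝[≠] a] h) : HasLaurent h a s r c := by
  obtain ⟨g, hg, hga, he⟩ := hf
  refine ⟨g, hg, hga, ?_⟩
  filter_upwards [he, hfh] with z h1 h2
  rw [← h2, h1]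

lemma congr_val (hf : HasLaurent f a s r c) (hs : s = s') (hr : r = r') (hc : c = c') :
    HasLaurent f a s' r' c' := by
  subst hs hr hc; exact hf

lemma add (hf : HasLaurent f a s r c) (hh : HasLaurent h a s' r' c') :
    HasLaurent (fun z => f z + h z) a (s + s') (r + r') (c + c') := by
  obtain ⟨g, hg, rfl, he⟩ := hf
  obtain ⟨g', hg', rfl, he'⟩ := hh
  refine ⟨g + g', hg.add hg', rfl, ?_⟩
  filter_upwards [he, he'] with z h1 h2
  rw [h1, h2, Pi.add_apply]
  ring

lemma const_mul (hf : HasLaurent f a s r c) (k : ℂ) :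
    HasLaurent (fun z => k * f z) a (k * s) (k * r) (k * c) := by
  obtain ⟨g, hg, rfl, he⟩ := hf
  refine ⟨fun z => k * g z, analyticAt_const.mul hg, rfl, ?_⟩
  filter_upwards [he] with z h1
  rw [h1]
  ring

lemma neg (hf : HasLaurent f a s r c) : HasLaurent (fun z => -f z) a (-s) (-r) (-c) := by
  simpa using hf.const_mul (-1)

lemma sub (hf : HasLaurent f a s r c) (hh : HasLaurent h a s' r' c') :
    HasLaurent (fun z => f z - h z) a (s - s') (r - r') (c - c') := by
  simpa [sub_eq_add_neg] using hf.add hh.neg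

lemma sum {ι : Type*} (S : Finset ι) {f : ι → ℂ → ℂ} {s r c : ι → ℂ}
    (hf : ∀ i ∈ S, HasLaurent (f i) a (s i) (r i) (c i)) :
    HasLaurent (fun z => ∑ i ∈ S, f i z) a (∑ i ∈ S, s i) (∑ i ∈ S, r i) (∑ i ∈ S, c i) := by
  classical
  induction S using Finset.induction_on with
  | empty => simpa using of_analyticAt (f := fun _ => (0 : ℂ)) (a := a) analyticAt_const
  | insert i S hi ih =>
    simp only [Finset.sum_insert hi]
    exact (hf i (by simp)).add (ih fun j hj => hf j (by simp [hj]))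

lemma eventually_sub_ne (a : ℂ) : ∀ᶠ z in 𝓝[≠] a, z - a ≠ 0 := by
  filter_upwards [self_mem_nhdsWithin] with z hz
  exact sub_ne_zero.mpr hz

lemma mul (hf : HasLaurent f a 0 r c) (hh : HasLaurent h a 0 r' c') :
    ∃ c'', HasLaurent (fun z => f z * h z) a (r * r') (r * c' + r' * c) c'' := by
  obtain ⟨g, hg, rfl, he⟩ := hf
  obtain ⟨g', hg', rfl, he'⟩ := hh
  have d1 := analyticAt_dslope hg
  have d2 := analyticAt_dslope hg'
  refine ⟨_, fun z => g z * g' z + r * dslope g' a z + r' * dslope g a z, by fun_prop, rfl, ?_⟩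
  filter_upwards [he, he', eventually_sub_ne a] with z h1 h2 hz
  have e1 : g z = g a + (z - a) * dslope g a z := by
    have := sub_smul_dslope g a z; simp only [smul_eq_mul] at this; linear_combination -this
  have e2 : g' z = g' a + (z - a) * dslope g' a z := by
    have := sub_smul_dslope g' a z; simp only [smul_eq_mul] at this; linear_combination -this
  rw [h1, h2, e1, e2]
  field_simp
  ring

lemma mul_analyticAt (hf : HasLaurent f a 0 r c) (hh : AnalyticAt ℂ h a) :
    HasLaurent (fun z => f z * h z) a 0 (r * h a) (c * h a + r * deriv h a) := by
  obtain ⟨g, hg, rfl, he⟩ := hf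
  have d1 := analyticAt_dslope hh
  refine ⟨fun z => g z * h z + r * dslope h a z, by fun_prop, by simp, ?_⟩
  filter_upwards [he, eventually_sub_ne a] with z h1 hz
  have e1 : h z = h a + (z - a) * dslope h a z := by
    have := sub_smul_dslope h a z; simp only [smul_eq_mul] at this; linear_combination -this
  rw [h1, e1]
  field_simp
  ring

/-- A simple pole of the product of a double pole and a simple zero; `deriv (dslope h a) a` is
`h''(a) / 2`. -/
lemma mul_zero (hf : HasLaurent f a s 0 c) (hh : AnalyticAt ℂ h a) (ha : h a = 0) :
    HasLaurent (fun z => f z * h z) a 0 (s * deriv h a) (s * deriv (dslope h a) a) := by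
  obtain ⟨g, hg, rfl, he⟩ := hf
  have d1 := analyticAt_dslope hh
  have d2 := analyticAt_dslope d1
  refine ⟨fun z => g z * h z + s * dslope (dslope h a) a z, by fun_prop, by simp [ha], ?_⟩
  filter_upwards [he, eventually_sub_ne a] with z h1 hz
  have e1 : h z = (z - a) * dslope h a z := by
    have := sub_smul_dslope h a z; simp only [smul_eq_mul] at this
    rw [this, ha, sub_zero]
  have e2 : dslope h a z = deriv h a + (z - a) * dslope (dslope h a) a z := by
    have := sub_smul_dslope (dslope h a) a z; simp only [smul_eq_mul, dslope_same] at this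
    linear_combination -this
  rw [h1, e1, e2]
  field_simp
  ring

lemma deriv (hf : HasLaurent f a 0 r c) : ∃ c', HasLaurent (deriv f) a (-r) 0 c' := by
  obtain ⟨g, hg, rfl, he⟩ := hf
  refine ⟨_, _root_.deriv g, hg.deriv, rfl, ?_⟩
  obtain ⟨V, hV, hVo, haV⟩ := eventually_nhds_iff.mp
    ((eventually_nhdsWithin_iff.mp he).and hg.eventually_analyticAt)
  filter_upwards [eventually_sub_ne a, mem_nhdsWithin_of_mem_nhds (hVo.mem_nhds haV),
    self_mem_nhdsWithin] with z hz hzV hne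
  have h1 : f =ᶠ[𝓝 z] fun z => r / (z - a) + g z := by
    filter_upwards [hVo.mem_nhds hzV, isOpen_compl_singleton.mem_nhds hne] with y hy hya
    rw [(hV y hy).1 hya]; simp
  rw [h1.deriv_eq]
  have h2 : HasDerivAt (fun z => r / (z - a) + g z) _ z :=
    ((hasDerivAt_const z r).div ((hasDerivAt_id z).sub_const a) hz).add
      (hV z hzV).2.differentiableAt.hasDerivAt
  rw [h2.deriv]
  simp

lemma unique (hf : HasLaurent f a 0 r c) (hf' : HasLaurent f a 0 r' c') : r = r' ∧ c = c' := by
  obtain ⟨g, hg, rfl, he⟩ := hf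
  obtain ⟨g', hg', rfl, he'⟩ := hf'
  have hgt : Tendsto g (𝓝[≠] a) (𝓝 (g a)) := hg.continuousAt.mono_left nhdsWithin_le_nhds
  have hgt' : Tendsto g' (𝓝[≠] a) (𝓝 (g' a)) := hg'.continuousAt.mono_left nhdsWithin_le_nhds
  have hz : Tendsto (fun z => z - a) (𝓝[≠] a) (𝓝 0) := by
    have : Tendsto (fun z => z - a) (𝓝 a) (𝓝 (a - a)) := by
      exact (continuous_id.sub continuous_const).tendsto a
    rw [sub_self] at this
    exact this.mono_left nhdsWithin_le_nhds
  have hrr : r - r' = 0 := by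
    have h1 : Tendsto (fun z => (z - a) * (g' z - g z)) (𝓝[≠] a) (𝓝 (0 * (g' a - g a))) :=
      hz.mul (hgt'.sub hgt)
    rw [zero_mul] at h1
    refine tendsto_nhds_unique (tendsto_const_nhds.congr' ?_) h1
    filter_upwards [he, he', eventually_sub_ne a] with z h1 h2 hz
    rw [h1] at h2
    have hz2 : z - a ≠ 0 := hz
    have e1 : r / (z - a) * (z - a) = r := div_mul_cancel₀ _ hz2
    have e2 : r' / (z - a) * (z - a) = r' := div_mul_cancel₀ _ hz2
    linear_combination (z - a) * h2 - e1 + e2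
  refine ⟨by linear_combination hrr, tendsto_nhds_unique (hgt.congr' ?_) hgt'⟩
  filter_upwards [he, he'] with z h1 h2
  rw [h1] at h2
  linear_combination h2 - hrr / (z - a)

lemma comp_sub (hf : HasLaurent f a s r c) (w : ℂ) :
    HasLaurent (fun z => f (z - w)) (a + w) s r c := by
  obtain ⟨g, hg, rfl, he⟩ := hf
  refine ⟨fun z => g (z - w), ?_, by simp, ?_⟩
  · exact AnalyticAt.fun_comp (by simpa using hg) (by fun_prop)
  · have ht : Tendsto (fun z => z - w) (𝓝[≠] (a + w)) (𝓝[≠] a) := by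
      refine tendsto_nhdsWithin_of_tendsto_nhds_of_eventually_within _ ?_ ?_
      · have : Tendsto (fun z => z - w) (𝓝 (a + w)) (𝓝 (a + w - w)) :=
          (continuous_id.sub continuous_const).tendsto _
        rw [add_sub_cancel_right] at this
        exact this.mono_left nhdsWithin_le_nhds
      · filter_upwards [self_mem_nhdsWithin] with z hz h
        simp only [Set.mem_singleton_iff] at h
        exact hz (by simp [← h])
    filter_upwards [ht.eventually he] with z hz
    rw [hz]
    ring

lemma comp_sub_zero (hf : HasLaurent f 0 s r c) (b : ℂ) :
    HasLaurent (fun z => f (z - b)) b s r c := by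
  simpa using hf.comp_sub b

/-- The residue, defined by limits of contour integrals, is the coefficient of `1 / (z - a)`. -/
lemma residue_eq (hf : HasLaurent f a s r c) : residue f a = r := by
  obtain ⟨g, hg, rfl, he⟩ := hf
  refine Tendsto.limUnder_eq (tendsto_const_nhds.congr' ?_)
  obtain ⟨ε, hε, hV⟩ := Metric.eventually_nhds_iff.mp
    ((eventually_nhdsWithin_iff.mp he).and hg.eventually_analyticAt)
  filter_upwards [Ioo_mem_nhdsGT hε] with ρ hρ
  have hρ0 : ρ ≠ 0 := hρ.1.ne'
  have hball : ∀ z ∈ Metric.closedBall a ρ, AnalyticAt ℂ g z := fun z hz =>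
    (hV (lt_of_le_of_lt (Metric.mem_closedBall.mp hz) hρ.2)).2
  have h1 : (∮ z in C(a, ρ), f z) = ∮ z in C(a, ρ), (s * (z - a) ^ (-2 : ℤ) + r * (z - a)⁻¹) + g z := by
    refine circleIntegral.integral_congr hρ.1.le fun z hz => ?_
    have hz1 : dist z a = ρ := hz
    have hza : z ≠ a := by
      rintro rfl
      rw [dist_self] at hz1
      exact hρ0 hz1.symm
    rw [(hV (by rw [hz1]; exact hρ.2)).1 hza, zpow_neg, div_eq_mul_inv, div_eq_mul_inv]
    norm_cast
  have hcg : ContinuousOn g (Metric.sphere a ρ) := fun z hz =>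
    (hball z (Metric.sphere_subset_closedBall hz)).continuousAt.continuousWithinAt
  have hc1 : ContinuousOn (fun z => s * (z - a) ^ (-2 : ℤ)) (Metric.sphere a ρ) := by
    refine continuousOn_const.mul (ContinuousOn.zpow₀ (by fun_prop) _ fun z hz => Or.inl ?_)
    intro h
    rw [sub_eq_zero] at h
    subst h
    simp only [mem_sphere_iff_norm, sub_self, norm_zero] at hz
    exact hρ0 hz.symm
  have hc2 : ContinuousOn (fun z => r * (z - a)⁻¹) (Metric.sphere a ρ) := by
    refine continuousOn_const.mul (ContinuousOn.inv₀ (by fun_prop) fun z hz => ?_)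
    intro h
    rw [sub_eq_zero] at h
    subst h
    simp only [mem_sphere_iff_norm, sub_self, norm_zero] at hz
    exact hρ0 hz.symm
  rw [h1, circleIntegral.integral_add (ContinuousOn.circleIntegrable hρ.1.le (hc1.fun_add hc2))
    (hcg.circleIntegrable hρ.1.le), circleIntegral.integral_add (hc1.circleIntegrable hρ.1.le)
    (hc2.circleIntegrable hρ.1.le), circleIntegral.integral_const_mul,
    circleIntegral.integral_const_mul,
    circleIntegral.integral_sub_zpow_of_ne (by norm_num), circleIntegral.integral_sub_center_inv a hρ0,
    Complex.circleIntegral_eq_zero_of_differentiable_on_off_countable hρ.1.le Set.countable_empty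
      (fun z hz => (hball z hz).continuousAt.continuousWithinAt)
      (fun z hz => (hball z (Metric.ball_subset_closedBall hz.1)).differentiableAt)]
  have : (2 * (Real.pi : ℂ) * Complex.I) ≠ 0 := Complex.two_pi_I_ne_zero
  field_simp
  ring

end HasLaurent

/-! ### Expansions of `ζ`, `℘`, `φ` -/

lemma analyticAt_sigma (Λ : PeriodPair) (z : ℂ) : AnalyticAt ℂ (sigma Λ) z :=
  (differentiable_sigma Λ).analyticAt z

lemma analyticAt_zeta (Λ : PeriodPair) {z : ℂ} (hz : z ∉ Λ.lattice) : AnalyticAt ℂ (zeta Λ) z :=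
  (analyticAt_sigma Λ z).deriv.div (analyticAt_sigma Λ z) (sigma_ne_zero Λ hz)

lemma analyticAt_weierstrassP (Λ : PeriodPair) {z : ℂ} (hz : z ∉ Λ.lattice) :
    AnalyticAt ℂ Λ.weierstrassP z := Λ.analyticOnNhd_weierstrassP z hz

lemma hasLaurent_zeta (Λ : PeriodPair) : HasLaurent (zeta Λ) 0 0 1 0 := by
  have hd : DifferentiableOn ℂ (logDeriv (sigmaDiv Λ)) {z : ℂ | z ∈ Λ.lattice → z = 0} :=
    fun z hz => (hasDerivAt_logDeriv_sigmaDiv Λ hz).differentiableAt.differentiableWithinAt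
  refine ⟨logDeriv (sigmaDiv Λ),
    hd.analyticAt ((isOpen_compl_lattice_diff_zero Λ).mem_nhds (by simp)), ?_, ?_⟩
  · have he : ∀ z, sigmaDiv Λ (-z) = sigmaDiv Λ z := by
      intro z
      rw [sigmaDiv, sigmaDiv, ← (Equiv.neg Λ.lattice).tprod_eq]
      congr 1
      ext l
      simp [sigmaFactor]
    have h1 := (differentiable_sigmaDiv Λ (-0)).hasDerivAt.comp 0 (hasDerivAt_neg 0)
    have h2 : sigmaDiv Λ ∘ Neg.neg = sigmaDiv Λ := funext he
    rw [h2] at h1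
    have h3 := h1.unique (differentiable_sigmaDiv Λ 0).hasDerivAt
    rw [neg_zero] at h3
    have h4 : deriv (sigmaDiv Λ) 0 = 0 := by linear_combination -h3 / 2
    rw [logDeriv_apply, h4, zero_div]
  · filter_upwards [mem_nhdsWithin_of_mem_nhds (Λ.compl_lattice_sdiff_singleton_mem_nhds 0),
      self_mem_nhdsWithin] with z hz hz0
    have : z ∉ Λ.lattice := fun h => hz ⟨h, hz0⟩
    rw [zeta_eq Λ this]
    simp

lemma hasLaurent_weierstrassP (Λ : PeriodPair) : HasLaurent Λ.weierstrassP 0 1 0 0 := by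
  refine ⟨Λ.weierstrassPExcept 0, Λ.analyticAt_weierstrassPExcept 0, Λ.weierstrassPExcept_zero 0,
    .of_forall fun z => ?_⟩
  rw [← Λ.weierstrassPExcept_add 0 z]
  simp [add_comm]

lemma eventually_notMem (Λ : PeriodPair) (b z : ℂ) : ∀ᶠ x in 𝓝[≠] z, x - b ∉ Λ.lattice := by
  have h := Λ.compl_lattice_sdiff_singleton_mem_nhds (z - b)
  have hc : ContinuousAt (fun x => x - b) z := by fun_prop
  filter_upwards [mem_nhdsWithin_of_mem_nhds (hc.preimage_mem_nhds h), self_mem_nhdsWithin]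
    with x hx hxz hmem
  exact hx ⟨hmem, fun h => hxz (by simpa using h)⟩

lemma eventually_forall_notMem (Λ : PeriodPair) {ι : Type*} [Finite ι] (a : ι → ℂ) (z : ℂ) :
    ∀ᶠ x in 𝓝[≠] z, ∀ i, x - a i ∉ Λ.lattice :=
  eventually_all.mpr fun i => eventually_notMem Λ (a i) z

lemma dense_forall_notMem (Λ : PeriodPair) {ι : Type*} [Finite ι] (a : ι → ℂ) :
    Dense {x : ℂ | ∀ i, x - a i ∉ Λ.lattice} := by
  intro z
  refine mem_closure_iff_frequently.mpr ?_
  exact ((eventually_forall_notMem Λ a z).frequently).filter_mono nhdsWithin_le_nhds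

lemma isOpen_notMem (Λ : PeriodPair) {X : Type*} [TopologicalSpace X] {f : X → ℂ}
    (hf : Continuous f) : IsOpen {x | f x ∉ Λ.lattice} :=
  Λ.isClosed_lattice.isOpen_compl.preimage hf

lemma phi_add (Λ : PeriodPair) {w : ℂ} (hw : w ∈ Λ.lattice) (u z : ℂ) :
    phi Λ u (z + w) = Complex.exp (-(eta Λ w * u)) * phi Λ u z := by
  obtain ⟨c, hc, h⟩ := exists_sigma_add Λ hw
  have h1 : sigma Λ (u - (z + w)) = c * Complex.exp (eta Λ w * (z - u)) * sigma Λ (u - z) := by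
    rw [show u - (z + w) = -(z - u + w) by ring, sigma_neg, h, ← neg_sub u z, sigma_neg]
    ring
  rw [phi, phi, h1, h, mul_sub, Complex.exp_sub, Complex.exp_neg]
  have e1 := Complex.exp_ne_zero (eta Λ w * z)
  have e2 := Complex.exp_ne_zero (eta Λ w * u)
  field_simp

lemma analyticAt_phi (Λ : PeriodPair) {u z : ℂ} (hu : u ∉ Λ.lattice) (hz : z ∉ Λ.lattice) :
    AnalyticAt ℂ (phi Λ u) z := by
  have h1 : AnalyticAt ℂ (fun z => sigma Λ (u - z)) z :=
    (analyticAt_sigma Λ (u - z)).fun_comp (by fun_prop)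
  exact h1.div (analyticAt_const.mul (analyticAt_sigma Λ z))
    (mul_ne_zero (sigma_ne_zero Λ hu) (sigma_ne_zero Λ hz))

lemma hasLaurent_inv_sigma (Λ : PeriodPair) : HasLaurent (fun z => (sigma Λ z)⁻¹) 0 0 1 0 := by
  have hz : zeta Λ = fun z => deriv (sigma Λ) z * (sigma Λ z)⁻¹ := by
    ext z; rw [zeta, div_eq_mul_inv]
  have h0 := hasLaurent_zeta Λ
  have hd := (analyticAt_sigma Λ 0).deriv
  have h1 := h0.mul_analyticAt (h := fun z => (deriv (sigma Λ) z)⁻¹) (hd.inv (by simp))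
  have h2 : deriv (fun z => (deriv (sigma Λ) z)⁻¹) 0 = 0 := by
    have h3 : HasDerivAt (deriv (sigma Λ)) (deriv (deriv (sigma Λ)) 0) (-0) := by
      rw [neg_zero]; exact hd.differentiableAt.hasDerivAt
    have h4 := h3.comp 0 (hasDerivAt_neg 0)
    have h5 : deriv (sigma Λ) ∘ Neg.neg = deriv (sigma Λ) := funext (deriv_sigma_neg Λ)
    rw [h5] at h4
    have h6 := h4.unique hd.differentiableAt.hasDerivAt
    have h7 : deriv (deriv (sigma Λ)) 0 = 0 := by linear_combination -h6 / 2
    have h8 := hd.differentiableAt.hasDerivAt.fun_inv (by simp)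
    rw [h8.deriv, h7]
    simp
  refine (h1.congr_val (r' := 1) (c' := 0) rfl ?_ ?_).congr ?_
  · simp
  · rw [h2]; simp
  · have : ∀ᶠ z in 𝓝 (0 : ℂ), deriv (sigma Λ) z ≠ 0 :=
      hd.continuousAt.eventually_ne (by simp)
    filter_upwards [mem_nhdsWithin_of_mem_nhds this] with z hz'
    rw [zeta]
    field_simp

lemma hasLaurent_phi (Λ : PeriodPair) {u : ℂ} (hu : u ∉ Λ.lattice) :
    HasLaurent (phi Λ u) 0 0 1 (-zeta Λ u) := by
  have hd : HasDerivAt (fun z => sigma Λ (u - z) / sigma Λ u) (-zeta Λ u) 0 := by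
    have := ((hasDerivAt_sigma Λ (u - 0)).comp_const_sub u 0).div_const (sigma Λ u)
    refine this.congr_deriv ?_
    rw [sub_zero, zeta, neg_div]
  have ha : AnalyticAt ℂ (fun z => sigma Λ (u - z) / sigma Λ u) 0 :=
    AnalyticAt.div ((analyticAt_sigma Λ (u - 0)).fun_comp (by fun_prop)) analyticAt_const
      (sigma_ne_zero Λ hu)
  refine (((hasLaurent_inv_sigma Λ).mul_analyticAt ha).congr_val rfl ?_ ?_).congr ?_
  · simp [sigma_ne_zero Λ hu]
  · rw [hd.deriv]; simp
  · refine .of_forall fun z => ?_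
    simp only [phi]
    have := sigma_ne_zero Λ hu
    field_simp

/-! ### Liouville theorems for elliptic functions -/

/-- A function with removable singularities at the points `a i` modulo the lattice and elsewhere
analytic, that is affine-periodic where it is analytic, extends to an entire function with the
same multipliers. -/
lemma exists_entire_extension (Λ : PeriodPair) {ι : Type*} [Finite ι] {a c : ι → ℂ} {f : ℂ → ℂ}
    {A B : ℂ → ℂ}
    (hper : ∀ w ∈ Λ.lattice, ∀ z, (∀ i, z - a i ∉ Λ.lattice) → f (z + w) = A w * f z + B w)
    (han : ∀ z, (∀ i, z - a i ∉ Λ.lattice) → AnalyticAt ℂ f z)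
    (hpol : ∀ i, HasLaurent f (a i) 0 0 (c i)) :
    ∃ F : ℂ → ℂ, Differentiable ℂ F ∧ (∀ z, (∀ i, z - a i ∉ Λ.lattice) → F z = f z) ∧
      (∀ i, F (a i) = c i) ∧ ∀ w ∈ Λ.lattice, ∀ z, F (z + w) = A w * F z + B w := by
  -- Every point has a punctured neighbourhood on which `f` agrees with an analytic germ; at a
  -- translate of `a i` the germ at `a i` is transported by the multipliers.
  have hloc : ∀ z, ∃ g : ℂ → ℂ, AnalyticAt ℂ g z ∧ f =ᶠ[𝓝[≠] z] g := by
    intro z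
    by_cases hz : ∀ i, z - a i ∉ Λ.lattice
    · exact ⟨f, han z hz, EventuallyEq.rfl⟩
    · push Not at hz
      obtain ⟨i, hi⟩ := hz
      obtain ⟨g, hg, _, he⟩ := (((hpol i).comp_sub (z - a i)).const_mul (A (z - a i))).add
        (HasLaurent.of_analyticAt (f := fun _ => B (z - a i)) analyticAt_const)
      rw [add_sub_cancel] at hg he
      refine ⟨g, hg, ?_⟩
      filter_upwards [he, eventually_forall_notMem Λ a z] with x hx hgen
      have h2 : ∀ j, x - (z - a i) - a j ∉ Λ.lattice := by
        intro j
        have := (add_notMem_iff Λ hi (z := x - (z - a i) - a j)).mp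
        refine this ?_
        rw [show x - (z - a i) - a j + (z - a i) = x - a j by ring]
        exact hgen j
      have h3 := hper _ hi _ h2
      rw [sub_add_cancel] at h3
      rw [h3, hx]
      simp
  choose g hg hfg using hloc
  -- The germs glue to the function `x ↦ g x x`.
  have hF : ∀ z, (fun x => g x x) =ᶠ[𝓝 z] g z := by
    intro z
    obtain ⟨V, hV, hVo, hzV⟩ := eventually_nhds_iff.mp
      ((eventually_nhdsWithin_iff.mp (hfg z)).and (hg z).eventually_analyticAt)
    filter_upwards [hVo.mem_nhds hzV] with x hx
    by_cases hxz : x = z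
    · rw [hxz]
    · have h1 : Tendsto (g x) (𝓝[≠] x) (𝓝 (g x x)) :=
        (hg x).continuousAt.mono_left nhdsWithin_le_nhds
      have h2 : Tendsto (g z) (𝓝[≠] x) (𝓝 (g z x)) :=
        (hV x hx).2.continuousAt.mono_left nhdsWithin_le_nhds
      refine tendsto_nhds_unique (h1.congr' ?_) h2
      filter_upwards [hfg x, mem_nhdsWithin_of_mem_nhds (hVo.mem_nhds hx),
        mem_nhdsWithin_of_mem_nhds (isOpen_compl_singleton.mem_nhds hxz)] with y hy hyV hyz
      rw [← hy, (hV y hyV).1 hyz]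
  have hFd : Differentiable ℂ fun x => g x x := fun z =>
    ((hg z).congr (hF z).symm).differentiableAt
  have hFf : ∀ z, (∀ i, z - a i ∉ Λ.lattice) → g z z = f z := by
    intro z hz
    have h1 : Tendsto (g z) (𝓝[≠] z) (𝓝 (g z z)) :=
      (hg z).continuousAt.mono_left nhdsWithin_le_nhds
    have h2 : Tendsto f (𝓝[≠] z) (𝓝 (f z)) :=
      (han z hz).continuousAt.mono_left nhdsWithin_le_nhds
    exact tendsto_nhds_unique h1 (h2.congr' (hfg z))
  refine ⟨fun x => g x x, hFd, hFf, ?_, ?_⟩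
  · intro i
    have h1 := (HasLaurent.of_analyticAt (hg (a i))).congr (hfg (a i)).symm
    exact (h1.unique (hpol i)).2
  · intro w hw
    have h1 : Continuous fun z => g (z + w) (z + w) := hFd.continuous.comp (continuous_add_const w)
    have h2 : Continuous fun z => A w * g z z + B w :=
      (continuous_const.mul hFd.continuous).add continuous_const
    refine fun z => congrFun (h1.ext_on (dense_forall_notMem Λ a) h2 ?_) z
    intro x hx
    have hx' : ∀ i, x - a i ∉ Λ.lattice := hx
    have hxw : ∀ i, x + w - a i ∉ Λ.lattice := by
      intro i
      rw [add_sub_right_comm]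
      exact (add_notMem_iff Λ hw).mpr (hx' i)
    simp only [hFf _ hx', hFf _ hxw, hper w hw x hx']

/-- Partial fractions: a function with at most simple poles, elliptic up to multiples of the
quasi-periods of `ζ`, is a combination of shifted `ζ` functions and a constant. -/
theorem partial_fractions (Λ : PeriodPair) {ι : Type*} [Fintype ι] [DecidableEq ι]
    {a r c : ι → ℂ} (ha : ∀ i j, i ≠ j → a i - a j ∉ Λ.lattice) {f : ℂ → ℂ} {s : ℂ}
    (hper : ∀ w ∈ Λ.lattice, ∀ z, (∀ i, z - a i ∉ Λ.lattice) → f (z + w) = f z + s * eta Λ w)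
    (han : ∀ z, (∀ i, z - a i ∉ Λ.lattice) → AnalyticAt ℂ f z)
    (hpol : ∀ i, HasLaurent f (a i) 0 (r i) (c i)) :
    ∑ i, r i = s ∧ ∃ b : ℂ,
      (∀ z, (∀ i, z - a i ∉ Λ.lattice) → f z = ∑ i, r i * zeta Λ (z - a i) + b) ∧
      ∀ i, c i = ∑ j ∈ Finset.univ.erase i, r j * zeta Λ (a i - a j) + b := by
  have hzan : ∀ (i : ι) (z : ℂ), z - a i ∉ Λ.lattice →
      AnalyticAt ℂ (fun z => r i * zeta Λ (z - a i)) z := fun i z hz =>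
    analyticAt_const.mul ((analyticAt_zeta Λ hz).fun_comp (f := fun z => z - a i) (by fun_prop))
  have hzpol : ∀ i, HasLaurent (fun z => ∑ j, r j * zeta Λ (z - a j)) (a i) 0 (r i)
      (∑ j ∈ Finset.univ.erase i, r j * zeta Λ (a i - a j)) := by
    intro i
    have h1 := HasLaurent.sum (Finset.univ.erase i) (fun j hj =>
      HasLaurent.of_analyticAt (hzan j (a i) (ha i j (Finset.ne_of_mem_erase hj).symm)))
    have h2 := ((hasLaurent_zeta Λ).comp_sub_zero (a i)).const_mul (r i)
    refine ((h2.add h1).congr_val (by simp) (by simp) (by simp)).congr (.of_forall fun z => ?_)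
    exact Finset.add_sum_erase Finset.univ (fun j => r j * zeta Λ (z - a j)) (Finset.mem_univ i)
  have hext := exists_entire_extension Λ (a := a) (f := fun z => f z - ∑ i, r i * zeta Λ (z - a i))
    (A := fun _ => 1) (B := fun w => (s - ∑ i, r i) * eta Λ w)
    (c := fun i => c i - ∑ j ∈ Finset.univ.erase i, r j * zeta Λ (a i - a j)) ?_ ?_ ?_
  · obtain ⟨F, hFd, hFf, hFa, hFper⟩ := hext
    simp only [one_mul] at hFper
    -- The remainder is affine of slope `α`, with `α w = (s - ∑ r) η(w)` for all periods `w`.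
    obtain ⟨α, hα, hα'⟩ := entire_quasiperiodic_affine Λ hFd hFper
    have hs : s - ∑ i, r i = 0 := eq_zero_of_eta_linear Λ hα'
    have hα0 : α = 0 := by
      have := hα' _ Λ.ω₁_mem_lattice
      rw [hs, zero_mul] at this
      refine (mul_eq_zero.mp this.symm).resolve_right ?_
      intro h0
      exact Λ.ω₁_div_two_notMem_lattice (by rw [h0]; simp)
    refine ⟨by linear_combination -hs, F 0, fun z hz => ?_, fun i => ?_⟩
    · have h1 := hFf z hz
      rw [hα z, hα0] at h1
      linear_combination -h1
    · have h1 := hFa i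
      rw [hα (a i), hα0] at h1
      linear_combination -h1
  · intro w hw z hz
    have h1 : ∑ i, r i * zeta Λ (z + w - a i) = ∑ i, r i * zeta Λ (z - a i) + (∑ i, r i) * eta Λ w := by
      rw [Finset.sum_mul, ← Finset.sum_add_distrib]
      refine Finset.sum_congr rfl fun i _ => ?_
      rw [add_sub_right_comm, zeta_add Λ hw (hz i)]
      ring
    rw [hper w hw z hz, h1]
    ring
  · intro z hz
    exact (han z hz).sub (Finset.univ.analyticAt_fun_sum fun i _ => hzan i z (hz i))
  · intro i
    exact ((hpol i).sub (hzpol i)).congr_val (by simp) (by simp) rfl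

/-- A function without poles whose multipliers are those of `φ(-κ, ·)` with `κ` not a period
vanishes: its product with `φ(κ, ·)` is elliptic with at most a simple pole at `0`, hence
constant, and this product vanishes at `κ`. -/
theorem eq_zero_of_multiplier (Λ : PeriodPair) {ι : Type*} [Finite ι]
    {a c : ι → ℂ} {f : ℂ → ℂ} {κ : ℂ} (hκ : κ ∉ Λ.lattice)
    (hper : ∀ w ∈ Λ.lattice, ∀ z, (∀ i, z - a i ∉ Λ.lattice) →
      f (z + w) = Complex.exp (eta Λ w * κ) * f z)
    (han : ∀ z, (∀ i, z - a i ∉ Λ.lattice) → AnalyticAt ℂ f z)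
    (hpol : ∀ i, HasLaurent f (a i) 0 0 (c i)) :
    (∀ z, (∀ i, z - a i ∉ Λ.lattice) → f z = 0) ∧ ∀ i, c i = 0 := by
  obtain ⟨F, hFd, hFf, hFa, hFper⟩ := exists_entire_extension Λ (a := a) (f := f)
    (A := fun w => Complex.exp (eta Λ w * κ)) (B := fun _ => 0)
    (fun w hw z hz => by simpa using hper w hw z hz) han hpol
  have hpf := partial_fractions Λ (ι := Unit) (a := fun _ => 0) (r := fun _ => 1 * F 0)
    (c := fun _ => -zeta Λ κ * F 0 + 1 * deriv F 0)
    (f := fun z => phi Λ κ z * F z) (s := 0) (fun i j h => absurd rfl h) ?_ ?_ ?_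
  · obtain ⟨h0, b, hb, _⟩ := hpf
    simp only [Finset.univ_unique, Finset.sum_singleton, sub_zero, one_mul, forall_const] at h0 hb
    simp only [h0, zero_mul, zero_add] at hb
    have hb0 : b = 0 := by
      rw [← hb κ hκ]
      simp [phi]
    have hF0 : ∀ z, F z = 0 := by
      have hc : Continuous F := hFd.continuous
      refine fun z => congrFun (hc.ext_on (dense_forall_notMem Λ ![0, κ]) continuous_const ?_) z
      intro x hx
      have hx0 : x ∉ Λ.lattice := by simpa using hx 0
      have hx1 : κ - x ∉ Λ.lattice := by
        have h2 := hx 1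
        rw [show κ - x = -(x - κ) by ring, neg_mem_iff]
        simpa using h2
      have h3 := hb x hx0
      rw [hb0] at h3
      refine (mul_eq_zero.mp h3).resolve_left ?_
      exact div_ne_zero (sigma_ne_zero Λ hx1)
        (mul_ne_zero (sigma_ne_zero Λ hκ) (sigma_ne_zero Λ hx0))
    exact ⟨fun z hz => by rw [← hFf z hz, hF0], fun i => by rw [← hFa, hF0]⟩
  · intro w hw z _
    rw [phi_add Λ hw, hFper w hw, Complex.exp_neg]
    have := Complex.exp_ne_zero (eta Λ w * κ)
    field_simp
    ring
  · intro z hz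
    exact (analyticAt_phi Λ hκ (by simpa using hz)).mul (hFd.analyticAt z)
  · intro _
    exact (hasLaurent_phi Λ hκ).mul_analyticAt (hFd.analyticAt 0)

end

section

/-! ### Derivatives and the addition formula of `φ` -/

/-- `∂φ/∂z`. -/
def phiZ (Λ : PeriodPair) (u z : ℂ) : ℂ :=
  -(deriv (sigma Λ) (u - z) + sigma Λ (u - z) * zeta Λ z) / (sigma Λ u * sigma Λ z)

/-- `∂²φ/∂u∂z`. -/
def phiUZ (Λ : PeriodPair) (u z : ℂ) : ℂ :=
  (-deriv (deriv (sigma Λ)) (u - z) + deriv (sigma Λ) (u - z) * zeta Λ u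
    - zeta Λ z * (deriv (sigma Λ) (u - z) - sigma Λ (u - z) * zeta Λ u))
    / (sigma Λ u * sigma Λ z)

variable (Λ : PeriodPair)

lemma hasDerivAt_phi_left {u : ℂ} (hu : u ∉ Λ.lattice) (z : ℂ) :
    HasDerivAt (fun v => phi Λ v z)
      ((deriv (sigma Λ) (u - z) - sigma Λ (u - z) * zeta Λ u) / (sigma Λ u * sigma Λ z)) u := by
  have hs := sigma_ne_zero Λ hu
  have h1 := ((((hasDerivAt_sigma Λ (u - z)).comp_sub_const u z).div (hasDerivAt_sigma Λ u) hs).div_const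
    (sigma Λ z))
  have h2 : (fun v => phi Λ v z) = fun v => sigma Λ (v - z) / sigma Λ v / sigma Λ z := by
    ext v; rw [phi, div_div]
  rw [h2]
  refine h1.congr_deriv ?_
  rw [deriv_sigma_eq Λ hu, ← div_div]
  congr 1
  field_simp

lemma phiU_eq {u : ℂ} (hu : u ∉ Λ.lattice) (z : ℂ) : phiU Λ u z =
    (deriv (sigma Λ) (u - z) - sigma Λ (u - z) * zeta Λ u) / (sigma Λ u * sigma Λ z) :=
  (hasDerivAt_phi_left Λ hu z).deriv

lemma hasDerivAt_phiU {u : ℂ} (hu : u ∉ Λ.lattice) (z : ℂ) :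
    HasDerivAt (fun v => phi Λ v z) (phiU Λ u z) u := by
  rw [phiU_eq Λ hu]
  exact hasDerivAt_phi_left Λ hu z

lemma hasDerivAt_phi_right (u : ℂ) {z : ℂ} (hz : z ∉ Λ.lattice) :
    HasDerivAt (phi Λ u) (phiZ Λ u z) z := by
  have hs := sigma_ne_zero Λ hz
  have h1 := (((hasDerivAt_sigma Λ (u - z)).comp_const_sub u z).div (hasDerivAt_sigma Λ z) hs).div_const
    (sigma Λ u)
  have h2 : phi Λ u = fun z => sigma Λ (u - z) / sigma Λ z / sigma Λ u := by
    ext v; rw [phi, div_div, mul_comm]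
  rw [h2]
  refine h1.congr_deriv ?_
  rw [deriv_sigma_eq Λ hz, phiZ, mul_comm (sigma Λ u), ← div_div]
  congr 1
  field_simp
  ring

/-- The chain rule for `φ` along a curve. -/
lemma hasDerivAt_phi_comp {q x : ℂ → ℂ} {q' x' s : ℂ} (hq : HasDerivAt q q' s)
    (hx : HasDerivAt x x' s) (hq0 : q s ∉ Λ.lattice) (hx0 : x s ∉ Λ.lattice) :
    HasDerivAt (fun s => phi Λ (q s) (x s))
      (phiU Λ (q s) (x s) * q' + phiZ Λ (q s) (x s) * x') s := by
  have hs := sigma_ne_zero Λ hq0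
  have hs' := sigma_ne_zero Λ hx0
  have h1 := ((hasDerivAt_sigma Λ (q s - x s)).comp s (hq.sub hx)).div
    (((hasDerivAt_sigma Λ (q s)).comp s hq).mul ((hasDerivAt_sigma Λ (x s)).comp s hx))
    (mul_ne_zero hs hs')
  refine h1.congr_deriv ?_
  rw [phiU_eq Λ hq0, phiZ]
  simp only [Function.comp_apply, Pi.mul_apply, Pi.sub_apply]
  rw [deriv_sigma_eq Λ hq0, deriv_sigma_eq Λ hx0]
  field_simp
  ring

lemma hasDerivAt_deriv_sigma (z : ℂ) :
    HasDerivAt (deriv (sigma Λ)) (deriv (deriv (sigma Λ)) z) z :=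
  ((differentiable_sigma Λ).deriv z).hasDerivAt

lemma hasDerivAt_phiU_right {u z : ℂ} (hu : u ∉ Λ.lattice) (hz : z ∉ Λ.lattice) :
    HasDerivAt (phiU Λ u) (phiUZ Λ u z) z := by
  have h2 : phiU Λ u = fun z =>
      (deriv (sigma Λ) (u - z) - sigma Λ (u - z) * zeta Λ u) / (sigma Λ u * sigma Λ z) :=
    funext (phiU_eq Λ hu)
  have hs := sigma_ne_zero Λ hu
  have hs' := sigma_ne_zero Λ hz
  have h1 := (((hasDerivAt_deriv_sigma Λ (u - z)).comp_const_sub u z).sub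
    (((hasDerivAt_sigma Λ (u - z)).comp_const_sub u z).mul_const (zeta Λ u))).div
    ((hasDerivAt_sigma Λ z).const_mul (sigma Λ u)) (mul_ne_zero hs hs')
  rw [h2]
  refine h1.congr_deriv ?_
  simp only [Pi.sub_apply]
  rw [deriv_sigma_eq Λ hz, phiUZ]
  field_simp
  ring

lemma hasDerivAt_phiZ_left {u z : ℂ} (hu : u ∉ Λ.lattice) (hz : z ∉ Λ.lattice) :
    HasDerivAt (fun u => phiZ Λ u z) (phiUZ Λ u z) u := by
  have hs := sigma_ne_zero Λ hu
  have hs' := sigma_ne_zero Λ hz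
  have h1 := (((hasDerivAt_deriv_sigma Λ (u - z)).comp_sub_const u z).add
    (((hasDerivAt_sigma Λ (u - z)).comp_sub_const u z).mul_const (zeta Λ z))).neg.div
    ((hasDerivAt_sigma Λ u).mul_const (sigma Λ z)) (mul_ne_zero hs hs')
  refine h1.congr_deriv ?_
  simp only [Pi.add_apply, Pi.neg_apply]
  rw [deriv_sigma_eq Λ hu, phiUZ]
  field_simp
  ring

lemma phi_neg_left (u z : ℂ) : phi Λ (-u) z = -phi Λ u (-z) := by
  rw [phi, phi, show -u - z = -(u - -z) by ring, sigma_neg, sigma_neg, sigma_neg]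
  rw [neg_mul, mul_neg, neg_div_neg_eq, div_neg, neg_neg]

lemma phiU_neg_left (u z : ℂ) : phiU Λ (-u) z = phiU Λ u (-z) := by
  have h : (fun v => phi Λ v z) = fun v => -phi Λ (-v) (-z) := by
    ext v; rw [phi_neg_left, neg_neg, neg_neg]
  rw [phiU, h, deriv.fun_neg, deriv_comp_neg (fun v => phi Λ v (-z)), neg_neg, neg_neg, phiU]

lemma phiZ_neg_neg (u z : ℂ) : phiZ Λ (-u) (-z) = phiZ Λ u z := by
  rw [phiZ, phiZ, show -u - -z = -(u - z) by ring, deriv_sigma_neg, sigma_neg, sigma_neg, sigma_neg,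
    zeta_neg]
  ring

lemma phiZ_add {w z : ℂ} (hw : w ∈ Λ.lattice) (u : ℂ) (hz : z ∉ Λ.lattice) :
    phiZ Λ u (z + w) = Complex.exp (-(eta Λ w * u)) * phiZ Λ u z := by
  have h1 := (hasDerivAt_phi_right Λ u ((add_notMem_iff Λ hw).mpr hz)).comp_add_const z w
  have h2 := (hasDerivAt_phi_right Λ u hz).const_mul (Complex.exp (-(eta Λ w * u)))
  have h3 : (fun z => phi Λ u (z + w)) = fun z => Complex.exp (-(eta Λ w * u)) * phi Λ u z :=
    funext (phi_add Λ hw u)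
  rw [h3] at h1
  exact h1.unique h2

lemma hasLaurent_phiZ {u : ℂ} (hu : u ∉ Λ.lattice) :
    ∃ c, HasLaurent (phiZ Λ u) 0 (-1) 0 c := by
  obtain ⟨c, hc⟩ := (hasLaurent_phi Λ hu).deriv
  refine ⟨c, hc.congr ?_⟩
  filter_upwards [eventually_notMem Λ 0 0] with z hz
  exact (hasDerivAt_phi_right Λ u (by simpa using hz)).deriv

lemma analyticAt_phiZ {u z : ℂ} (hu : u ∉ Λ.lattice) (hz : z ∉ Λ.lattice) :
    AnalyticAt ℂ (phiZ Λ u) z := by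
  have h1 : AnalyticAt ℂ (fun z => sigma Λ (u - z)) z :=
    (analyticAt_sigma Λ (u - z)).fun_comp (by fun_prop)
  have h2 : AnalyticAt ℂ (fun z => deriv (sigma Λ) (u - z)) z :=
    (analyticAt_sigma Λ (u - z)).deriv.fun_comp (by fun_prop)
  exact ((h2.add (h1.mul (analyticAt_zeta Λ hz))).neg).div
    (analyticAt_const.mul (analyticAt_sigma Λ z))
    (mul_ne_zero (sigma_ne_zero Λ hu) (sigma_ne_zero Λ hz))

/-- The addition formula of `φ`, obtained by decomposing the left-hand side into partial fractions
with respect to `x`. -/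
theorem phi_mul_phi_neg {u x y : ℂ} (hu : u ∉ Λ.lattice) (hx : x ∉ Λ.lattice)
    (hy : y ∉ Λ.lattice) (hxy : x - y ∉ Λ.lattice) :
    phi Λ u x * phi Λ (-u) y
      = (zeta Λ y - zeta Λ x) * phi Λ u (x - y) - phiU Λ u (x - y) := by
  set d := x - y with hd
  have hu' : -u ∉ Λ.lattice := fun h => hu (by simpa using neg_mem h)
  have hd' : -d ∉ Λ.lattice := fun h => hxy (by simpa using neg_mem h)
  have hsub : ∀ {z : ℂ} (b : ℂ), z - b ∉ Λ.lattice → AnalyticAt ℂ (fun z => phi Λ (-u) (z - b)) z :=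
    fun b hz => (analyticAt_phi Λ hu' hz).fun_comp (f := fun z => z - b) (by fun_prop)
  -- As a function of `z = x`, with `d = x - y` fixed, the product `φ(u, z) φ(-u, z - d)` is elliptic
  -- with poles at `0` and `d`; its constant term at `0` determines the additive constant.
  have hpf := partial_fractions Λ (ι := Fin 2) (a := ![0, d])
    (r := ![1 * phi Λ (-u) (0 - d), phi Λ u d])
    (c := ![-zeta Λ u * phi Λ (-u) (0 - d) + 1 * deriv (fun z => phi Λ (-u) (z - d)) 0,
      zeta Λ u * phi Λ u d + deriv (phi Λ u) d])
    (f := fun z => phi Λ u z * phi Λ (-u) (z - d)) (s := 0) ?_ ?_ ?_ ?_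
  · obtain ⟨-, b, hb, hc⟩ := hpf
    have h1 := hb x (by intro i; fin_cases i <;> simpa [hd])
    have h2 := hc 0
    have e0 : (Finset.univ.erase (0 : Fin 2)) = {1} := by decide
    have hder : deriv (fun z => phi Λ (-u) (z - d)) 0 = phiZ Λ u d := by
      have h3 : HasDerivAt (phi Λ (-u)) (phiZ Λ (-u) (0 - d)) (0 - d) :=
        hasDerivAt_phi_right Λ (-u) (by simpa using hd')
      have h4 := h3.comp_sub_const 0 d
      rw [h4.deriv, zero_sub, phiZ_neg_neg]
    rw [e0] at h2
    simp only [Fin.isValue, Fin.sum_univ_two, Matrix.cons_val_zero, Matrix.cons_val_one,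
      Finset.sum_singleton, zero_sub, one_mul, sub_zero, zeta_neg, hder, phi_neg_left Λ u (-d),
      neg_neg] at h1 h2
    have hsd := sigma_ne_zero Λ hxy
    have hsu := sigma_ne_zero Λ hu
    have h5 : phiZ Λ u d = -phiU Λ u d - (zeta Λ u + zeta Λ d) * phi Λ u d := by
      rw [phiZ, phiU_eq Λ hu, phi]
      field_simp
      ring
    have e1 : x - d = y := by rw [hd]; ring
    rw [e1] at h1
    linear_combination h1 - h2 + h5
  · intro i j hij
    fin_cases i <;> fin_cases j
    · exact absurd rfl hij
    · simpa using hxy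
    · simpa using hxy
    · exact absurd rfl hij
  · intro w hw z _
    rw [phi_add Λ hw, add_sub_right_comm, phi_add Λ hw, mul_neg, neg_neg, Complex.exp_neg]
    have := Complex.exp_ne_zero (eta Λ w * u)
    field_simp
    ring
  · intro z hz
    have h0 := hz 0
    have h1 := hz 1
    simp only [Fin.isValue, Matrix.cons_val_zero, Matrix.cons_val_one, sub_zero] at h0 h1
    exact (analyticAt_phi Λ hu h0).mul (hsub d h1)
  · intro i
    fin_cases i
    · exact (hasLaurent_phi Λ hu).mul_analyticAt (hsub d (by simpa using hd'))
    · have h1 := ((hasLaurent_phi Λ hu').comp_sub_zero d).mul_analyticAt (analyticAt_phi Λ hu hxy)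
      refine (h1.congr_val rfl (by simp) (by simp [zeta_neg])).congr
        (.of_forall fun z => mul_comm _ _)

/-- The addition formula of `φ` with `y - x` in place of `y`. -/
lemma phiU_add_zeta_mul_phi {u x y : ℂ} (hu : u ∉ Λ.lattice) (hx : x ∉ Λ.lattice)
    (hy : y ∉ Λ.lattice) (hyx : y - x ∉ Λ.lattice) :
    phiU Λ u x + (zeta Λ y - zeta Λ (y - x)) * phi Λ u x + phi Λ u y * phi Λ (-u) (y - x) = 0 := by
  have := phi_mul_phi_neg Λ hu hy hyx (by simpa using hx)
  rw [sub_sub_cancel] at this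
  rw [this]
  ring

end

section

/-! ### The quotient `Q / P` of sigma products -/

variable {N : ℕ}

/-- `∏_{k ≠ i} σ(z - a_k)`. -/
def sigmaProdErase (Λ : PeriodPair) (a : Fin N → ℂ) (i : Fin N) (z : ℂ) : ℂ :=
  ∏ k ∈ Finset.univ.erase i, sigma Λ (z - a k)

/-- `∑ λ - ∑ t`. -/
def charge (t l : Fin N → ℂ) : ℂ := ∑ k, l k - ∑ k, t k

/-- The function `Q / P`, to which `L₁₂` is proportional. -/
def ratio (Λ : PeriodPair) (t l : Fin N → ℂ) (z : ℂ) : ℂ := sigmaProd Λ l z / sigmaProd Λ t z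

/-- The residue of `Q / P` at `t_i`. -/
def ratioRes (Λ : PeriodPair) (t l : Fin N → ℂ) (i : Fin N) : ℂ :=
  sigmaProd Λ l (t i) / sigmaProdErase Λ t i (t i)

/-- The derivative of `Q / P` at `λ_m`. -/
def ratioDeriv (Λ : PeriodPair) (t l : Fin N → ℂ) (m : Fin N) : ℂ :=
  sigmaProdErase Λ l m (l m) / sigmaProd Λ t (l m)

/-- The logarithmic derivative of `Q / P`. -/
def logRatio (Λ : PeriodPair) (t l : Fin N → ℂ) (z : ℂ) : ℂ :=
  ∑ k, zeta Λ (z - l k) - ∑ k, zeta Λ (z - t k)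

/-- The constant term at `λ_m` of the logarithmic derivative of `Q / P`. -/
def logRatioZero (Λ : PeriodPair) (t l : Fin N → ℂ) (m : Fin N) : ℂ :=
  ∑ k ∈ Finset.univ.erase m, zeta Λ (l m - l k) - ∑ k, zeta Λ (l m - t k)

/-- The constant term at `t_i` of the logarithmic derivative of `Q / P`. -/
def logRatioPole (Λ : PeriodPair) (t l : Fin N → ℂ) (i : Fin N) : ℂ :=
  ∑ k, zeta Λ (t i - l k) - ∑ k ∈ Finset.univ.erase i, zeta Λ (t i - t k)

/-- `z` is congruent to none of the `t_i`, `λ_k`. -/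
def IsGeneric (Λ : PeriodPair) (t l : Fin N → ℂ) (z : ℂ) : Prop :=
  (∀ i, z - t i ∉ Λ.lattice) ∧ ∀ k, z - l k ∉ Λ.lattice

variable {Λ : PeriodPair} {t l : Fin N → ℂ}

lemma sub_notMem_comm {x y : ℂ} : x - y ∉ Λ.lattice ↔ y - x ∉ Λ.lattice := by
  rw [← neg_sub y x, neg_mem_iff]

lemma isGeneric_iff {z : ℂ} :
    IsGeneric Λ t l z ↔ ∀ i : Fin N ⊕ Fin N, z - Sum.elim t l i ∉ Λ.lattice := by
  simp [IsGeneric]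

lemma eventually_isGeneric (Λ : PeriodPair) (t l : Fin N → ℂ) (z : ℂ) :
    ∀ᶠ x in 𝓝[≠] z, IsGeneric Λ t l x := by
  simp_rw [isGeneric_iff]
  exact eventually_forall_notMem Λ _ z

lemma exists_isGeneric (Λ : PeriodPair) (t l : Fin N → ℂ) : ∃ z, IsGeneric Λ t l z :=
  (eventually_isGeneric Λ t l 0).exists

lemma IsRegular.sub_time (h : IsRegular Λ t l) (i k : Fin N) : t i - l k ∉ Λ.lattice :=
  sub_notMem_comm.mp (h.zeros_ne_times i k)

lemma IsRegular.charge_notMem (h : IsRegular Λ t l) : charge t l ∉ Λ.lattice := h.sum_notMem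

lemma sigmaProd_split (a : Fin N → ℂ) (i : Fin N) (z : ℂ) :
    sigmaProd Λ a z = sigma Λ (z - a i) * sigmaProdErase Λ a i z :=
  (Finset.mul_prod_erase Finset.univ (fun k => sigma Λ (z - a k)) (Finset.mem_univ i)).symm

lemma sigmaProd_ne_zero {a : Fin N → ℂ} {z : ℂ} (h : ∀ k, z - a k ∉ Λ.lattice) :
    sigmaProd Λ a z ≠ 0 := Finset.prod_ne_zero_iff.mpr fun k _ => sigma_ne_zero Λ (h k)

lemma sigmaProdErase_ne_zero {a : Fin N → ℂ} {i : Fin N} {z : ℂ}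
    (h : ∀ k, i ≠ k → z - a k ∉ Λ.lattice) : sigmaProdErase Λ a i z ≠ 0 :=
  Finset.prod_ne_zero_iff.mpr fun k hk => sigma_ne_zero Λ (h k (Finset.ne_of_mem_erase hk).symm)

lemma differentiable_sigmaProdErase (a : Fin N → ℂ) (i : Fin N) :
    Differentiable ℂ (sigmaProdErase Λ a i) := by
  have := differentiable_sigma Λ
  exact Differentiable.fun_finsetProd fun k _ => this.comp (differentiable_id.sub_const _)

lemma differentiable_sigmaProd (a : Fin N → ℂ) : Differentiable ℂ (sigmaProd Λ a) := by
  have := differentiable_sigma Λ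
  exact Differentiable.fun_finsetProd fun k _ => this.comp (differentiable_id.sub_const _)

lemma deriv_sigmaProd (a : Fin N → ℂ) (i : Fin N) :
    deriv (sigmaProd Λ a) (a i) = sigmaProdErase Λ a i (a i) := by
  have h1 : sigmaProd Λ a = fun z => sigma Λ (z - a i) * sigmaProdErase Λ a i z :=
    funext (sigmaProd_split a i)
  have h2 := ((hasDerivAt_sigma Λ (a i - a i)).comp_sub_const (a i) (a i)).mul
    (differentiable_sigmaProdErase (Λ := Λ) a i (a i)).hasDerivAt
  rw [h1]
  refine h2.deriv.trans ?_
  simp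

lemma sigmaProd_add (a b : Fin N → ℂ) {w z : ℂ} (hw : w ∈ Λ.lattice) :
    sigmaProd Λ a (z + w) * sigmaProd Λ b z * Complex.exp (eta Λ w * (∑ k, a k - ∑ k, b k)) =
      sigmaProd Λ b (z + w) * sigmaProd Λ a z := by
  obtain ⟨c, hc, h⟩ := exists_sigma_add Λ hw
  have h1 : ∀ a : Fin N → ℂ, sigmaProd Λ a (z + w) =
      c ^ N * Complex.exp (∑ k, eta Λ w * (z - a k)) * sigmaProd Λ a z := by
    intro a
    simp only [sigmaProd, add_sub_right_comm, h, Finset.prod_mul_distrib, Finset.prod_const,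
      Finset.card_univ, Fintype.card_fin, ← Complex.exp_sum]
  rw [h1 a, h1 b]
  have h2 : Complex.exp (∑ k, eta Λ w * (z - b k)) = Complex.exp (∑ k, eta Λ w * (z - a k)) *
      Complex.exp (eta Λ w * (∑ k, a k - ∑ k, b k)) := by
    rw [← Complex.exp_add]
    congr 1
    rw [← Finset.mul_sum, ← Finset.mul_sum, ← mul_add]
    simp only [Finset.sum_sub_distrib]
    ring
  rw [h2]
  ring

lemma ratio_add {w z : ℂ} (hw : w ∈ Λ.lattice) (hz : ∀ i, z - t i ∉ Λ.lattice) :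
    ratio Λ t l (z + w) = Complex.exp (-(eta Λ w * charge t l)) * ratio Λ t l z := by
  have h1 := sigmaProd_ne_zero hz
  have h2 : sigmaProd Λ t (z + w) ≠ 0 := sigmaProd_ne_zero fun i => by
    rw [add_sub_right_comm]; exact (add_notMem_iff Λ hw).mpr (hz i)
  have h3 := sigmaProd_add (z := z) l t hw
  rw [ratio, ratio, charge, Complex.exp_neg]
  have := Complex.exp_ne_zero (eta Λ w * (∑ k, l k - ∑ k, t k))
  field_simp
  linear_combination h3

lemma analyticAt_ratio {z : ℂ} (hz : ∀ i, z - t i ∉ Λ.lattice) : AnalyticAt ℂ (ratio Λ t l) z :=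
  ((differentiable_sigmaProd l).analyticAt z).div ((differentiable_sigmaProd t).analyticAt z)
    (sigmaProd_ne_zero hz)

lemma ratio_ne_zero {z : ℂ} (hz : IsGeneric Λ t l z) : ratio Λ t l z ≠ 0 :=
  div_ne_zero (sigmaProd_ne_zero hz.2) (sigmaProd_ne_zero hz.1)

lemma ratio_eq_zero_iff {z : ℂ} (hz : ∀ i, z - t i ∉ Λ.lattice) :
    ratio Λ t l z = 0 ↔ ∃ k, z - l k ∈ Λ.lattice := by
  rw [ratio, div_eq_zero_iff, or_iff_left (sigmaProd_ne_zero hz), sigmaProd, Finset.prod_eq_zero_iff]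
  simp [sigma_eq_zero_iff]

lemma ratio_zero (m : Fin N) : ratio Λ t l (l m) = 0 := by
  rw [ratio, sigmaProd_split l m]; simp

lemma ratioRes_ne_zero (h : IsRegular Λ t l) (i : Fin N) : ratioRes Λ t l i ≠ 0 :=
  div_ne_zero (sigmaProd_ne_zero fun k => h.sub_time i k)
    (sigmaProdErase_ne_zero fun k hk => h.times_distinct i k hk)

lemma ratioDeriv_ne_zero (h : IsRegular Λ t l) (m : Fin N) : ratioDeriv Λ t l m ≠ 0 :=
  div_ne_zero (sigmaProdErase_ne_zero fun k hk => h.zeros_distinct m k hk)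
    (sigmaProd_ne_zero fun k => h.zeros_ne_times k m)

lemma hasLaurent_inv_sigmaProd (ht : ∀ j k, j ≠ k → t j - t k ∉ Λ.lattice) (i : Fin N) :
    ∃ c, HasLaurent (fun z => (sigmaProd Λ t z)⁻¹) (t i) 0 (sigmaProdErase Λ t i (t i))⁻¹ c := by
  have h1 := ((hasLaurent_inv_sigma Λ).comp_sub_zero (t i)).mul_analyticAt
    (((differentiable_sigmaProdErase (Λ := Λ) t i).analyticAt (t i)).inv
      (sigmaProdErase_ne_zero fun k hk => ht i k hk))
  refine ⟨_, (h1.congr_val rfl (by simp) rfl).congr (.of_forall fun z => ?_)⟩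
  simp only [Pi.inv_apply]
  rw [sigmaProd_split t i, mul_inv]

lemma hasLaurent_ratio (ht : ∀ j k, j ≠ k → t j - t k ∉ Λ.lattice) (i : Fin N) :
    ∃ c, HasLaurent (ratio Λ t l) (t i) 0 (ratioRes Λ t l i) c := by
  obtain ⟨c, hc⟩ := hasLaurent_inv_sigmaProd ht i
  refine ⟨_, ((hc.mul_analyticAt ((differentiable_sigmaProd (Λ := Λ) l).analyticAt (t i))).congr_val
    rfl ?_ rfl).congr (.of_forall fun z => ?_)⟩
  · rw [ratioRes]; ring
  · simp only [ratio]; ring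

lemma hasDerivAt_ratio_zero (h : IsRegular Λ t l) (m : Fin N) :
    HasDerivAt (ratio Λ t l) (ratioDeriv Λ t l m) (l m) := by
  have hP : sigmaProd Λ t (l m) ≠ 0 := sigmaProd_ne_zero fun k => h.zeros_ne_times k m
  have h1 := ((differentiable_sigmaProd (Λ := Λ) l) (l m)).hasDerivAt.div
    ((differentiable_sigmaProd (Λ := Λ) t) (l m)).hasDerivAt hP
  refine h1.congr_deriv ?_
  have h0 : sigmaProd Λ l (l m) = 0 := by rw [sigmaProd_split l m]; simp
  rw [deriv_sigmaProd, ratioDeriv, h0]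
  field_simp
  ring

lemma hasDerivAt_sigmaProd {a : Fin N → ℂ} {z : ℂ} (h : ∀ k, z - a k ∉ Λ.lattice) :
    HasDerivAt (sigmaProd Λ a) (sigmaProd Λ a z * ∑ k, zeta Λ (z - a k)) z := by
  have h1 : HasDerivAt (fun z => ∏ k, sigma Λ (z - a k)) _ z :=
    HasDerivAt.fun_finsetProd (u := Finset.univ) (f := fun k z => sigma Λ (z - a k))
    (f' := fun k => deriv (sigma Λ) (z - a k))
    (fun k _ => (hasDerivAt_sigma Λ (z - a k)).comp_sub_const z (a k))
  refine h1.congr_deriv ?_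
  rw [Finset.mul_sum]
  refine Finset.sum_congr rfl fun k _ => ?_
  rw [deriv_sigma_eq Λ (h k), sigmaProd_split a k, smul_eq_mul, sigmaProdErase]
  ring

lemma hasDerivAt_ratio {z : ℂ} (hz : IsGeneric Λ t l z) :
    HasDerivAt (ratio Λ t l) (ratio Λ t l z * logRatio Λ t l z) z := by
  have hP := sigmaProd_ne_zero hz.1
  refine ((hasDerivAt_sigmaProd hz.2).div (hasDerivAt_sigmaProd hz.1) hP).congr_deriv ?_
  rw [ratio, logRatio]
  field_simp

lemma analyticAt_zeta_sub {a z : ℂ} (h : z - a ∉ Λ.lattice) :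
    AnalyticAt ℂ (fun z => zeta Λ (z - a)) z :=
  (analyticAt_zeta Λ h).fun_comp (f := fun z => z - a) (by fun_prop)

lemma analyticAt_sum_zeta {a b : Fin N → ℂ} {z : ℂ} {S : Finset (Fin N)}
    (h : ∀ i ∈ S, z - a i ∉ Λ.lattice) :
    AnalyticAt ℂ (fun z => ∑ i ∈ S, b i * zeta Λ (z - a i)) z :=
  S.analyticAt_fun_sum fun i hi => analyticAt_const.mul (analyticAt_zeta_sub (h i hi))

lemma hasLaurent_sum_zeta {a : Fin N → ℂ} (ha : ∀ j k, j ≠ k → a j - a k ∉ Λ.lattice)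
    (b : Fin N → ℂ) (i : Fin N) :
    HasLaurent (fun z => ∑ k, b k * zeta Λ (z - a k)) (a i) 0 (b i)
      (∑ k ∈ Finset.univ.erase i, b k * zeta Λ (a i - a k)) := by
  have h1 := HasLaurent.of_analyticAt (analyticAt_sum_zeta (b := b) (S := Finset.univ.erase i)
    (fun k hk => ha i k (Finset.ne_of_mem_erase hk).symm))
  have h2 := ((hasLaurent_zeta Λ).comp_sub_zero (a i)).const_mul (b i)
  refine ((h2.add h1).congr_val (by simp) (by simp) (by simp)).congr (.of_forall fun z => ?_)
  exact Finset.add_sum_erase Finset.univ (fun k => b k * zeta Λ (z - a k)) (Finset.mem_univ i)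

lemma analyticAt_logRatio {z : ℂ} (hz : IsGeneric Λ t l z) : AnalyticAt ℂ (logRatio Λ t l) z :=
  (Finset.univ.analyticAt_fun_sum fun i _ => analyticAt_zeta_sub (hz.2 i)).sub
    (Finset.univ.analyticAt_fun_sum fun i _ => analyticAt_zeta_sub (hz.1 i))

lemma hasLaurent_logRatio_zero (h : IsRegular Λ t l) (m : Fin N) :
    HasLaurent (logRatio Λ t l) (l m) 0 1 (logRatioZero Λ t l m) := by
  have h1 := hasLaurent_sum_zeta h.zeros_distinct (fun _ => 1) m
  have h2 := HasLaurent.of_analyticAt (analyticAt_sum_zeta (b := fun _ => 1) (S := Finset.univ)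
    (fun i _ => h.zeros_ne_times i m))
  refine ((h1.sub h2).congr_val (by simp) (by simp) (by simp [logRatioZero])).congr
    (.of_forall fun z => by simp [logRatio])

lemma hasLaurent_logRatio_pole (h : IsRegular Λ t l) (i : Fin N) :
    HasLaurent (logRatio Λ t l) (t i) 0 (-1) (logRatioPole Λ t l i) := by
  have h1 := hasLaurent_sum_zeta h.times_distinct (fun _ => 1) i
  have h2 := HasLaurent.of_analyticAt (analyticAt_sum_zeta (b := fun _ => 1) (S := Finset.univ)
    (fun k _ => h.sub_time i k))
  refine ((h2.sub h1).congr_val (by simp) (by simp) (by simp [logRatioPole])).congr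
    (.of_forall fun z => by simp [logRatio])

/-- `½ (Q/P)''(λ_m)` in terms of the logarithmic derivative. -/
lemma deriv_dslope_ratio (h : IsRegular Λ t l) (m : Fin N) :
    deriv (dslope (ratio Λ t l) (l m)) (l m) = ratioDeriv Λ t l m * logRatioZero Λ t l m := by
  have hβ := ratioDeriv_ne_zero h m
  have ha : AnalyticAt ℂ (ratio Λ t l) (l m) := analyticAt_ratio fun i => h.zeros_ne_times i m
  have hd := analyticAt_dslope ha
  have hD : dslope (ratio Λ t l) (l m) (l m) = ratioDeriv Λ t l m := by
    rw [dslope_same, (hasDerivAt_ratio_zero h m).deriv]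
  have hR : ∀ z, ratio Λ t l z = (z - l m) * dslope (ratio Λ t l) (l m) z := by
    intro z
    have := sub_smul_dslope (ratio Λ t l) (l m) z
    rw [ratio_zero, sub_zero] at this
    exact this.symm
  have h1 : HasLaurent (logRatio Λ t l) (l m) 0 1
      (deriv (dslope (ratio Λ t l) (l m)) (l m) / ratioDeriv Λ t l m) := by
    refine ⟨fun z => deriv (dslope (ratio Λ t l) (l m)) z / dslope (ratio Λ t l) (l m) z,
      hd.deriv.div hd (by rw [hD]; exact hβ), by simp only [hD], ?_⟩
    have hne : ∀ᶠ z in 𝓝 (l m), dslope (ratio Λ t l) (l m) z ≠ 0 :=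
      hd.continuousAt.eventually_ne (by rw [hD]; exact hβ)
    filter_upwards [HasLaurent.eventually_sub_ne (l m), mem_nhdsWithin_of_mem_nhds hne,
      mem_nhdsWithin_of_mem_nhds hd.eventually_analyticAt, eventually_isGeneric Λ t l (l m)]
      with z hz hz1 hz2 hz3
    have h2 := hasDerivAt_ratio hz3
    have h3 := ((hasDerivAt_id z).sub_const (l m)).mul hz2.differentiableAt.hasDerivAt
    have h4 : (fun z => id z - l m) * dslope (ratio Λ t l) (l m) = ratio Λ t l := by
      ext z; exact (hR z).symm
    rw [h4] at h3
    have h5 := h2.unique h3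
    rw [hR z] at h5
    simp only [id] at h5
    rw [zero_div, zero_add]
    field_simp
    linear_combination h5
  have h2 := (h1.unique (hasLaurent_logRatio_zero h m)).2
  rw [← h2]
  field_simp

/-! ### Partial fractions with poles at the `t_i` and `λ_k` -/

/-- `f` has at most simple poles, at the `t_i` with residues `r i` and at the `λ_k` with residues
`ρ k` and constant terms `γ k`, and is elliptic up to multiples of the quasi-periods of `ζ`. -/
structure HasPoles (Λ : PeriodPair) (t l : Fin N → ℂ) (f : ℂ → ℂ) (s : ℂ) (r ρ γ : Fin N → ℂ) :
    Prop where
  periodic : ∀ w ∈ Λ.lattice, ∀ z, IsGeneric Λ t l z → f (z + w) = f z + s * eta Λ w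
  analyticAt : ∀ z, IsGeneric Λ t l z → AnalyticAt ℂ f z
  times : ∀ i, ∃ c, HasLaurent f (t i) 0 (r i) c
  zeros : ∀ k, HasLaurent f (l k) 0 (ρ k) (γ k)

namespace HasPoles

variable {f g : ℂ → ℂ} {s s' : ℂ} {r ρ γ r' ρ' γ' : Fin N → ℂ}

lemma add (hf : HasPoles Λ t l f s r ρ γ) (hg : HasPoles Λ t l g s' r' ρ' γ') :
    HasPoles Λ t l (fun z => f z + g z) (s + s') (fun i => r i + r' i) (fun i => ρ i + ρ' i)
      (fun i => γ i + γ' i) where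
  periodic w hw z hz := by rw [hf.periodic w hw z hz, hg.periodic w hw z hz]; ring
  analyticAt z hz := (hf.analyticAt z hz).add (hg.analyticAt z hz)
  times i := by
    obtain ⟨c, hc⟩ := hf.times i
    obtain ⟨c', hc'⟩ := hg.times i
    exact ⟨_, (hc.add hc').congr_val (by simp) rfl rfl⟩
  zeros k := ((hf.zeros k).add (hg.zeros k)).congr_val (by simp) rfl rfl

lemma const_mul (hf : HasPoles Λ t l f s r ρ γ) (a : ℂ) :
    HasPoles Λ t l (fun z => a * f z) (a * s) (fun i => a * r i) (fun i => a * ρ i)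
      (fun i => a * γ i) where
  periodic w hw z hz := by rw [hf.periodic w hw z hz]; ring
  analyticAt z hz := analyticAt_const.mul (hf.analyticAt z hz)
  times i := by
    obtain ⟨c, hc⟩ := hf.times i
    exact ⟨_, (hc.const_mul a).congr_val (by simp) rfl rfl⟩
  zeros k := ((hf.zeros k).const_mul a).congr_val (by simp) rfl rfl

lemma congr_val (hf : HasPoles Λ t l f s r ρ γ) (h0 : s = s') (h1 : ∀ i, r i = r' i)
    (h2 : ∀ i, ρ i = ρ' i) (h3 : ∀ i, γ i = γ' i) : HasPoles Λ t l f s' r' ρ' γ' := by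
  obtain rfl := h0
  obtain rfl := funext h1
  obtain rfl := funext h2
  obtain rfl := funext h3
  exact hf

lemma zero : HasPoles Λ t l (fun _ => 0) 0 (fun _ => 0) (fun _ => 0) (fun _ => 0) where
  periodic w hw z hz := by simp
  analyticAt z hz := analyticAt_const
  times i := ⟨_, HasLaurent.of_analyticAt analyticAt_const⟩
  zeros k := HasLaurent.of_analyticAt (f := fun _ => 0) analyticAt_const

lemma sum {ι : Type*} (S : Finset ι) {f : ι → ℂ → ℂ} {s : ι → ℂ} {r ρ γ : ι → Fin N → ℂ}
    (hf : ∀ j ∈ S, HasPoles Λ t l (f j) (s j) (r j) (ρ j) (γ j)) :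
    HasPoles Λ t l (fun z => ∑ j ∈ S, f j z) (∑ j ∈ S, s j) (fun i => ∑ j ∈ S, r j i)
      (fun i => ∑ j ∈ S, ρ j i) (fun i => ∑ j ∈ S, γ j i) := by
  classical
  induction S using Finset.induction_on with
  | empty => simpa using zero
  | insert j S hj ih =>
    simp only [Finset.sum_insert hj]
    exact (hf j (by simp)).add (ih fun i hi => hf i (by simp [hi]))

/-- Partial fractions for a function with prescribed poles: the residues add up to `s`, and the
constant terms at the `λ_k` are those of the expansion. -/
theorem expand (h : IsRegular Λ t l) (hf : HasPoles Λ t l f s r ρ γ) :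
    ∑ i, r i + ∑ k, ρ k = s ∧ ∃ b : ℂ,
      (∀ z, IsGeneric Λ t l z →
        f z = ∑ i, r i * zeta Λ (z - t i) + ∑ k, ρ k * zeta Λ (z - l k) + b) ∧
      ∀ k, γ k = ∑ i, r i * zeta Λ (l k - t i)
        + ∑ m ∈ Finset.univ.erase k, ρ m * zeta Λ (l k - l m) + b := by
  choose c hc using hf.times
  obtain ⟨h1, b, hb, hb'⟩ := partial_fractions Λ (a := Sum.elim t l) (r := Sum.elim r ρ)
    (c := Sum.elim c γ) (f := f) (s := s)
    (by
      rintro (i | i) (j | j) hij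
      · exact h.times_distinct i j (by simpa using hij)
      · exact h.sub_time i j
      · exact h.zeros_ne_times j i
      · exact h.zeros_distinct i j (by simpa using hij))
    (fun w hw z hz => hf.periodic w hw z (isGeneric_iff.mpr hz))
    (fun z hz => hf.analyticAt z (isGeneric_iff.mpr hz))
    (by
      rintro (i | k)
      · exact hc i
      · exact hf.zeros k)
  refine ⟨by simpa using h1, b, fun z hz => ?_, fun k => ?_⟩
  · simpa using hb z (isGeneric_iff.mp hz)
  · have h2 := hb' (Sum.inr k)
    have h3 : (Finset.univ.erase (Sum.inr k : Fin N ⊕ Fin N)) =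
        Finset.univ.disjSum (Finset.univ.erase k) := by
      ext x; cases x <;> simp
    rw [h3, Finset.sum_disjSum] at h2
    simpa using h2

end HasPoles

end

section

variable {N : ℕ} {Λ : PeriodPair} {t l : Fin N → ℂ}

/-! ### Interpolation at the points `λ_k` -/

lemma IsRegular.swap (h : IsRegular Λ t l) : IsRegular Λ l t where
  times_distinct := h.zeros_distinct
  zeros_distinct := h.times_distinct
  zeros_ne_times j k := h.sub_time k j
  sum_notMem := sub_notMem_comm.mp h.sum_notMem

lemma neg_charge_notMem (h : IsRegular Λ t l) : -charge t l ∉ Λ.lattice := by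
  rw [neg_mem_iff]; exact h.charge_notMem

/-- The elliptic function with simple poles at the `t_i` whose value at `λ_k` is `δ_km`. -/
def lagrange (Λ : PeriodPair) (t l : Fin N → ℂ) (m : Fin N) (z : ℂ) : ℂ :=
  1 / ratioDeriv Λ t l m * (phi Λ (-charge t l) (z - l m) * ratio Λ t l z)

/-- An elliptic function with simple poles at the `t_i` and at `λ_m`, with residue `-1` at `λ_m`,
vanishing at the other `λ_k`. -/
def lagrangeZ (Λ : PeriodPair) (t l : Fin N → ℂ) (m : Fin N) (z : ℂ) : ℂ :=
  1 / ratioDeriv Λ t l m * (phiZ Λ (-charge t l) (z - l m) * ratio Λ t l z)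

/-- The residue of `lagrange m` at `t_i`. -/
def lagrangeRes (Λ : PeriodPair) (t l : Fin N → ℂ) (i m : Fin N) : ℂ :=
  phi Λ (-charge t l) (t i - l m) * ratioRes Λ t l i / ratioDeriv Λ t l m

/-- The residue of `lagrangeZ m` at `t_i`. -/
def lagrangeZRes (Λ : PeriodPair) (t l : Fin N → ℂ) (i m : Fin N) : ℂ :=
  phiZ Λ (-charge t l) (t i - l m) * ratioRes Λ t l i / ratioDeriv Λ t l m

lemma hasPoles_lagrange (h : IsRegular Λ t l) (m : Fin N) :
    HasPoles Λ t l (lagrange Λ t l m) 0 (fun i => lagrangeRes Λ t l i m) (fun _ => 0)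
      (fun k => if k = m then 1 else 0) := by
  have hβ := ratioDeriv_ne_zero h m
  have hq := neg_charge_notMem h
  have hphi : ∀ z, z - l m ∉ Λ.lattice →
      AnalyticAt ℂ (fun z => phi Λ (-charge t l) (z - l m)) z := fun z hz =>
    (analyticAt_phi Λ hq hz).fun_comp (f := fun z => z - l m) (by fun_prop)
  refine ⟨?_, ?_, ?_, ?_⟩
  · intro w hw z hz
    rw [lagrange, lagrange, ratio_add hw hz.1, add_sub_right_comm, phi_add Λ hw, mul_neg, neg_neg,
      Complex.exp_neg]
    have := Complex.exp_ne_zero (eta Λ w * charge t l)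
    field_simp
    ring
  · exact fun z hz => analyticAt_const.mul ((hphi z (hz.2 m)).mul (analyticAt_ratio hz.1))
  · intro i
    obtain ⟨c, hc⟩ := hasLaurent_ratio (l := l) h.times_distinct i
    refine ⟨_, (((hc.mul_analyticAt (hphi _ (h.sub_time i m))).const_mul
      (1 / ratioDeriv Λ t l m)).congr_val (by simp) ?_ rfl).congr (.of_forall fun z => ?_)⟩
    · rw [lagrangeRes]; ring
    · simp only [lagrange]; ring
  · intro k
    have ha : AnalyticAt ℂ (ratio Λ t l) (l k) := analyticAt_ratio fun i => h.zeros_ne_times i k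
    by_cases hk : k = m
    · subst hk
      refine ((((hasLaurent_phi Λ hq).comp_sub_zero (l k)).mul_analyticAt ha).const_mul
        (1 / ratioDeriv Λ t l k)).congr_val (by simp) (by simp [ratio_zero]) ?_
      rw [ratio_zero, (hasDerivAt_ratio_zero h k).deriv, if_pos rfl]
      field_simp
      ring
    · have h1 := HasLaurent.of_analyticAt ((analyticAt_const (v := 1 / ratioDeriv Λ t l m)).mul
        ((hphi _ (h.zeros_distinct k m hk)).mul ha))
      refine h1.congr_val rfl rfl ?_
      simp [ratio_zero, hk]

lemma hasPoles_lagrangeZ (h : IsRegular Λ t l) (m : Fin N) :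
    HasPoles Λ t l (lagrangeZ Λ t l m) 0 (fun i => lagrangeZRes Λ t l i m)
      (fun k => if k = m then -1 else 0)
      (fun k => if k = m then -logRatioZero Λ t l m else 0) := by
  have hβ := ratioDeriv_ne_zero h m
  have hq := neg_charge_notMem h
  have hphi : ∀ z, z - l m ∉ Λ.lattice →
      AnalyticAt ℂ (fun z => phiZ Λ (-charge t l) (z - l m)) z := fun z hz =>
    (analyticAt_phiZ Λ hq hz).fun_comp (f := fun z => z - l m) (by fun_prop)
  refine ⟨?_, ?_, ?_, ?_⟩
  · intro w hw z hz
    rw [lagrangeZ, lagrangeZ, ratio_add hw hz.1, add_sub_right_comm, phiZ_add Λ hw _ (hz.2 m),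
      mul_neg, neg_neg, Complex.exp_neg]
    have := Complex.exp_ne_zero (eta Λ w * charge t l)
    field_simp
    ring
  · exact fun z hz => analyticAt_const.mul ((hphi z (hz.2 m)).mul (analyticAt_ratio hz.1))
  · intro i
    obtain ⟨c, hc⟩ := hasLaurent_ratio (l := l) h.times_distinct i
    refine ⟨_, (((hc.mul_analyticAt (hphi _ (h.sub_time i m))).const_mul
      (1 / ratioDeriv Λ t l m)).congr_val (by simp) ?_ rfl).congr (.of_forall fun z => ?_)⟩
    · rw [lagrangeZRes]; ring
    · simp only [lagrangeZ]; ring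
  · intro k
    have ha : AnalyticAt ℂ (ratio Λ t l) (l k) := analyticAt_ratio fun i => h.zeros_ne_times i k
    by_cases hk : k = m
    · subst hk
      obtain ⟨c, hc⟩ := hasLaurent_phiZ Λ hq
      refine (((hc.comp_sub_zero (l k)).mul_zero ha (ratio_zero k)).const_mul
        (1 / ratioDeriv Λ t l k)).congr_val (by simp) ?_ ?_
      · rw [(hasDerivAt_ratio_zero h k).deriv, if_pos rfl]
        field_simp
      · rw [deriv_dslope_ratio h, if_pos rfl]
        field_simp
    · have h1 := HasLaurent.of_analyticAt ((analyticAt_const (v := 1 / ratioDeriv Λ t l m)).mul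
        ((hphi _ (h.zeros_distinct k m hk)).mul ha))
      refine h1.congr_val rfl (by simp [hk]) ?_
      simp [ratio_zero, hk]

/-- Residues with sum zero at the `t_i` and an additive constant are determined by the values at
the `λ_k`: otherwise the quotient by `Q / P` would be a nonzero function without poles whose
multipliers are those of a nontrivial line bundle of degree zero. -/
lemma eq_zero_of_values_eq_zero (h : IsRegular Λ t l) {x : Fin N → ℂ} {x₀ : ℂ}
    (hx : ∑ i, x i = 0) (hv : ∀ k, ∑ i, x i * zeta Λ (l k - t i) + x₀ = 0) :
    (∀ i, x i = 0) ∧ x₀ = 0 := by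
  set n : ℂ → ℂ := fun z => ∑ i, x i * zeta Λ (z - t i) + x₀ with hn
  have hna : ∀ z, (∀ i, z - t i ∉ Λ.lattice) → AnalyticAt ℂ n z := fun z hz =>
    (analyticAt_sum_zeta fun i _ => hz i).add analyticAt_const
  choose c hc using fun k => hasLaurent_ratio (l := t) h.zeros_distinct k
  have hkey := eq_zero_of_multiplier Λ (a := Sum.elim t l) (κ := charge t l)
    (c := Sum.elim (fun i => x i * ratioDeriv Λ l t i)
      (fun k => c k * n (l k) + ratioRes Λ l t k * deriv n (l k)))
    (f := fun z => n z * ratio Λ l t z) h.charge_notMem ?_ ?_ ?_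
  · have h1 : ∀ i, x i = 0 := by
      intro i
      have := hkey.2 (Sum.inl i)
      exact (mul_eq_zero.mp this).resolve_right (ratioDeriv_ne_zero h.swap i)
    refine ⟨h1, ?_⟩
    obtain ⟨z, hz⟩ := exists_isGeneric Λ t l
    have h2 := hkey.1 z (isGeneric_iff.mp hz)
    have h3 := (mul_eq_zero.mp h2).resolve_right (ratio_ne_zero ⟨hz.2, hz.1⟩)
    simpa [hn, h1] using h3
  · intro w hw z hz
    have hz' := isGeneric_iff.mpr hz
    have h1 : n (z + w) = n z := by
      simp only [hn, add_sub_right_comm]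
      have h2 : ∀ i, x i * zeta Λ (z - t i + w) = x i * zeta Λ (z - t i) + x i * eta Λ w :=
        fun i => by rw [zeta_add Λ hw (hz'.1 i), mul_add]
      simp only [h2, Finset.sum_add_distrib, ← Finset.sum_mul, hx]
      ring
    rw [h1, ratio_add hw hz'.2, show charge l t = -charge t l by rw [charge, charge]; ring]
    rw [mul_neg, neg_neg]
    ring
  · intro z hz
    have hz' := isGeneric_iff.mpr hz
    exact (hna z hz'.1).mul (analyticAt_ratio hz'.2)
  · rintro (i | k)
    · have h1 := (hasLaurent_sum_zeta h.times_distinct x i).add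
        (HasLaurent.of_analyticAt (f := fun _ => x₀) analyticAt_const)
      have h2 := (h1.congr_val (add_zero 0) rfl rfl).mul_analyticAt (analyticAt_ratio (t := l) (l := t) fun k => h.sub_time i k)
      refine h2.congr_val rfl (by simp [ratio_zero]) ?_
      rw [ratio_zero, (hasDerivAt_ratio_zero h.swap i).deriv]
      simp
    · have h1 := (hc k).mul_analyticAt (hna (l k) fun i => h.zeros_ne_times i k)
      refine (h1.congr_val rfl ?_ rfl).congr (.of_forall fun z => mul_comm _ _)
      rw [hn]
      simp only [hv, mul_zero]

lemma eq_of_values_eq (h : IsRegular Λ t l) {x y : Fin N → ℂ} {x₀ y₀ : ℂ}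
    (hx : ∑ i, x i = ∑ i, y i)
    (hv : ∀ k, ∑ i, x i * zeta Λ (l k - t i) + x₀ = ∑ i, y i * zeta Λ (l k - t i) + y₀) :
    (∀ i, x i = y i) ∧ x₀ = y₀ := by
  have := eq_zero_of_values_eq_zero h (x := fun i => x i - y i) (x₀ := x₀ - y₀)
    (by rw [Finset.sum_sub_distrib, hx, sub_self]) (fun k => by
      simp only [sub_mul, Finset.sum_sub_distrib]
      linear_combination hv k)
  exact ⟨fun i => sub_eq_zero.mp (this.1 i), sub_eq_zero.mp this.2⟩

/-! ### The spectral Hamiltonians -/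

/-- `∑ C_i ℘(z - t_i)` with `C_i = θ_i² / 4`. -/
def potential (Λ : PeriodPair) (θ t : Fin N → ℂ) (z : ℂ) : ℂ :=
  ∑ i, θ i ^ 2 / 4 * Λ.weierstrassP (z - t i)

lemma specHam_eq (h : IsRegular Λ t l) (θ μ : Fin N → ℂ) (j : Fin N) :
    specHam Λ θ j l μ t = ∑ m, (lagrangeRes Λ t l j m * (μ m ^ 2 - potential Λ θ t (l m))
      + lagrangeZRes Λ t l j m * μ m) := by
  refine Finset.sum_congr rfl fun m _ => ?_
  have hw : ∑ i ∈ Finset.univ.erase m, l i - ∑ i ∈ Finset.univ.erase j, t i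
      = charge t l + (t j - l m) := by
    rw [charge, ← Finset.add_sum_erase Finset.univ l (Finset.mem_univ m),
      ← Finset.add_sum_erase Finset.univ t (Finset.mem_univ j)]
    ring
  rw [hw, deriv_sigmaProd, deriv_sigmaProd, lagrangeRes, lagrangeZRes, phi, phiZ,
    show -charge t l - (t j - l m) = -(charge t l + (t j - l m)) by ring, sigma_neg, sigma_neg,
    deriv_sigma_neg, ratioRes, ratioDeriv, ← potential, show ∑ i, l i - ∑ i, t i = charge t l from rfl]
  have h1 := sigma_ne_zero Λ h.charge_notMem
  have h2 := sigma_ne_zero Λ (h.sub_time j m)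
  have h3 : sigmaProdErase Λ t j (t j) ≠ 0 :=
    sigmaProdErase_ne_zero fun k hk => h.times_distinct j k hk
  have h4 : sigmaProdErase Λ l m (l m) ≠ 0 :=
    sigmaProdErase_ne_zero fun k hk => h.zeros_distinct m k hk
  have h5 : sigmaProd Λ t (l m) ≠ 0 := sigmaProd_ne_zero fun k => h.zeros_ne_times k m
  field_simp
  ring

/-- The separation relations: the `H_j` are the residues at the `t_j` of the elliptic function
`∑ C_j ℘(z - t_j) + ∑ H_j ζ(z - t_j) - ∑ μ_k ζ(z - λ_k) + b`, whose constant term at `λ_k` is such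
that the associated second order equation has an apparent singularity there. -/
theorem specHam_relation (h : IsRegular Λ t l) (θ μ : Fin N → ℂ) :
    ∑ j, specHam Λ θ j l μ t = ∑ k, μ k ∧ ∃ b : ℂ, ∀ k,
      ∑ j, specHam Λ θ j l μ t * zeta Λ (l k - t j) + b =
        μ k ^ 2 - potential Λ θ t (l k) - μ k * logRatioZero Λ t l k
          + ∑ m ∈ Finset.univ.erase k, μ m * zeta Λ (l k - l m) := by
  have h1 := HasPoles.sum Finset.univ fun m _ =>
    ((hasPoles_lagrange h m).const_mul (μ m ^ 2 - potential Λ θ t (l m))).add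
      ((hasPoles_lagrangeZ h m).const_mul (μ m))
  have h2 := h1.congr_val (s' := 0) (r' := fun j => specHam Λ θ j l μ t) (ρ' := fun k => -μ k)
    (γ' := fun k => μ k ^ 2 - potential Λ θ t (l k) - μ k * logRatioZero Λ t l k) (by simp)
    (fun j => by
      rw [specHam_eq h]
      exact Finset.sum_congr rfl fun m _ => by ring)
    (fun k => by simp)
    (fun k => by simp [Finset.sum_add_distrib]; ring)
  obtain ⟨h3, b, -, hb⟩ := h2.expand h
  refine ⟨?_, b, fun k => ?_⟩
  · rw [Finset.sum_neg_distrib] at h3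
    linear_combination h3
  · have h4 := hb k
    simp only [neg_mul, Finset.sum_neg_distrib] at h4
    linear_combination -h4

/-! ### Holomorphic dependence on the positions -/

section Differentiability

variable {E : Type*} [NormedAddCommGroup E] [NormedSpace ℂ E]

lemma IsRegular.eventually {X : Type*} [TopologicalSpace X] {T L : X → Fin N → ℂ} {x : X}
    (hT : ContinuousAt T x) (hL : ContinuousAt L x) (h : IsRegular Λ (T x) (L x)) :
    ∀ᶠ y in 𝓝 x, IsRegular Λ (T y) (L y) := by
  have hT' := continuousAt_pi.mp hT
  have hL' := continuousAt_pi.mp hL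
  have key : ∀ {f : X → ℂ}, ContinuousAt f x → f x ∉ Λ.lattice → ∀ᶠ y in 𝓝 x, f y ∉ Λ.lattice :=
    fun hf hx => hf.eventually (Λ.isClosed_lattice.isOpen_compl.mem_nhds hx)
  have h1 : ∀ᶠ y in 𝓝 x, ∀ j k, j ≠ k → T y j - T y k ∉ Λ.lattice :=
    eventually_all.mpr fun j => eventually_all.mpr fun k => by
      by_cases hjk : j = k
      · simp [hjk]
      · filter_upwards [key ((hT' j).sub (hT' k)) (h.times_distinct j k hjk)] with y hy _ using hy
  have h2 : ∀ᶠ y in 𝓝 x, ∀ j k, j ≠ k → L y j - L y k ∉ Λ.lattice :=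
    eventually_all.mpr fun j => eventually_all.mpr fun k => by
      by_cases hjk : j = k
      · simp [hjk]
      · filter_upwards [key ((hL' j).sub (hL' k)) (h.zeros_distinct j k hjk)] with y hy _ using hy
  have h3 : ∀ᶠ y in 𝓝 x, ∀ j k, L y k - T y j ∉ Λ.lattice :=
    eventually_all.mpr fun j => eventually_all.mpr fun k =>
      key ((hL' k).sub (hT' j)) (h.zeros_ne_times j k)
  have h4 : ContinuousAt (fun y => ∑ k, L y k - ∑ k, T y k) x :=
    (tendsto_finsetSum _ fun k _ => hL' k).sub (tendsto_finsetSum _ fun k _ => hT' k)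
  filter_upwards [h1, h2, h3, key h4 h.sum_notMem] with y a b c d
  exact ⟨a, b, c, d⟩

lemma differentiableAt_fun_div {f g : E → ℂ} {x : E} (hf : DifferentiableAt ℂ f x)
    (hg : DifferentiableAt ℂ g x) (hx : g x ≠ 0) : DifferentiableAt ℂ (fun x => f x / g x) x := by
  simp only [div_eq_mul_inv]
  exact hf.fun_mul (hg.fun_inv hx)

lemma differentiableAt_fun_prod {ι : Type*} {s : Finset ι} {f : ι → E → ℂ} {x : E}
    (hf : ∀ i ∈ s, DifferentiableAt ℂ (f i) x) : DifferentiableAt ℂ (fun x => ∏ i ∈ s, f i x) x := by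
  classical
  induction s using Finset.induction_on with
  | empty => simp
  | insert a s ha ih =>
    simp only [Finset.prod_insert ha]
    exact (hf a (Finset.mem_insert_self a s)).fun_mul
      (ih fun i hi => hf i (Finset.mem_insert_of_mem hi))

lemma differentiableAt_sigma_comp {f : E → ℂ} {x : E} (hf : DifferentiableAt ℂ f x) :
    DifferentiableAt ℂ (fun x => sigma Λ (f x)) x :=
  (differentiable_sigma Λ (f x)).comp x hf

lemma differentiableAt_deriv_sigma_comp {f : E → ℂ} {x : E} (hf : DifferentiableAt ℂ f x) :
    DifferentiableAt ℂ (fun x => deriv (sigma Λ) (f x)) x :=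
  ((differentiable_sigma Λ).deriv (f x)).comp x hf

lemma differentiableAt_zeta_comp {f : E → ℂ} {x : E} (hf : DifferentiableAt ℂ f x)
    (hx : f x ∉ Λ.lattice) : DifferentiableAt ℂ (fun x => zeta Λ (f x)) x :=
  (hasDerivAt_zeta Λ hx).differentiableAt.comp x hf

lemma differentiableAt_weierstrassP_comp {f : E → ℂ} {x : E} (hf : DifferentiableAt ℂ f x)
    (hx : f x ∉ Λ.lattice) : DifferentiableAt ℂ (fun x => Λ.weierstrassP (f x)) x :=
  (analyticAt_weierstrassP Λ hx).differentiableAt.comp x hf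

lemma differentiableAt_phi_comp {f g : E → ℂ} {x : E} (hf : DifferentiableAt ℂ f x)
    (hg : DifferentiableAt ℂ g x) (hfx : f x ∉ Λ.lattice) (hgx : g x ∉ Λ.lattice) :
    DifferentiableAt ℂ (fun x => phi Λ (f x) (g x)) x := by
  simp only [phi]
  refine differentiableAt_fun_div (differentiableAt_sigma_comp (hf.fun_sub hg)) ?_ ?_
  · exact (differentiableAt_sigma_comp hf).fun_mul (differentiableAt_sigma_comp hg)
  · exact (mul_ne_zero (sigma_ne_zero Λ hfx) (sigma_ne_zero Λ hgx))

lemma differentiableAt_phiZ_comp {f g : E → ℂ} {x : E} (hf : DifferentiableAt ℂ f x)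
    (hg : DifferentiableAt ℂ g x) (hfx : f x ∉ Λ.lattice) (hgx : g x ∉ Λ.lattice) :
    DifferentiableAt ℂ (fun x => phiZ Λ (f x) (g x)) x := by
  simp only [phiZ]
  refine differentiableAt_fun_div ?_ ?_ ?_
  · exact ((differentiableAt_deriv_sigma_comp (hf.fun_sub hg)).fun_add
      ((differentiableAt_sigma_comp (hf.fun_sub hg)).fun_mul
        (differentiableAt_zeta_comp hg hgx))).fun_neg
  · exact (differentiableAt_sigma_comp hf).fun_mul (differentiableAt_sigma_comp hg)
  · exact (mul_ne_zero (sigma_ne_zero Λ hfx) (sigma_ne_zero Λ hgx))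

variable {T L : E → Fin N → ℂ} {x : E}

lemma differentiableAt_sigmaProd_comp {z : E → ℂ} (hT : DifferentiableAt ℂ T x)
    (hz : DifferentiableAt ℂ z x) : DifferentiableAt ℂ (fun x => sigmaProd Λ (T x) (z x)) x := by
  have hT' := differentiableAt_pi.mp hT
  simp only [sigmaProd]
  refine differentiableAt_fun_prod fun k _ => ?_
  exact differentiableAt_sigma_comp (hz.fun_sub (hT' k))

lemma differentiableAt_sigmaProdErase_comp {z : E → ℂ} (hT : DifferentiableAt ℂ T x)
    (hz : DifferentiableAt ℂ z x) (i : Fin N) :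
    DifferentiableAt ℂ (fun x => sigmaProdErase Λ (T x) i (z x)) x := by
  have hT' := differentiableAt_pi.mp hT
  simp only [sigmaProdErase]
  refine differentiableAt_fun_prod fun k _ => ?_
  exact differentiableAt_sigma_comp (hz.fun_sub (hT' k))

lemma differentiableAt_charge (hT : DifferentiableAt ℂ T x) (hL : DifferentiableAt ℂ L x) :
    DifferentiableAt ℂ (fun x => charge (T x) (L x)) x := by
  have hT' := differentiableAt_pi.mp hT
  have hL' := differentiableAt_pi.mp hL
  exact (DifferentiableAt.fun_sum fun k _ => hL' k).fun_sub
    (DifferentiableAt.fun_sum fun k _ => hT' k)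

lemma differentiableAt_ratioRes (hT : DifferentiableAt ℂ T x) (hL : DifferentiableAt ℂ L x)
    (h : IsRegular Λ (T x) (L x)) (i : Fin N) :
    DifferentiableAt ℂ (fun x => ratioRes Λ (T x) (L x) i) x := by
  simp only [ratioRes]
  refine differentiableAt_fun_div ?_ ?_ ?_
  · exact differentiableAt_sigmaProd_comp hL (differentiableAt_pi.mp hT i)
  · exact differentiableAt_sigmaProdErase_comp hT (differentiableAt_pi.mp hT i) i
  · exact (sigmaProdErase_ne_zero fun k hk => h.times_distinct i k hk)

lemma differentiableAt_ratioDeriv (hT : DifferentiableAt ℂ T x) (hL : DifferentiableAt ℂ L x)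
    (h : IsRegular Λ (T x) (L x)) (m : Fin N) :
    DifferentiableAt ℂ (fun x => ratioDeriv Λ (T x) (L x) m) x := by
  simp only [ratioDeriv]
  refine differentiableAt_fun_div ?_ ?_ ?_
  · exact differentiableAt_sigmaProdErase_comp hL (differentiableAt_pi.mp hL m) m
  · exact differentiableAt_sigmaProd_comp hT (differentiableAt_pi.mp hL m)
  · exact (sigmaProd_ne_zero fun k => h.zeros_ne_times k m)

lemma differentiableAt_lagrangeRes (hT : DifferentiableAt ℂ T x) (hL : DifferentiableAt ℂ L x)
    (h : IsRegular Λ (T x) (L x)) (i m : Fin N) :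
    DifferentiableAt ℂ (fun x => lagrangeRes Λ (T x) (L x) i m) x := by
  simp only [lagrangeRes]
  refine differentiableAt_fun_div (DifferentiableAt.fun_mul ?_ ?_) ?_ ?_
  · exact differentiableAt_phi_comp (differentiableAt_charge hT hL).fun_neg
      ((differentiableAt_pi.mp hT i).fun_sub (differentiableAt_pi.mp hL m)) (neg_charge_notMem h)
      (h.sub_time i m)
  · exact differentiableAt_ratioRes hT hL h i
  · exact differentiableAt_ratioDeriv hT hL h m
  · exact ratioDeriv_ne_zero h m

lemma differentiableAt_lagrangeZRes (hT : DifferentiableAt ℂ T x) (hL : DifferentiableAt ℂ L x)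
    (h : IsRegular Λ (T x) (L x)) (i m : Fin N) :
    DifferentiableAt ℂ (fun x => lagrangeZRes Λ (T x) (L x) i m) x := by
  simp only [lagrangeZRes]
  refine differentiableAt_fun_div (DifferentiableAt.fun_mul ?_ ?_) ?_ ?_
  · exact differentiableAt_phiZ_comp (differentiableAt_charge hT hL).fun_neg
      ((differentiableAt_pi.mp hT i).fun_sub (differentiableAt_pi.mp hL m)) (neg_charge_notMem h)
      (h.sub_time i m)
  · exact differentiableAt_ratioRes hT hL h i
  · exact differentiableAt_ratioDeriv hT hL h m
  · exact ratioDeriv_ne_zero h m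

lemma differentiableAt_specHam (θ : Fin N → ℂ) {M : E → Fin N → ℂ} (hT : DifferentiableAt ℂ T x)
    (hL : DifferentiableAt ℂ L x) (hM : DifferentiableAt ℂ M x) (h : IsRegular Λ (T x) (L x))
    (j : Fin N) : DifferentiableAt ℂ (fun x => specHam Λ θ j (L x) (M x) (T x)) x := by
  have hM' := differentiableAt_pi.mp hM
  have h1 : DifferentiableAt ℂ (fun x => ∑ m, (lagrangeRes Λ (T x) (L x) j m *
      (M x m ^ 2 - potential Λ θ (T x) (L x m)) + lagrangeZRes Λ (T x) (L x) j m * M x m)) x := by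
    refine DifferentiableAt.fun_sum fun m _ => ?_
    refine ((differentiableAt_lagrangeRes hT hL h j m).fun_mul
      (((hM' m).fun_pow 2).fun_sub ?_)).fun_add
      ((differentiableAt_lagrangeZRes hT hL h j m).fun_mul (hM' m))
    simp only [potential]
    exact DifferentiableAt.fun_sum fun i _ => (differentiableAt_weierstrassP_comp
      ((differentiableAt_pi.mp hL m).fun_sub (differentiableAt_pi.mp hT i))
      (h.zeros_ne_times i m)).const_mul _
  refine h1.congr_of_eventuallyEq ?_
  filter_upwards [h.eventually hT.continuousAt hL.continuousAt] with y hy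
  exact specHam_eq hy θ (M y) j

end Differentiability

/-! ### Derivatives of the spectral Hamiltonians -/

lemma hasDerivAt_update {a : Fin N → ℂ} (m k : Fin N) (s : ℂ) :
    HasDerivAt (fun s => Function.update a m s k) (if k = m then 1 else 0) s := by
  by_cases hk : k = m
  · subst hk
    simpa using hasDerivAt_id' s
  · simpa [hk] using hasDerivAt_const s (a k)

lemma differentiableAt_update {a : Fin N → ℂ} (m : Fin N) (s : ℂ) :
    DifferentiableAt ℂ (fun s => Function.update a m s) s :=
  differentiableAt_pi.mpr fun k => (hasDerivAt_update m k s).differentiableAt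

lemma pderiv_specHam_momentum (h : IsRegular Λ t l) (θ μ : Fin N → ℂ) (j m : Fin N) :
    pderiv m (fun μ => specHam Λ θ j l μ t) μ =
      2 * μ m * lagrangeRes Λ t l j m + lagrangeZRes Λ t l j m := by
  have h1 : ∀ k ∈ Finset.univ, HasDerivAt (fun s => lagrangeRes Λ t l j k *
      (Function.update μ m s k ^ 2 - potential Λ θ t (l k))
      + lagrangeZRes Λ t l j k * Function.update μ m s k)
      (if k = m then 2 * μ m * lagrangeRes Λ t l j m + lagrangeZRes Λ t l j m else 0) (μ m) := by
    intro k _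
    have hu := hasDerivAt_update (a := μ) m k (μ m)
    refine ((((hu.pow 2).sub_const _).const_mul _).add (hu.const_mul _)).congr_deriv ?_
    by_cases hk : k = m
    · subst hk; simp; ring
    · simp [hk]
  have h2 := HasDerivAt.fun_sum h1
  simp only [pderiv, specHam_eq h]
  rw [h2.deriv]
  simp

lemma hasDerivAt_zeta_comp {f : ℂ → ℂ} {f' s : ℂ} (hf : HasDerivAt f f' s)
    (hs : f s ∉ Λ.lattice) :
    HasDerivAt (fun s => zeta Λ (f s)) (-Λ.weierstrassP (f s) * f') s :=
  (hasDerivAt_zeta Λ hs).comp s hf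

lemma hasDerivAt_potential (θ : Fin N → ℂ) {z : ℂ} (hz : ∀ i, z - t i ∉ Λ.lattice) :
    HasDerivAt (potential Λ θ t) (∑ i, θ i ^ 2 / 4 * Λ.derivWeierstrassP (z - t i)) z := by
  refine HasDerivAt.fun_sum fun i _ => HasDerivAt.const_mul _ ?_
  have h1 := (analyticAt_weierstrassP Λ (hz i)).differentiableAt.hasDerivAt
  rw [Λ.deriv_weierstrassP] at h1
  exact h1.comp_sub_const z (t i)

/-- The derivative at `λ_m` of the elliptic function of the separation relations, after removal of
its pole `-μ_m / (z - λ_m)` by `μ_m Q' P / (Q P')`. -/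
def separationDeriv (Λ : PeriodPair) (θ t l μ : Fin N → ℂ) (m : Fin N) : ℂ :=
  ∑ i, θ i ^ 2 / 4 * Λ.derivWeierstrassP (l m - t i)
    - ∑ j, specHam Λ θ j l μ t * Λ.weierstrassP (l m - t j)
    + ∑ n ∈ Finset.univ.erase m, (μ n - μ m) * Λ.weierstrassP (l m - l n)
    + μ m * ∑ i, Λ.weierstrassP (l m - t i)

/-- The separation relations differentiated with respect to `λ_m`. -/
theorem pderiv_specHam_position (h : IsRegular Λ t l) (θ μ : Fin N → ℂ) (m : Fin N) :
    ∑ j, pderiv m (fun l => specHam Λ θ j l μ t) l = 0 ∧ ∃ b : ℂ, ∀ k,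
      ∑ j, pderiv m (fun l => specHam Λ θ j l μ t) l * zeta Λ (l k - t j) + b =
        if k = m then -separationDeriv Λ θ t l μ m
        else (μ m - μ k) * Λ.weierstrassP (l k - l m) := by
  set lu : ℂ → Fin N → ℂ := fun s => Function.update l m s with hlu
  have hlu0 : lu (l m) = l := Function.update_eq_self m l
  have hreg : ∀ᶠ s in 𝓝 (l m), IsRegular Λ t (lu s) :=
    IsRegular.eventually continuousAt_const (differentiableAt_update m _).continuousAt
      (by rw [hlu0]; exact h)
  have hH : ∀ j, HasDerivAt (fun s => specHam Λ θ j (lu s) μ t)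
      (pderiv m (fun l => specHam Λ θ j l μ t) l) (l m) := fun j =>
    (differentiableAt_specHam θ (differentiableAt_const t) (differentiableAt_update m _)
      (differentiableAt_const μ) (by rw [Function.update_eq_self]; exact h) j).hasDerivAt
  set H' : Fin N → ℂ := fun j => pderiv m (fun l => specHam Λ θ j l μ t) l with hH'
  have hu : ∀ k, HasDerivAt (fun s => lu s k) (if k = m then 1 else 0) (l m) := fun k =>
    hasDerivAt_update m k (l m)
  have hum : ∀ s, lu s m = s := fun s => by simp [hlu]
  have huk : ∀ k s, k ≠ m → lu s k = l k := fun k s hk => by simp [hlu, hk]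
  -- The separation relations with `λ_m = s` state that the `F k s` do not depend on `k`. They are
  -- differentiated at `s = λ_m`; `λ_m` enters `F m` through all terms, but `F k` only through
  -- one term and the Hamiltonians.
  set F : Fin N → ℂ → ℂ := fun k s => μ k ^ 2 - potential Λ θ t (lu s k)
    + ∑ n ∈ Finset.univ.erase k, (μ n - μ k) * zeta Λ (lu s k - lu s n)
    + μ k * ∑ i, zeta Λ (lu s k - t i)
    - ∑ j, specHam Λ θ j (lu s) μ t * zeta Λ (lu s k - t j) with hF
  have hFconst : ∀ k, F k =ᶠ[𝓝 (l m)] F m := by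
    intro k
    filter_upwards [hreg] with s hs
    obtain ⟨-, b, hb⟩ := specHam_relation hs θ μ
    have h1 : ∀ k, F k s = b := by
      intro k
      have h2 := hb k
      simp only [logRatioZero] at h2
      simp only [hF, sub_mul, Finset.sum_sub_distrib, ← Finset.mul_sum]
      linear_combination -h2
    rw [h1, h1]
  have hFm : HasDerivAt (F m) (-separationDeriv Λ θ t l μ m
      - ∑ j, H' j * zeta Λ (l m - t j)) (l m) := by
    have hid : HasDerivAt (fun s => lu s m) 1 (l m) := by simpa using hu m
    have hval : lu (l m) m = l m := hum _
    have h1 : HasDerivAt (fun s => potential Λ θ t (lu s m))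
        (∑ i, θ i ^ 2 / 4 * Λ.derivWeierstrassP (l m - t i)) (l m) := by
      have hp := hasDerivAt_potential (Λ := Λ) (t := t) θ (z := l m)
        (fun i => h.zeros_ne_times i m)
      refine hp.congr_of_eventuallyEq (.of_forall fun s => ?_)
      simp only [hum]
    have h2 : HasDerivAt (fun s => ∑ n ∈ Finset.univ.erase m,
        (μ n - μ m) * zeta Λ (lu s m - lu s n))
        (∑ n ∈ Finset.univ.erase m, (μ n - μ m) * (-Λ.weierstrassP (l m - l n))) (l m) := by
      refine HasDerivAt.fun_sum fun n hn => HasDerivAt.const_mul _ ?_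
      have hnm := Finset.ne_of_mem_erase hn
      have h3 : HasDerivAt (fun s => lu s m - lu s n) (1 - 0) (l m) := by
        refine hid.sub ?_
        simpa [hnm] using hu n
      have h4 := hasDerivAt_zeta_comp (Λ := Λ) h3 (by
        rw [hval, huk n _ hnm]; exact h.zeros_distinct m n hnm.symm)
      refine h4.congr_deriv ?_
      rw [hval, huk n _ hnm]; ring
    have h3 : ∀ i, HasDerivAt (fun s => zeta Λ (lu s m - t i)) (-Λ.weierstrassP (l m - t i))
        (l m) := by
      intro i
      have h4 := hasDerivAt_zeta_comp (Λ := Λ) (hid.sub_const (t i)) (by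
        rw [hval]; exact h.zeros_ne_times i m)
      refine h4.congr_deriv ?_
      rw [hval]; ring
    have h4 := (HasDerivAt.fun_sum (u := Finset.univ) fun i _ => h3 i).const_mul (μ m)
    have h5 := HasDerivAt.fun_sum (u := Finset.univ) fun j _ => (hH j).mul (h3 j)
    refine ((((h1.const_sub (μ m ^ 2)).add h2).add h4).sub h5).congr_deriv ?_
    simp only [separationDeriv, hval, hlu0, mul_neg, Finset.sum_neg_distrib,
      Finset.sum_add_distrib]
    ring
  have hFk : ∀ k, k ≠ m → HasDerivAt (F k) ((μ m - μ k) * Λ.weierstrassP (l k - l m)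
      - ∑ j, H' j * zeta Λ (l k - t j)) (l m) := by
    intro k hk
    have hval : ∀ s, lu s k = l k := fun s => huk k s hk
    have h2 : HasDerivAt (fun s => ∑ n ∈ Finset.univ.erase k,
        (μ n - μ k) * zeta Λ (lu s k - lu s n))
        (∑ n ∈ Finset.univ.erase k,
          if n = m then (μ m - μ k) * Λ.weierstrassP (l k - l m) else 0) (l m) := by
      refine HasDerivAt.fun_sum fun n hn => ?_
      have hnk := Finset.ne_of_mem_erase hn
      simp only [hval]
      by_cases hnm : n = m
      · subst hnm
        have h3 : HasDerivAt (fun s => l k - lu s n) (-1) (l n) := by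
          simpa using (hu n).const_sub (l k)
        have h4 := hasDerivAt_zeta_comp (Λ := Λ) h3 (by
          rw [hum]; exact h.zeros_distinct k n hk)
        refine (h4.const_mul (μ n - μ k)).congr_deriv ?_
        rw [hum, if_pos rfl]; ring
      · simp only [huk n _ hnm, if_neg hnm]
        exact hasDerivAt_const _ _
    have h5 := HasDerivAt.fun_sum (u := Finset.univ) fun j _ =>
      (hH j).mul_const (zeta Λ (l k - t j))
    have h6 := (h2.const_add (μ k ^ 2 - potential Λ θ t (l k))).add_const
      (μ k * ∑ i, zeta Λ (l k - t i)) |>.sub h5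
    have h7 : F k = fun s => μ k ^ 2 - potential Λ θ t (l k)
        + ∑ n ∈ Finset.univ.erase k, (μ n - μ k) * zeta Λ (lu s k - lu s n)
        + μ k * ∑ i, zeta Λ (l k - t i)
        - ∑ j, specHam Λ θ j (lu s) μ t * zeta Λ (l k - t j) := by
      ext s
      simp only [hF, hval]
    rw [h7]
    refine h6.congr_deriv ?_
    rw [Finset.sum_ite_eq', if_pos (Finset.mem_erase.mpr ⟨hk.symm, Finset.mem_univ m⟩)]
  refine ⟨?_, -separationDeriv Λ θ t l μ m - ∑ j, H' j * zeta Λ (l m - t j), fun k => ?_⟩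
  · have h1 := HasDerivAt.fun_sum (u := Finset.univ) fun j _ => hH j
    have h2 : (fun s => ∑ j, specHam Λ θ j (lu s) μ t) =ᶠ[𝓝 (l m)] fun _ => ∑ k, μ k := by
      filter_upwards [hreg] with s hs using (specHam_relation hs θ μ).1
    exact (h1.congr_of_eventuallyEq h2.symm).unique (hasDerivAt_const _ _)
  · by_cases hk : k = m
    · subst hk
      rw [if_pos rfl]; ring
    · rw [if_neg hk]
      have h1 := ((hFk k hk).congr_of_eventuallyEq (hFconst k).symm).unique hFm
      linear_combination -h1

end

section

variable {N : ℕ} {Λ : PeriodPair} {t l : Fin N → ℂ}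

/-! ### Matrix elements of the Lax matrix -/

/-- A section of the degree zero line bundle with multiplier `u`, with poles at the `t_j`. -/
def phiSum (Λ : PeriodPair) (t : Fin N → ℂ) (u : ℂ) (A : Fin N → ℂ) (z : ℂ) : ℂ :=
  ∑ j, A j * phi Λ u (z - t j)

/-- The matrix element `L₁₁(z)`. -/
def laxDiag (Λ : PeriodPair) (t : Fin N → ℂ) (x : Phase N) (z : ℂ) : ℂ :=
  x.p + ∑ j, x.A3 j * zeta Λ (z - t j)

/-- The derivative of `L₁₁`. -/
def laxDiagDeriv (Λ : PeriodPair) (t : Fin N → ℂ) (x : Phase N) (z : ℂ) : ℂ :=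
  -∑ j, x.A3 j * Λ.weierstrassP (z - t j)

/-- The constant term of `L₁₁` at `t_i`. -/
def laxDiagConst (Λ : PeriodPair) (t : Fin N → ℂ) (x : Phase N) (i : Fin N) : ℂ :=
  x.p + ∑ k ∈ Finset.univ.erase i, x.A3 k * zeta Λ (t i - t k)

/-- The matrix element `L₁₂(z)`. -/
def laxUpper (Λ : PeriodPair) (t : Fin N → ℂ) (x : Phase N) (z : ℂ) : ℂ := phiSum Λ t x.q x.Am z

/-- The matrix element `L₂₁(z)`. -/
def laxLower (Λ : PeriodPair) (t : Fin N → ℂ) (x : Phase N) (z : ℂ) : ℂ := phiSum Λ t (-x.q) x.Ap z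

lemma laxMatrix_eq (t : Fin N → ℂ) (x : Phase N) (z : ℂ) :
    laxMatrix Λ t x z = !![laxDiag Λ t x z, laxUpper Λ t x z; laxLower Λ t x z, -laxDiag Λ t x z] := by
  ext i j
  fin_cases i <;> fin_cases j <;>
    simp [laxMatrix, laxDiag, laxUpper, laxLower, phiSum, Matrix.add_apply, Matrix.sum_apply,
      mul_comm, add_comm]

lemma phiSum_add {w : ℂ} (hw : w ∈ Λ.lattice) (u : ℂ) (A : Fin N → ℂ) (z : ℂ) :
    phiSum Λ t u A (z + w) = Complex.exp (-(eta Λ w * u)) * phiSum Λ t u A z := by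
  simp only [phiSum, Finset.mul_sum, add_sub_right_comm, phi_add Λ hw]
  exact Finset.sum_congr rfl fun j _ => by ring

lemma analyticAt_phi_sub {u a z : ℂ} (hu : u ∉ Λ.lattice) (hz : z - a ∉ Λ.lattice) :
    AnalyticAt ℂ (fun z => phi Λ u (z - a)) z :=
  (analyticAt_phi Λ hu hz).fun_comp (f := fun z => z - a) (by fun_prop)

lemma analyticAt_phiSum {u z : ℂ} (hu : u ∉ Λ.lattice) (A : Fin N → ℂ)
    (hz : ∀ i, z - t i ∉ Λ.lattice) : AnalyticAt ℂ (phiSum Λ t u A) z :=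
  Finset.analyticAt_fun_sum _ fun i _ => analyticAt_const.mul (analyticAt_phi_sub hu (hz i))

lemma hasLaurent_phiSum (ht : ∀ j k, j ≠ k → t j - t k ∉ Λ.lattice) {u : ℂ} (hu : u ∉ Λ.lattice)
    (A : Fin N → ℂ) (i : Fin N) : HasLaurent (phiSum Λ t u A) (t i) 0 (A i)
      (∑ k ∈ Finset.univ.erase i, A k * phi Λ u (t i - t k) - A i * zeta Λ u) := by
  have h1 := HasLaurent.of_analyticAt (Finset.analyticAt_fun_sum (Finset.univ.erase i)
    fun k hk => (analyticAt_const (v := A k)).mul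
      (analyticAt_phi_sub (Λ := Λ) hu (ht i k (Finset.ne_of_mem_erase hk).symm)))
  have h2 := ((hasLaurent_phi Λ hu).comp_sub_zero (t i)).const_mul (A i)
  refine ((h2.add h1).congr_val (by simp) (by simp) (by simp; ring)).congr (.of_forall fun z => ?_)
  rw [phiSum, ← Finset.add_sum_erase _ _ (Finset.mem_univ i)]
  rfl

/-- With `A_j` proportional to the residues of `Q / P`, `∑ A_j φ(q, z - t_j)` is proportional to
`Q / P`: the difference is a section without poles of a nontrivial line bundle of degree zero. -/
lemma phiSum_eq_ratio (h : IsRegular Λ t l) {A : Fin N → ℂ} {a : ℂ}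
    (hA : ∀ i, A i = a * ratioRes Λ t l i) {z : ℂ} (hz : ∀ i, z - t i ∉ Λ.lattice) :
    phiSum Λ t (charge t l) A z = a * ratio Λ t l z := by
  choose c hc using fun i => hasLaurent_ratio (l := l) h.times_distinct i
  have hkey := (eq_zero_of_multiplier Λ (a := t) (κ := -charge t l)
    (f := fun z => phiSum Λ t (charge t l) A z - a * ratio Λ t l z) (neg_charge_notMem h)
    (fun w hw z hz => by
      rw [phiSum_add hw, ratio_add hw hz, mul_neg]; ring)
    (fun z hz => (analyticAt_phiSum h.charge_notMem A hz).sub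
      (analyticAt_const.mul (analyticAt_ratio hz)))
    (fun i => ((hasLaurent_phiSum h.times_distinct h.charge_notMem A i).sub
      ((hc i).const_mul a)).congr_val (by simp) (by rw [hA, sub_self]) rfl)).1 z hz
  exact sub_eq_zero.mp hkey

/-- A section `∑ A_j φ(q, z - t_j)` vanishing at all `λ_k` is proportional to `Q / P`, since the
quotient is an elliptic function without poles. -/
lemma exists_eq_mul_ratioRes (h : IsRegular Λ t l) {A : Fin N → ℂ}
    (hA : ∀ k, phiSum Λ t (charge t l) A (l k) = 0) : ∃ a, ∀ i, A i = a * ratioRes Λ t l i := by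
  choose c hc using fun k => hasLaurent_ratio (l := t) h.zeros_distinct k
  have hp : HasPoles Λ l t (fun z => phiSum Λ t (charge t l) A z * ratio Λ l t z) 0 (fun _ => 0)
      (fun _ => 0) (fun i => A i * ratioDeriv Λ l t i) := by
    refine ⟨fun w hw z hz => ?_, fun z hz => ?_, fun k => ?_, fun i => ?_⟩
    · rw [phiSum_add hw, ratio_add hw hz.1, show charge l t = -charge t l by rw [charge, charge]; ring,
        mul_neg, neg_neg, Complex.exp_neg]
      have := Complex.exp_ne_zero (eta Λ w * charge t l)
      field_simp
      ring
    · exact (analyticAt_phiSum h.charge_notMem A hz.2).mul (analyticAt_ratio hz.1)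
    · refine ⟨_, (((hc k).mul_analyticAt (analyticAt_phiSum h.charge_notMem A
        fun i => h.zeros_ne_times i k)).congr_val rfl (by rw [hA, mul_zero]) rfl).congr
        (.of_forall fun z => mul_comm _ _)⟩
    · refine ((hasLaurent_phiSum h.times_distinct h.charge_notMem A i).mul_analyticAt
        (analyticAt_ratio (t := l) (l := t) fun k => h.sub_time i k)).congr_val rfl
        (by rw [ratio_zero, mul_zero]) ?_
      rw [ratio_zero, (hasDerivAt_ratio_zero h.swap i).deriv]
      simp
  obtain ⟨-, b, -, hb⟩ := hp.expand h.swap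
  refine ⟨b, fun i => ?_⟩
  have h1 := hb i
  simp only [zero_mul, Finset.sum_const_zero, zero_add] at h1
  have h2 := ratioRes_ne_zero h i
  have h3 : ratioDeriv Λ l t i = (ratioRes Λ t l i)⁻¹ := by rw [ratioDeriv, ratioRes, inv_div]
  rw [h3] at h1
  rw [← h1]
  field_simp

lemma laxDiag_add {x : Phase N} (hx : ∑ i, x.A3 i = 0) {w : ℂ} (hw : w ∈ Λ.lattice) {z : ℂ}
    (hz : ∀ i, z - t i ∉ Λ.lattice) : laxDiag Λ t x (z + w) = laxDiag Λ t x z := by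
  have h2 : ∀ i, x.A3 i * zeta Λ (z + w - t i) = x.A3 i * zeta Λ (z - t i) + x.A3 i * eta Λ w :=
    fun i => by rw [add_sub_right_comm, zeta_add Λ hw (hz i), mul_add]
  simp only [laxDiag, h2, Finset.sum_add_distrib, ← Finset.sum_mul, hx]
  ring

lemma weierstrassP_add {w : ℂ} (hw : w ∈ Λ.lattice) (z : ℂ) :
    Λ.weierstrassP (z + w) = Λ.weierstrassP z := Λ.weierstrassP_add_coe z ⟨w, hw⟩

lemma analyticAt_laxDiag (x : Phase N) {z : ℂ} (hz : ∀ i, z - t i ∉ Λ.lattice) :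
    AnalyticAt ℂ (laxDiag Λ t x) z :=
  analyticAt_const.add (analyticAt_sum_zeta fun i _ => hz i)

lemma hasLaurent_laxDiag (ht : ∀ j k, j ≠ k → t j - t k ∉ Λ.lattice) (x : Phase N) (i : Fin N) :
    HasLaurent (laxDiag Λ t x) (t i) 0 (x.A3 i) (laxDiagConst Λ t x i) :=
  ((HasLaurent.of_analyticAt (f := fun _ => x.p) analyticAt_const).add
    (hasLaurent_sum_zeta ht x.A3 i)).congr_val (zero_add 0) (zero_add _) rfl

lemma hasDerivAt_laxDiag (x : Phase N) {z : ℂ} (hz : ∀ i, z - t i ∉ Λ.lattice) :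
    HasDerivAt (laxDiag Λ t x) (laxDiagDeriv Λ t x z) z := by
  have h1 := HasDerivAt.fun_sum (u := Finset.univ) fun i _ =>
    ((hasDerivAt_zeta Λ (hz i)).comp_sub_const z (t i)).const_mul (x.A3 i)
  refine (h1.const_add x.p).congr_deriv ?_
  simp [laxDiagDeriv]

lemma analyticAt_weierstrassP_sub {a z : ℂ} (hz : z - a ∉ Λ.lattice) :
    AnalyticAt ℂ (fun z => Λ.weierstrassP (z - a)) z :=
  (analyticAt_weierstrassP Λ hz).fun_comp (f := fun z => z - a) (by fun_prop)

lemma analyticAt_sum_weierstrassP (b : Fin N → ℂ) {S : Finset (Fin N)} {z : ℂ}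
    (hz : ∀ i ∈ S, z - t i ∉ Λ.lattice) :
    AnalyticAt ℂ (fun z => ∑ i ∈ S, b i * Λ.weierstrassP (z - t i)) z :=
  Finset.analyticAt_fun_sum _ fun i hi => analyticAt_const.mul (analyticAt_weierstrassP_sub (hz i hi))

lemma hasLaurent_sum_weierstrassP (ht : ∀ j k, j ≠ k → t j - t k ∉ Λ.lattice) (b : Fin N → ℂ)
    (i : Fin N) : HasLaurent (fun z => ∑ k, b k * Λ.weierstrassP (z - t k)) (t i) (b i) 0
      (∑ k ∈ Finset.univ.erase i, b k * Λ.weierstrassP (t i - t k)) := by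
  have h1 := HasLaurent.of_analyticAt (analyticAt_sum_weierstrassP (Λ := Λ) (t := t) b
    (S := Finset.univ.erase i) (z := t i) fun k hk => ht i k (Finset.ne_of_mem_erase hk).symm)
  have h2 := ((hasLaurent_weierstrassP Λ).comp_sub_zero (t i)).const_mul (b i)
  refine ((h2.add h1).congr_val (by simp) (by simp) (by simp)).congr (.of_forall fun z => ?_)
  beta_reduce
  rw [← Finset.add_sum_erase _ _ (Finset.mem_univ i)]

lemma analyticAt_laxDiagDeriv (x : Phase N) {z : ℂ} (hz : ∀ i, z - t i ∉ Λ.lattice) :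
    AnalyticAt ℂ (laxDiagDeriv Λ t x) z :=
  (analyticAt_sum_weierstrassP x.A3 fun i _ => hz i).neg

lemma analyticAt_potential (θ : Fin N → ℂ) {z : ℂ} (hz : ∀ i, z - t i ∉ Λ.lattice) :
    AnalyticAt ℂ (potential Λ θ t) z :=
  analyticAt_sum_weierstrassP (fun i => θ i ^ 2 / 4) fun i _ => hz i

/-- The explicit form of the quadratic Hamiltonian. -/
def quadHamExplicit (Λ : PeriodPair) (t : Fin N → ℂ) (j : Fin N) (x : Phase N) : ℂ :=
  2 * x.A3 j * laxDiagConst Λ t x j + ∑ k ∈ Finset.univ.erase j,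
    (phi Λ (-x.q) (t j - t k) * x.Am j * x.Ap k + phi Λ x.q (t j - t k) * x.Ap j * x.Am k)

lemma hasLaurent_laxUpper_mul_laxLower (ht : ∀ j k, j ≠ k → t j - t k ∉ Λ.lattice) {x : Phase N}
    (hq : x.q ∉ Λ.lattice) (i : Fin N) :
    ∃ c, HasLaurent (fun z => laxUpper Λ t x z * laxLower Λ t x z) (t i) (x.Ap i * x.Am i)
      (∑ k ∈ Finset.univ.erase i,
        (phi Λ (-x.q) (t i - t k) * x.Am i * x.Ap k + phi Λ x.q (t i - t k) * x.Ap i * x.Am k)) c := by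
  have hq' : -x.q ∉ Λ.lattice := by rwa [neg_mem_iff]
  obtain ⟨c, hc⟩ := (hasLaurent_phiSum ht hq x.Am i).mul (hasLaurent_phiSum ht hq' x.Ap i)
  refine ⟨c, hc.congr_val (mul_comm _ _) ?_ rfl⟩
  rw [zeta_neg, Finset.sum_add_distrib, mul_sub, mul_sub, Finset.mul_sum, Finset.mul_sum]
  have h1 : ∀ k, x.Am i * (x.Ap k * phi Λ (-x.q) (t i - t k))
      = phi Λ (-x.q) (t i - t k) * x.Am i * x.Ap k := fun k => by ring
  have h2 : ∀ k, x.Ap i * (x.Am k * phi Λ x.q (t i - t k))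
      = phi Λ x.q (t i - t k) * x.Ap i * x.Am k := fun k => by ring
  simp only [h1, h2]
  ring

/-- The residue of `½ Tr L² = L₁₁² + L₁₂ L₂₁` at `t_j`. -/
lemma quadHam_eq (ht : ∀ j k, j ≠ k → t j - t k ∉ Λ.lattice) {x : Phase N} (hq : x.q ∉ Λ.lattice)
    (j : Fin N) : quadHam Λ t j x = quadHamExplicit Λ t j x := by
  obtain ⟨c, hc⟩ := hasLaurent_laxUpper_mul_laxLower ht hq j
  have h1 := hasLaurent_laxDiag ht x j
  obtain ⟨c', hc'⟩ := h1.mul h1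
  refine HasLaurent.residue_eq (((hc'.add hc).congr_val rfl ?_ rfl).congr (.of_forall fun z => ?_))
  · rw [quadHamExplicit]; ring
  · beta_reduce
    rw [laxMatrix_eq, pow_two, Matrix.trace_fin_two]
    simp [Matrix.mul_apply]
    ring

/-! ### Configurations with given spectral coordinates -/

/-- `x` is a point of the constrained phase space with spectral coordinates `l`, `μ`, in general
position, for which `L₁₂ = a Q / P`. -/
structure HasSpectralCoordinates (Λ : PeriodPair) (θ t : Fin N → ℂ) (x : Phase N) (l μ : Fin N → ℂ)
    (a : ℂ) : Prop where
  regular : IsRegular Λ t l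
  charge_eq : x.q = charge t l
  spin_constraint : ∑ i, x.A3 i = 0
  leaf : ∀ i, x.A3 i ^ 2 + x.Ap i * x.Am i = θ i ^ 2 / 4
  upper : ∀ i, x.Am i = a * ratioRes Λ t l i
  diag : ∀ k, laxDiag Λ t x (l k) = μ k

variable {θ μ : Fin N → ℂ} {x : Phase N} {a : ℂ}

lemma HasSpectralCoordinates.q_notMem (h : HasSpectralCoordinates Λ θ t x l μ a) :
    x.q ∉ Λ.lattice := h.charge_eq ▸ h.regular.charge_notMem

lemma HasSpectralCoordinates.laxUpper_eq (h : HasSpectralCoordinates Λ θ t x l μ a) {z : ℂ}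
    (hz : ∀ i, z - t i ∉ Λ.lattice) : laxUpper Λ t x z = a * ratio Λ t l z := by
  rw [laxUpper, h.charge_eq]
  exact phiSum_eq_ratio h.regular h.upper hz

lemma HasSpectralCoordinates.neg_q_notMem (h : HasSpectralCoordinates Λ θ t x l μ a) :
    -x.q ∉ Λ.lattice := by
  rw [neg_mem_iff]; exact h.q_notMem

lemma HasSpectralCoordinates.analyticAt_laxLower (h : HasSpectralCoordinates Λ θ t x l μ a) {z : ℂ}
    (hz : ∀ i, z - t i ∉ Λ.lattice) : AnalyticAt ℂ (laxLower Λ t x) z :=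
  analyticAt_phiSum h.neg_q_notMem _ hz

lemma HasSpectralCoordinates.analyticAt_laxUpper (h : HasSpectralCoordinates Λ θ t x l μ a) {z : ℂ}
    (hz : ∀ i, z - t i ∉ Λ.lattice) : AnalyticAt ℂ (laxUpper Λ t x) z :=
  analyticAt_phiSum h.q_notMem _ hz

lemma HasSpectralCoordinates.laxUpper_zero (h : HasSpectralCoordinates Λ θ t x l μ a) (k : Fin N) :
    laxUpper Λ t x (l k) = 0 := by
  rw [h.laxUpper_eq fun i => h.regular.zeros_ne_times i k, ratio_zero, mul_zero]

lemma logRatio_add {w z : ℂ} (hw : w ∈ Λ.lattice) (hz : IsGeneric Λ t l z) :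
    logRatio Λ t l (z + w) = logRatio Λ t l z := by
  have h1 : ∀ k, zeta Λ (z + w - l k) = zeta Λ (z - l k) + eta Λ w := fun k => by
    rw [add_sub_right_comm, zeta_add Λ hw (hz.2 k)]
  have h2 : ∀ k, zeta Λ (z + w - t k) = zeta Λ (z - t k) + eta Λ w := fun k => by
    rw [add_sub_right_comm, zeta_add Λ hw (hz.1 k)]
  simp only [logRatio, h1, h2, Finset.sum_add_distrib]
  ring

/-- The potential of the second order scalar equation satisfied by the first component of a
solution of `Y' = L Y` is, up to `∑ C_i ℘(z - t_i)`, this elliptic function. Its poles at the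
`λ_k` are apparent singularities. -/
def scalarPotential (Λ : PeriodPair) (θ t : Fin N → ℂ) (x : Phase N) (l : Fin N → ℂ) (z : ℂ) : ℂ :=
  laxDiagDeriv Λ t x z + laxDiag Λ t x z * laxDiag Λ t x z + laxUpper Λ t x z * laxLower Λ t x z
    - laxDiag Λ t x z * logRatio Λ t l z - potential Λ θ t z

/-- At `t_i` the double poles cancel because `(A_i³)² + A_i⁺ A_i⁻ = C_i`; at `λ_k` the only singular
term is `-L₁₁ L₁₂' / L₁₂`. -/
lemma HasSpectralCoordinates.hasPoles (h : HasSpectralCoordinates Λ θ t x l μ a) :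
    HasPoles Λ t l (scalarPotential Λ θ t x l) 0
      (fun i => quadHam Λ t i x + laxDiagConst Λ t x i - x.A3 i * logRatioPole Λ t l i)
      (fun k => -μ k)
      (fun k => μ k ^ 2 - potential Λ θ t (l k) - μ k * logRatioZero Λ t l k) := by
  refine ⟨fun w hw z hz => ?_, fun z hz => ?_, fun i => ?_, fun k => ?_⟩
  · have h1 : Complex.exp (-(eta Λ w * x.q)) * Complex.exp (-(eta Λ w * -x.q)) = 1 := by
      rw [← Complex.exp_add, ← Complex.exp_zero]; congr 1; ring
    simp only [scalarPotential, laxDiagDeriv, potential, laxDiag_add h.spin_constraint hw hz.1,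
      logRatio_add hw hz, laxUpper, laxLower, phiSum_add hw, add_sub_right_comm z w,
      weierstrassP_add hw]
    linear_combination (phiSum Λ t x.q x.Am z * phiSum Λ t (-x.q) x.Ap z) * h1
  · have h1 := analyticAt_laxDiag x hz.1
    exact ((((analyticAt_laxDiagDeriv x hz.1).add (h1.mul h1)).add
      ((h.analyticAt_laxUpper hz.1).mul (h.analyticAt_laxLower hz.1))).sub
      (h1.mul (analyticAt_logRatio hz))).sub (analyticAt_potential θ hz.1)
  · have hd := h.regular.times_distinct
    have h1 := hasLaurent_laxDiag hd x i
    obtain ⟨c₁, hc₁⟩ := h1.mul h1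
    obtain ⟨c₂, hc₂⟩ := h1.mul (hasLaurent_logRatio_pole h.regular i)
    obtain ⟨c₃, hc₃⟩ := hasLaurent_laxUpper_mul_laxLower hd h.q_notMem i
    have h2 := (hasLaurent_sum_weierstrassP hd x.A3 i).neg
    have h3 := hasLaurent_sum_weierstrassP hd (fun i => θ i ^ 2 / 4) i
    refine ⟨_, ((((h2.add hc₁).add hc₃).sub hc₂).sub h3).congr_val ?_ ?_ rfl⟩
    · linear_combination h.leaf i
    · rw [quadHam_eq hd h.q_notMem, quadHamExplicit]; ring
  · have hz : ∀ i, l k - t i ∉ Λ.lattice := fun i => h.regular.zeros_ne_times i k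
    have h1 := analyticAt_laxDiag x hz
    have h2 := HasLaurent.of_analyticAt (((analyticAt_laxDiagDeriv x hz).add (h1.mul h1)).add
      ((h.analyticAt_laxUpper hz).mul (h.analyticAt_laxLower hz)))
    have h3 := (hasLaurent_logRatio_zero h.regular k).mul_analyticAt h1
    have h4 := HasLaurent.of_analyticAt (analyticAt_potential θ hz)
    refine (((h2.sub h3).sub h4).congr_val (by simp) ?_ ?_).congr (.of_forall fun z => ?_)
    · rw [h.diag]; ring
    · rw [(hasDerivAt_laxDiag x hz).deriv]
      simp only [Pi.add_apply, Pi.mul_apply, h.diag, h.laxUpper_zero]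
      ring
    · simp only [scalarPotential, Pi.add_apply, Pi.mul_apply]; ring

/-- The value of the spectral Hamiltonian: both sides are the residue at `t_i` of the elliptic
function of the separation relations. -/
theorem HasSpectralCoordinates.specHam_eq (h : HasSpectralCoordinates Λ θ t x l μ a) (i : Fin N) :
    specHam Λ θ i l μ t =
      quadHam Λ t i x + laxDiagConst Λ t x i - x.A3 i * logRatioPole Λ t l i := by
  obtain ⟨h1, b, -, hb⟩ := h.hasPoles.expand h.regular
  obtain ⟨h2, b', hb'⟩ := specHam_relation h.regular θ μ
  rw [Finset.sum_neg_distrib] at h1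
  refine (eq_of_values_eq h.regular (x := fun i => specHam Λ θ i l μ t)
    (y := fun i => quadHam Λ t i x + laxDiagConst Λ t x i - x.A3 i * logRatioPole Λ t l i)
    (x₀ := b') (y₀ := b) ?_ fun k => ?_).1 i
  · rw [h2]; linear_combination -h1
  · have h3 := hb k
    simp only [neg_mul, Finset.sum_neg_distrib] at h3
    linear_combination hb' k + h3

lemma deriv_deriv_eq_two_mul {f : ℂ → ℂ} {z : ℂ} (hf : AnalyticAt ℂ f z) :
    deriv (deriv f) z = 2 * deriv (dslope f z) z := by
  have hD := analyticAt_dslope hf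
  have h1 : f =ᶠ[𝓝 z] fun y => f z + (y - z) * dslope f z y := .of_forall fun y => by
    have := sub_smul_dslope f z y
    rw [smul_eq_mul] at this
    linear_combination -this
  have h2 : deriv f =ᶠ[𝓝 z] fun y => dslope f z y + (y - z) * deriv (dslope f z) y := by
    filter_upwards [h1.eventuallyEq_nhds, hD.eventually_analyticAt] with y hy hDy
    rw [hy.deriv_eq]
    have h3 := (((hasDerivAt_id' y).sub_const z).fun_mul hDy.differentiableAt.hasDerivAt).const_add (f z)
    rw [h3.deriv]; ring
  rw [h2.deriv_eq]
  have h4 := hD.differentiableAt.hasDerivAt.fun_add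
    (((hasDerivAt_id' z).sub_const z).fun_mul hD.deriv.differentiableAt.hasDerivAt)
  rw [h4.deriv]; ring

/-- The function `L₁₁(z) - μ_m`, which vanishes at `λ_m`. -/
def laxDiagSub (Λ : PeriodPair) (t : Fin N → ℂ) (x : Phase N) (b z : ℂ) : ℂ := laxDiag Λ t x z - b

/-- The derivative at `λ_m` of the function of the separation relations, in terms of the Lax
matrix. -/
lemma HasSpectralCoordinates.separationDeriv_eq (h : HasSpectralCoordinates Λ θ t x l μ a)
    (m : Fin N) : separationDeriv Λ θ t l μ m =
      deriv (dslope (laxDiagSub Λ t x (μ m)) (l m)) (l m)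
        + a * ratioDeriv Λ t l m * laxLower Λ t x (l m)
        + laxDiagDeriv Λ t x (l m) * (2 * μ m - logRatioZero Λ t l m) := by
  have hz : ∀ i, l m - t i ∉ Λ.lattice := fun i => h.regular.zeros_ne_times i m
  obtain ⟨-, b, hexp, -⟩ := h.hasPoles.expand h.regular
  obtain ⟨g, hg, hgm, hlog⟩ := hasLaurent_logRatio_zero h.regular m
  set D := dslope (laxDiagSub Λ t x (μ m)) (l m) with hDdef
  have hL := analyticAt_laxDiag x hz
  have hh : AnalyticAt ℂ (laxDiagSub Λ t x (μ m)) (l m) := hL.sub analyticAt_const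
  have hD : AnalyticAt ℂ D (l m) := analyticAt_dslope hh
  have hL' := analyticAt_laxDiagDeriv x hz
  have hR : AnalyticAt ℂ (ratio Λ t l) (l m) := analyticAt_ratio hz
  have hLow := h.analyticAt_laxLower hz
  have hh0 : laxDiagSub Λ t x (μ m) (l m) = 0 := by rw [laxDiagSub, h.diag, sub_self]
  -- The expansion of the scalar potential in partial fractions, with the poles at `λ_m` cancelled,
  -- reads `A = B`. Both sides are analytic at `λ_m`, and their derivatives are compared.
  set A : ℂ → ℂ := fun z => laxDiagDeriv Λ t x z + laxDiag Λ t x z * laxDiag Λ t x z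
    + a * ratio Λ t l z * laxLower Λ t x z - D z - laxDiagSub Λ t x (μ m) z * g z with hA
  set B : ℂ → ℂ := fun z => ∑ i, specHam Λ θ i l μ t * zeta Λ (z - t i)
    + ∑ n ∈ Finset.univ.erase m, (μ m - μ n) * zeta Λ (z - l n)
    - μ m * ∑ i, zeta Λ (z - t i) + b + potential Λ θ t z with hB
  have hAB : A =ᶠ[𝓝[≠] (l m)] B := by
    filter_upwards [hlog, eventually_isGeneric Λ t l (l m), HasLaurent.eventually_sub_ne (l m)]
      with z h1 hzg hne
    have h2 := hexp z hzg
    simp only [← h.specHam_eq, neg_mul, Finset.sum_neg_distrib] at h2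
    have h3 : laxDiagSub Λ t x (μ m) z = (z - l m) * D z := by
      have := sub_smul_dslope (laxDiagSub Λ t x (μ m)) (l m) z
      rw [smul_eq_mul, hh0, sub_zero] at this
      exact this.symm
    have h4 : laxDiagSub Λ t x (μ m) z * (logRatio Λ t l z - g z) = D z := by
      rw [h1, h3]; field_simp; ring
    have h5 : ∑ n ∈ Finset.univ.erase m, (μ m - μ n) * zeta Λ (z - l n)
        = μ m * ∑ n, zeta Λ (z - l n) - ∑ n, μ n * zeta Λ (z - l n) := by
      rw [← Finset.add_sum_erase _ _ (Finset.mem_univ m),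
        ← Finset.add_sum_erase _ (fun n => μ n * zeta Λ (z - l n)) (Finset.mem_univ m), mul_add,
        Finset.mul_sum]
      simp only [sub_mul, Finset.sum_sub_distrib]
      ring
    have h6 : logRatio Λ t l z = ∑ n, zeta Λ (z - l n) - ∑ i, zeta Λ (z - t i) := rfl
    simp only [scalarPotential, h.laxUpper_eq hzg.1] at h2
    simp only [hA, hB, h5]
    rw [laxDiagSub] at h4 ⊢
    linear_combination h2 + h4 + μ m * h6
  have hA' : HasDerivAt A (deriv (dslope (laxDiagSub Λ t x (μ m)) (l m)) (l m)
      + a * ratioDeriv Λ t l m * laxLower Λ t x (l m)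
      + laxDiagDeriv Λ t x (l m) * (2 * μ m - logRatioZero Λ t l m)) (l m) := by
    have hd := hasDerivAt_laxDiag x hz
    have hds : HasDerivAt (laxDiagSub Λ t x (μ m)) (laxDiagDeriv Λ t x (l m)) (l m) :=
      hd.sub_const (μ m)
    have h1 := hL'.differentiableAt.hasDerivAt
    have h2 : deriv (laxDiagDeriv Λ t x) (l m) = 2 * deriv D (l m) := by
      rw [hDdef, ← deriv_deriv_eq_two_mul hh]
      refine Filter.EventuallyEq.deriv_eq ?_
      filter_upwards [(eventually_all.mpr fun i => ((continuous_id.sub continuous_const).continuousAt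
        (f := fun z : ℂ => z - t i) (x := l m)).eventually
          (Λ.isClosed_lattice.isOpen_compl.mem_nhds (hz i)))] with z hz'
      exact ((hasDerivAt_laxDiag x hz').sub_const (μ m)).deriv.symm
    refine ((((h1.fun_add (hd.fun_mul hd)).fun_add (((hasDerivAt_ratio_zero h.regular m).const_mul
      a).fun_mul hLow.differentiableAt.hasDerivAt)).fun_sub hD.differentiableAt.hasDerivAt).fun_sub
      (hds.fun_mul hg.differentiableAt.hasDerivAt)).congr_deriv ?_
    rw [h2, hh0, hgm, h.diag, ratio_zero]
    ring
  have hB' : HasDerivAt B (separationDeriv Λ θ t l μ m) (l m) := by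
    have hζt : ∀ i, HasDerivAt (fun z => zeta Λ (z - t i)) (-Λ.weierstrassP (l m - t i)) (l m) :=
      fun i => (hasDerivAt_zeta Λ (hz i)).comp_sub_const (l m) (t i)
    have h1 := HasDerivAt.fun_sum (u := Finset.univ)
      fun i _ => (hζt i).const_mul (specHam Λ θ i l μ t)
    have h2 : HasDerivAt (fun z => ∑ n ∈ Finset.univ.erase m, (μ m - μ n) * zeta Λ (z - l n))
        (∑ n ∈ Finset.univ.erase m, (μ m - μ n) * -Λ.weierstrassP (l m - l n)) (l m) :=
      HasDerivAt.fun_sum fun n hn => ((hasDerivAt_zeta Λ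
        (h.regular.zeros_distinct m n (Finset.ne_of_mem_erase hn).symm)).comp_sub_const
          (l m) (l n)).const_mul _
    have h3 := (HasDerivAt.fun_sum (u := Finset.univ) fun i _ => hζt i).const_mul (μ m)
    refine ((((h1.fun_add h2).fun_sub h3).add_const b).fun_add
      (hasDerivAt_potential θ hz)).congr_deriv ?_
    simp only [separationDeriv, mul_neg, Finset.sum_neg_distrib, sub_mul, Finset.sum_sub_distrib]
    ring
  have hAan : AnalyticAt ℂ A (l m) :=
    (((hL'.add (hL.mul hL)).add ((analyticAt_const.mul hR).mul hLow)).sub hD).sub (hh.mul hg)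
  have hBan : AnalyticAt ℂ B (l m) := by
    refine AnalyticAt.add (AnalyticAt.add (AnalyticAt.sub (AnalyticAt.add
      (analyticAt_sum_zeta fun i _ => hz i) ?_) ?_) analyticAt_const) (analyticAt_potential θ hz)
    · exact analyticAt_sum_zeta fun n hn =>
        h.regular.zeros_distinct m n (Finset.ne_of_mem_erase hn).symm
    · exact analyticAt_const.mul (Finset.analyticAt_fun_sum _ fun i _ => analyticAt_zeta_sub (hz i))
  have hev : A =ᶠ[𝓝 (l m)] B := (hAan.frequently_eq_iff_eventually_eq hBan).mp hAB.frequently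
  exact hB'.unique (hA'.congr_of_eventuallyEq hev.symm)

/-- The velocity `∂μ_m / ∂t_i` in terms of the Lax matrix. -/
def momentumVelocity (Λ : PeriodPair) (t : Fin N → ℂ) (x : Phase N) (l μ : Fin N → ℂ) (a : ℂ)
    (i m : Fin N) : ℂ :=
  Λ.weierstrassP (t i - l m) * x.A3 i
    + a * ratioDeriv Λ t l m * laxLower Λ t x (l m) * lagrangeRes Λ t l i m
    + laxDiagDeriv Λ t x (l m) * (2 * μ m * lagrangeRes Λ t l i m + lagrangeZRes Λ t l i m)

/-- The force of the spectral Hamiltonian: both sides are the residue at `t_i` of an elliptic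
function with poles at the `t_i` and prescribed values at the `λ_k`. -/
theorem HasSpectralCoordinates.neg_pderiv_specHam_position
    (h : HasSpectralCoordinates Λ θ t x l μ a) (i m : Fin N) :
    -pderiv m (fun l => specHam Λ θ i l μ t) l = momentumVelocity Λ t x l μ a i m := by
  have hz : ∀ k i, l k - t i ∉ Λ.lattice := fun k i => h.regular.zeros_ne_times i k
  -- `(L₁₁(z) - μ_m) ℘(z - λ_m)` has the values required at the `λ_k` with `k ≠ m`; multiples of
  -- `lagrange m` and `lagrangeZ m` correct the value and remove the pole at `λ_m`.
  have hp : HasPoles Λ t l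
      (fun z => laxDiagSub Λ t x (μ m) z * Λ.weierstrassP (z - l m)) 0
      (fun i => Λ.weierstrassP (t i - l m) * x.A3 i)
      (fun k => if k = m then laxDiagDeriv Λ t x (l m) else 0)
      (fun k => if k = m then deriv (dslope (laxDiagSub Λ t x (μ m)) (l m)) (l m)
        else (μ k - μ m) * Λ.weierstrassP (l k - l m)) := by
    refine ⟨fun w hw z hz => ?_, fun z hz => ?_, fun i => ?_, fun k => ?_⟩
    · simp only [laxDiagSub]
      rw [laxDiag_add h.spin_constraint hw hz.1, add_sub_right_comm z w, weierstrassP_add hw]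
      ring
    · exact ((analyticAt_laxDiag x hz.1).sub analyticAt_const).mul
        (analyticAt_weierstrassP_sub (hz.2 m))
    · refine ⟨_, (((hasLaurent_laxDiag h.regular.times_distinct x i).sub
        (HasLaurent.of_analyticAt (f := fun _ => μ m) analyticAt_const)).congr_val (sub_zero 0)
        rfl rfl).mul_analyticAt (analyticAt_weierstrassP_sub (h.regular.sub_time i m))
        |>.congr_val rfl (by ring) rfl⟩
    · by_cases hk : k = m
      · subst hk
        have h1 := ((hasLaurent_weierstrassP Λ).comp_sub_zero (l k)).mul_zero
          ((analyticAt_laxDiag x (hz k)).sub (analyticAt_const (v := μ k)))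
          (by simp [h.diag])
        refine (h1.congr_val rfl ?_ ?_).congr (.of_forall fun z => mul_comm _ _)
        · rw [if_pos rfl, one_mul]
          exact ((hasDerivAt_laxDiag x (hz k)).sub_const (μ k)).deriv
        · rw [if_pos rfl, one_mul]; rfl
      · rw [if_neg hk, if_neg hk]
        exact (HasLaurent.of_analyticAt (((analyticAt_laxDiag x (hz k)).sub
          (analyticAt_const (v := μ m))).mul (analyticAt_weierstrassP_sub
            (h.regular.zeros_distinct k m hk)))).congr_val rfl rfl (by simp [h.diag])
  have h1 := (hp.add ((hasPoles_lagrange h.regular m).const_mul (a * ratioDeriv Λ t l m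
    * laxLower Λ t x (l m) + laxDiagDeriv Λ t x (l m) * (2 * μ m)))).add
    ((hasPoles_lagrangeZ h.regular m).const_mul (laxDiagDeriv Λ t x (l m)))
  have h2 := h1.congr_val (s' := 0) (r' := fun i => momentumVelocity Λ t x l μ a i m)
    (ρ' := fun _ => 0) (γ' := fun k => if k = m then separationDeriv Λ θ t l μ m
      else (μ k - μ m) * Λ.weierstrassP (l k - l m)) (by simp)
    (fun i => by rw [momentumVelocity]; ring)
    (fun k => by by_cases hk : k = m <;> simp [hk])
    (fun k => by
      by_cases hk : k = m
      · simp only [hk, if_true]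
        rw [h.separationDeriv_eq m]; ring
      · simp [hk])
  obtain ⟨h3, b, -, hb⟩ := h2.expand h.regular
  obtain ⟨h4, b', hb'⟩ := pderiv_specHam_position h.regular θ μ m
  have h5 := (eq_of_values_eq h.regular
    (x := fun i => -pderiv m (fun l => specHam Λ θ i l μ t) l)
    (y := fun i => momentumVelocity Λ t x l μ a i m) (x₀ := -b') (y₀ := b) ?_ fun k => ?_).1 i
  · exact h5
  · rw [Finset.sum_neg_distrib, h4]
    simpa using h3.symm
  · have h6 := hb k
    have h7 := hb' k
    simp only [zero_mul, Finset.sum_const_zero, add_zero] at h6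
    simp only [neg_mul, Finset.sum_neg_distrib]
    by_cases hk : k = m
    · rw [if_pos hk] at h6 h7
      linear_combination h6 - h7
    · rw [if_neg hk] at h6 h7
      linear_combination h6 - h7

end

section

variable {N : ℕ} {Λ : PeriodPair} {t : Fin N → ℂ}

/-! ### The flows of the quadratic Hamiltonians -/

lemma poisson_q (G : Phase N → ℂ) (x : Phase N) : poisson (fun x => x.q) G x = dp G x := by
  simp [poisson, dq, dp, d3, dPlus, dMinus, pderiv]

lemma poisson_p (G : Phase N → ℂ) (x : Phase N) : poisson (fun x => x.p) G x = -dq G x := by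
  simp [poisson, dq, dp, d3, dPlus, dMinus, pderiv]

lemma deriv_update (a : Fin N → ℂ) (i k : Fin N) (s : ℂ) :
    deriv (fun s => Function.update a i s k) s = if k = i then 1 else 0 :=
  (hasDerivAt_update i k s).deriv

lemma poisson_A3 (G : Phase N → ℂ) (x : Phase N) (k : Fin N) :
    poisson (fun x => x.A3 k) G x = x.Ap k * dPlus k G x - x.Am k * dMinus k G x := by
  have h1 : ∀ i, d3 i (fun x : Phase N => x.A3 k) x = if k = i then 1 else 0 := fun i =>
    deriv_update _ _ _ _
  have h2 : ∀ i, dPlus i (fun x : Phase N => x.A3 k) x = 0 := fun i => by simp [dPlus, pderiv]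
  have h3 : ∀ i, dMinus i (fun x : Phase N => x.A3 k) x = 0 := fun i => by simp [dMinus, pderiv]
  simp only [poisson, h1, h2, h3]
  simp [dq, dp]

lemma poisson_Ap (G : Phase N → ℂ) (x : Phase N) (k : Fin N) :
    poisson (fun x => x.Ap k) G x = 2 * x.A3 k * dMinus k G x - x.Ap k * d3 k G x := by
  have h1 : ∀ i, dPlus i (fun x : Phase N => x.Ap k) x = if k = i then 1 else 0 := fun i =>
    deriv_update _ _ _ _
  have h2 : ∀ i, d3 i (fun x : Phase N => x.Ap k) x = 0 := fun i => by simp [d3, pderiv]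
  have h3 : ∀ i, dMinus i (fun x : Phase N => x.Ap k) x = 0 := fun i => by simp [dMinus, pderiv]
  simp only [poisson, h1, h2, h3]
  simp [dq, dp, Finset.sum_add_distrib]
  ring

lemma poisson_Am (G : Phase N → ℂ) (x : Phase N) (k : Fin N) :
    poisson (fun x => x.Am k) G x = x.Am k * d3 k G x - 2 * x.A3 k * dPlus k G x := by
  have h1 : ∀ i, dMinus i (fun x : Phase N => x.Am k) x = if k = i then 1 else 0 := fun i =>
    deriv_update _ _ _ _
  have h2 : ∀ i, d3 i (fun x : Phase N => x.Am k) x = 0 := fun i => by simp [d3, pderiv]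
  have h3 : ∀ i, dPlus i (fun x : Phase N => x.Am k) x = 0 := fun i => by simp [dPlus, pderiv]
  simp only [poisson, h1, h2, h3]
  simp [dq, dp, Finset.sum_add_distrib]
  ring

lemma d3_totalSpin (x : Phase N) (k : Fin N) : d3 k totalSpin x = 1 := by
  have h1 := HasDerivAt.fun_sum (u := Finset.univ)
    fun i _ => hasDerivAt_update (a := x.A3) k i (x.A3 k)
  refine h1.deriv.trans ?_
  simp

lemma totalSpin_partials (x : Phase N) : dq totalSpin x = 0 ∧ dp totalSpin x = 0 ∧
    (∀ k, dPlus k totalSpin x = 0) ∧ ∀ k, dMinus k totalSpin x = 0 := by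
  simp [dq, dp, dPlus, dMinus, pderiv, totalSpin]

lemma dp_quadHam (ht : ∀ j k, j ≠ k → t j - t k ∉ Λ.lattice) {x : Phase N}
    (hq : x.q ∉ Λ.lattice) (j : Fin N) : dp (quadHam Λ t j) x = 2 * x.A3 j := by
  have h0 : ∀ s, quadHam Λ t j { x with p := s } = quadHamExplicit Λ t j { x with p := s } :=
    fun s => quadHam_eq ht (x := { x with p := s }) hq j
  simp only [dp, h0, quadHamExplicit, laxDiagConst]
  have h1 := ((((hasDerivAt_id' x.p).add_const (∑ k ∈ Finset.univ.erase j,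
    x.A3 k * zeta Λ (t j - t k))).const_mul (2 * x.A3 j)).add_const (∑ k ∈ Finset.univ.erase j,
    (phi Λ (-x.q) (t j - t k) * x.Am j * x.Ap k + phi Λ x.q (t j - t k) * x.Ap j * x.Am k)))
  rw [h1.deriv, mul_one]

lemma dq_quadHam (ht : ∀ j k, j ≠ k → t j - t k ∉ Λ.lattice) {x : Phase N}
    (hq : x.q ∉ Λ.lattice) (j : Fin N) : dq (quadHam Λ t j) x = ∑ k ∈ Finset.univ.erase j,
    (phiU Λ x.q (t j - t k) * x.Ap j * x.Am k - phiU Λ (-x.q) (t j - t k) * x.Am j * x.Ap k) := by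
  have hq' : -x.q ∉ Λ.lattice := by rwa [neg_mem_iff]
  have h0 : (fun s => quadHam Λ t j { x with q := s }) =ᶠ[𝓝 x.q]
      fun s => quadHamExplicit Λ t j { x with q := s } := by
    filter_upwards [Λ.isClosed_lattice.isOpen_compl.mem_nhds hq] with s hs
    exact quadHam_eq ht (x := { x with q := s }) hs j
  rw [dq, h0.deriv_eq]
  simp only [quadHamExplicit, laxDiagConst]
  refine HasDerivAt.deriv (HasDerivAt.const_add _ (HasDerivAt.fun_sum fun k _ => ?_))
  have h1 := hasDerivAt_phiU Λ hq (t j - t k)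
  have h2 : HasDerivAt (fun s => phi Λ (-s) (t j - t k)) (phiU Λ (-x.q) (t j - t k) * -1) x.q :=
    (hasDerivAt_phiU Λ hq' (t j - t k)).comp x.q (hasDerivAt_neg x.q)
  refine (((h2.mul_const (x.Am j)).mul_const (x.Ap k)).fun_add
    ((h1.mul_const (x.Ap j)).mul_const (x.Am k))).congr_deriv ?_
  ring

lemma d3_quadHam (ht : ∀ j k, j ≠ k → t j - t k ∉ Λ.lattice) {x : Phase N}
    (hq : x.q ∉ Λ.lattice) (j k : Fin N) : d3 k (quadHam Λ t j) x =
    if k = j then 2 * laxDiagConst Λ t x j else 2 * x.A3 j * zeta Λ (t j - t k) := by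
  have h0 : ∀ a, quadHam Λ t j { x with A3 := a } = quadHamExplicit Λ t j { x with A3 := a } :=
    fun a => quadHam_eq ht (x := { x with A3 := a }) hq j
  simp only [d3, pderiv, h0, quadHamExplicit, laxDiagConst]
  have hu := fun i => hasDerivAt_update (a := x.A3) k i (x.A3 k)
  have h1 := (((hu j).const_mul 2).fun_mul ((HasDerivAt.fun_sum (u := Finset.univ.erase j)
    fun i _ => (hu i).mul_const (zeta Λ (t j - t i))).const_add x.p)).add_const
    (∑ k ∈ Finset.univ.erase j, (phi Λ (-x.q) (t j - t k) * x.Am j * x.Ap k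
      + phi Λ x.q (t j - t k) * x.Ap j * x.Am k))
  rw [h1.deriv]
  by_cases hk : k = j
  · subst hk; simp
  · simp [hk, Ne.symm hk]

lemma dPlus_quadHam (ht : ∀ j k, j ≠ k → t j - t k ∉ Λ.lattice) {x : Phase N}
    (hq : x.q ∉ Λ.lattice) (j k : Fin N) : dPlus k (quadHam Λ t j) x =
    if k = j then ∑ i ∈ Finset.univ.erase j, phi Λ x.q (t j - t i) * x.Am i
    else phi Λ (-x.q) (t j - t k) * x.Am j := by
  have h0 : ∀ a, quadHam Λ t j { x with Ap := a } = quadHamExplicit Λ t j { x with Ap := a } :=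
    fun a => quadHam_eq ht (x := { x with Ap := a }) hq j
  simp only [dPlus, pderiv, h0, quadHamExplicit, laxDiagConst]
  have hu := fun i => hasDerivAt_update (a := x.Ap) k i (x.Ap k)
  have h1 := (HasDerivAt.fun_sum (u := Finset.univ.erase j) fun i _ =>
    ((hu i).const_mul (phi Λ (-x.q) (t j - t i) * x.Am j)).fun_add
      (((hu j).const_mul (phi Λ x.q (t j - t i))).mul_const (x.Am i))).const_add
      (2 * x.A3 j * (x.p + ∑ i ∈ Finset.univ.erase j, x.A3 i * zeta Λ (t j - t i)))
  rw [h1.deriv]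
  by_cases hk : k = j
  · subst hk
    simp only [if_true, mul_one, Finset.sum_add_distrib]
    rw [Finset.sum_eq_zero fun i hi => by rw [if_neg (Finset.ne_of_mem_erase hi), mul_zero], zero_add]
  · simp [hk, Ne.symm hk]

lemma dMinus_quadHam (ht : ∀ j k, j ≠ k → t j - t k ∉ Λ.lattice) {x : Phase N}
    (hq : x.q ∉ Λ.lattice) (j k : Fin N) : dMinus k (quadHam Λ t j) x =
    if k = j then ∑ i ∈ Finset.univ.erase j, phi Λ (-x.q) (t j - t i) * x.Ap i
    else phi Λ x.q (t j - t k) * x.Ap j := by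
  have h0 : ∀ a, quadHam Λ t j { x with Am := a } = quadHamExplicit Λ t j { x with Am := a } :=
    fun a => quadHam_eq ht (x := { x with Am := a }) hq j
  simp only [dMinus, pderiv, h0, quadHamExplicit, laxDiagConst]
  have hu := fun i => hasDerivAt_update (a := x.Am) k i (x.Am k)
  have h1 := (HasDerivAt.fun_sum (u := Finset.univ.erase j) fun i _ =>
    (((hu j).const_mul (phi Λ (-x.q) (t j - t i))).mul_const (x.Ap i)).fun_add
      ((hu i).const_mul (phi Λ x.q (t j - t i) * x.Ap j))).const_add
      (2 * x.A3 j * (x.p + ∑ i ∈ Finset.univ.erase j, x.A3 i * zeta Λ (t j - t i)))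
  rw [h1.deriv]
  by_cases hk : k = j
  · subst hk
    simp only [if_true, mul_one, Finset.sum_add_distrib]
    exact add_eq_left.mpr (Finset.sum_eq_zero fun i hi => by
      rw [if_neg (Finset.ne_of_mem_erase hi), mul_zero])
  · simp [hk, Ne.symm hk]

/-- The velocity `∂p / ∂t_j`. -/
def flowP (Λ : PeriodPair) (t : Fin N → ℂ) (x : Phase N) (j : Fin N) : ℂ :=
  ∑ k ∈ Finset.univ.erase j,
    (phiU Λ (-x.q) (t j - t k) * x.Am j * x.Ap k - phiU Λ x.q (t j - t k) * x.Ap j * x.Am k)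

/-- The exchange of spin between the sites `j` and `k`. -/
def exchange (Λ : PeriodPair) (t : Fin N → ℂ) (x : Phase N) (j k : Fin N) : ℂ :=
  phi Λ (-x.q) (t j - t k) * x.Am j * x.Ap k - phi Λ x.q (t j - t k) * x.Ap j * x.Am k

/-- The velocity `∂A_k³ / ∂t_j`. -/
def flowA3 (Λ : PeriodPair) (t : Fin N → ℂ) (x : Phase N) (j k : Fin N) : ℂ :=
  if k = j then -∑ i ∈ Finset.univ.erase j, exchange Λ t x j i else exchange Λ t x j k

/-- The velocity `∂A_k⁺ / ∂t_j`, where `c` is twice the multiplier. -/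
def flowAp (Λ : PeriodPair) (t : Fin N → ℂ) (x : Phase N) (c : ℂ) (j k : Fin N) : ℂ :=
  if k = j then -2 * laxDiagConst Λ t x j * x.Ap j
    + 2 * x.A3 j * ∑ i ∈ Finset.univ.erase j, phi Λ (-x.q) (t j - t i) * x.Ap i + c * x.Ap j
  else -2 * x.A3 j * zeta Λ (t j - t k) * x.Ap k
    + 2 * x.A3 k * phi Λ x.q (t j - t k) * x.Ap j + c * x.Ap k

/-- The velocity `∂A_k⁻ / ∂t_j`, where `c` is twice the multiplier. -/
def flowAm (Λ : PeriodPair) (t : Fin N → ℂ) (x : Phase N) (c : ℂ) (j k : Fin N) : ℂ :=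
  if k = j then 2 * laxDiagConst Λ t x j * x.Am j
    - 2 * x.A3 j * ∑ i ∈ Finset.univ.erase j, phi Λ x.q (t j - t i) * x.Am i - c * x.Am j
  else 2 * x.A3 j * zeta Λ (t j - t k) * x.Am k
    - 2 * x.A3 k * phi Λ (-x.q) (t j - t k) * x.Am j - c * x.Am k

lemma modBracket_q (ht : ∀ j k, j ≠ k → t j - t k ∉ Λ.lattice) {x : Phase N}
    (hq : x.q ∉ Λ.lattice) (c : ℂ) (j : Fin N) :
    modBracket Λ t j c (fun x => x.q) x = 2 * x.A3 j := by
  rw [modBracket, poisson_q, poisson_q, dp_quadHam ht hq, (totalSpin_partials x).2.1]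
  ring

lemma modBracket_p (ht : ∀ j k, j ≠ k → t j - t k ∉ Λ.lattice) {x : Phase N}
    (hq : x.q ∉ Λ.lattice) (c : ℂ) (j : Fin N) :
    modBracket Λ t j c (fun x => x.p) x = flowP Λ t x j := by
  rw [modBracket, poisson_p, poisson_p, dq_quadHam ht hq, (totalSpin_partials x).1, flowP,
    ← Finset.sum_neg_distrib, neg_zero, mul_zero, sub_zero]
  exact Finset.sum_congr rfl fun k _ => by ring

lemma modBracket_A3 (ht : ∀ j k, j ≠ k → t j - t k ∉ Λ.lattice) {x : Phase N}
    (hq : x.q ∉ Λ.lattice) (c : ℂ) (j k : Fin N) :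
    modBracket Λ t j c (fun x => x.A3 k) x = flowA3 Λ t x j k := by
  rw [modBracket, poisson_A3, poisson_A3, dPlus_quadHam ht hq, dMinus_quadHam ht hq,
    (totalSpin_partials x).2.2.1, (totalSpin_partials x).2.2.2, flowA3]
  by_cases hk : k = j
  · subst hk
    simp only [if_true, exchange, Finset.mul_sum, Finset.sum_sub_distrib]
    rw [neg_sub, mul_zero, mul_zero, sub_zero, mul_zero, sub_zero]
    congr 1 <;> exact Finset.sum_congr rfl fun i _ => by ring
  · simp only [if_neg hk, exchange]; ring

lemma modBracket_Ap (ht : ∀ j k, j ≠ k → t j - t k ∉ Λ.lattice) {x : Phase N}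
    (hq : x.q ∉ Λ.lattice) (c : ℂ) (j k : Fin N) :
    modBracket Λ t j c (fun x => x.Ap k) x = flowAp Λ t x c j k := by
  rw [modBracket, poisson_Ap, poisson_Ap, d3_quadHam ht hq, dMinus_quadHam ht hq, d3_totalSpin,
    (totalSpin_partials x).2.2.2, flowAp]
  by_cases hk : k = j
  · subst hk; simp only [if_true]; ring
  · simp only [if_neg hk]; ring

lemma modBracket_Am (ht : ∀ j k, j ≠ k → t j - t k ∉ Λ.lattice) {x : Phase N}
    (hq : x.q ∉ Λ.lattice) (c : ℂ) (j k : Fin N) :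
    modBracket Λ t j c (fun x => x.Am k) x = flowAm Λ t x c j k := by
  rw [modBracket, poisson_Am, poisson_Am, d3_quadHam ht hq, dPlus_quadHam ht hq, d3_totalSpin,
    (totalSpin_partials x).2.2.1, flowAm]
  by_cases hk : k = j
  · subst hk; simp only [if_true]; ring
  · simp only [if_neg hk]; ring

/-! ### The Lax form of the flows -/

/-- The diagonal part of the Lax equation. -/
lemma laxDiag_flow (ht : ∀ j k, j ≠ k → t j - t k ∉ Λ.lattice) {x : Phase N} (hq : x.q ∉ Λ.lattice)
    (j : Fin N) {z : ℂ} (hz : ∀ i, z - t i ∉ Λ.lattice) :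
    flowP Λ t x j + ∑ i, flowA3 Λ t x j i * zeta Λ (z - t i) =
      laxUpper Λ t x z * (phi Λ (-x.q) (z - t j) * x.Ap j)
        - phi Λ x.q (z - t j) * x.Am j * laxLower Λ t x z := by
  -- The contribution of each `i ≠ j` is an instance of the addition formula of `φ`.
  have h1 : ∀ i ∈ Finset.univ.erase j, x.Am i * phi Λ x.q (z - t i) * (phi Λ (-x.q) (z - t j) * x.Ap j)
      - phi Λ x.q (z - t j) * x.Am j * (x.Ap i * phi Λ (-x.q) (z - t i)) =
      (phiU Λ (-x.q) (t j - t i) * x.Am j * x.Ap i - phiU Λ x.q (t j - t i) * x.Ap j * x.Am i)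
        + exchange Λ t x j i * (zeta Λ (z - t i) - zeta Λ (z - t j)) := by
    intro i hi
    have hij := Finset.ne_of_mem_erase hi
    have e1 : (z - t i) - (z - t j) = t j - t i := by ring
    have e2 : (z - t j) - (z - t i) = -(t j - t i) := by ring
    have k1 := phi_mul_phi_neg Λ hq (hz i) (hz j) (by rw [e1]; exact ht j i hij.symm)
    have k2 := phi_mul_phi_neg Λ hq (hz j) (hz i) (by
      rw [e2, neg_mem_iff]; exact ht j i hij.symm)
    rw [e1] at k1
    rw [e2, ← phiU_neg_left] at k2
    have k3 := phi_neg_left Λ x.q (t j - t i)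
    rw [exchange]
    linear_combination x.Am i * x.Ap j * k1 - x.Am j * x.Ap i * k2
      - x.Am j * x.Ap i * (zeta Λ (z - t i) - zeta Λ (z - t j)) * k3
  have h2 := Finset.sum_congr rfl h1
  rw [flowP, laxUpper, laxLower, phiSum, phiSum, ← Finset.add_sum_erase _ _ (Finset.mem_univ j),
    ← Finset.add_sum_erase _ (fun i => x.Am i * phi Λ x.q (z - t i)) (Finset.mem_univ j),
    ← Finset.add_sum_erase _ (fun i => x.Ap i * phi Λ (-x.q) (z - t i)) (Finset.mem_univ j)]
  have h3 : ∑ i ∈ Finset.univ.erase j, flowA3 Λ t x j i * zeta Λ (z - t i)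
      = ∑ i ∈ Finset.univ.erase j, exchange Λ t x j i * zeta Λ (z - t i) :=
    Finset.sum_congr rfl fun i hi => by rw [flowA3, if_neg (Finset.ne_of_mem_erase hi)]
  rw [h3, flowA3, if_pos rfl]
  simp only [Finset.sum_sub_distrib, Finset.sum_add_distrib, mul_sub, ← Finset.mul_sum,
    ← Finset.sum_mul] at h2 ⊢
  linear_combination -h2

/-- The upper triangular part of the Lax equation. -/
lemma laxUpper_flow (ht : ∀ j k, j ≠ k → t j - t k ∉ Λ.lattice) {x : Phase N} (hq : x.q ∉ Λ.lattice)
    (hx : ∑ i, x.A3 i = 0) (c : ℂ) (j : Fin N) {z : ℂ} (hz : ∀ i, z - t i ∉ Λ.lattice) :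
    2 * x.A3 j * ∑ i, x.Am i * phiU Λ x.q (z - t i) + phiSum Λ t x.q (flowAm Λ t x c j) z =
      2 * laxDiag Λ t x z * (phi Λ x.q (z - t j) * x.Am j)
        - laxUpper Λ t x z * (2 * zeta Λ (z - t j) * x.A3 j + c) := by
  have h1 : ∀ i ∈ Finset.univ.erase j,
      2 * x.A3 j * (x.Am i * phiU Λ x.q (z - t i)) + flowAm Λ t x c j i * phi Λ x.q (z - t i)
        - 2 * x.A3 j * (phi Λ x.q (t j - t i) * x.Am i) * phi Λ x.q (z - t j)
        + 2 * (x.A3 i * zeta Λ (t j - t i)) * (x.Am j * phi Λ x.q (z - t j)) =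
      2 * (x.A3 i * zeta Λ (z - t i)) * (phi Λ x.q (z - t j) * x.Am j)
        - x.Am i * phi Λ x.q (z - t i) * (2 * zeta Λ (z - t j) * x.A3 j + c)
        + 2 * x.A3 i * (x.Am j * phiU Λ x.q (z - t j)) := by
    intro i hi
    have hij := Finset.ne_of_mem_erase hi
    have e1 : (z - t i) - (t j - t i) = z - t j := by ring
    have e2 : (z - t j) - (z - t i) = -(t j - t i) := by ring
    have k1 := phi_mul_phi_neg Λ hq (hz i) (ht j i hij.symm) (by rw [e1]; exact hz j)
    have k2 := phiU_add_zeta_mul_phi Λ hq (hz i) (hz j) (by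
      rw [e2, neg_mem_iff]; exact ht j i hij.symm)
    have k3 := phi_neg_left Λ x.q (-(t j - t i))
    rw [neg_neg] at k3
    rw [e1] at k1
    rw [e2, zeta_neg, k3] at k2
    rw [flowAm, if_neg hij]
    linear_combination 2 * x.A3 j * x.Am i * k2 - 2 * x.A3 i * x.Am j * k1
  have h2 := Finset.sum_congr rfl h1
  have h3 : ∑ i ∈ Finset.univ.erase j, x.A3 i = -x.A3 j := by
    rw [← Finset.add_sum_erase _ _ (Finset.mem_univ j)] at hx
    linear_combination hx
  rw [laxUpper, laxDiag, phiSum, phiSum, ← Finset.add_sum_erase _ _ (Finset.mem_univ j),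
    ← Finset.add_sum_erase _ (fun i => x.Am i * phi Λ x.q (z - t i)) (Finset.mem_univ j),
    ← Finset.add_sum_erase _ (fun i => x.A3 i * zeta Λ (z - t i)) (Finset.mem_univ j),
    ← Finset.add_sum_erase _ (fun i => flowAm Λ t x c j i * phi Λ x.q (z - t i)) (Finset.mem_univ j)]
  rw [flowAm, if_pos rfl, laxDiagConst]
  simp only [Finset.sum_sub_distrib, Finset.sum_add_distrib, ← Finset.mul_sum,
    ← Finset.sum_mul] at h2
  rw [h3] at h2
  linear_combination h2

/-- The flow preserves the symplectic leaves. -/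
lemma leaf_flow (x : Phase N) (c : ℂ) (j k : Fin N) :
    2 * x.A3 k * flowA3 Λ t x j k + flowAp Λ t x c j k * x.Am k + x.Ap k * flowAm Λ t x c j k = 0 := by
  rw [flowA3, flowAp, flowAm]
  by_cases hk : k = j
  · subst hk
    simp only [if_true, exchange, Finset.sum_sub_distrib]
    have h1 : ∑ i ∈ Finset.univ.erase k, phi Λ (-x.q) (t k - t i) * x.Am k * x.Ap i
        = x.Am k * ∑ i ∈ Finset.univ.erase k, phi Λ (-x.q) (t k - t i) * x.Ap i := by
      rw [Finset.mul_sum]; exact Finset.sum_congr rfl fun i _ => by ring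
    have h2 : ∑ i ∈ Finset.univ.erase k, phi Λ x.q (t k - t i) * x.Ap k * x.Am i
        = x.Ap k * ∑ i ∈ Finset.univ.erase k, phi Λ x.q (t k - t i) * x.Am i := by
      rw [Finset.mul_sum]; exact Finset.sum_congr rfl fun i _ => by ring
    rw [h1, h2]; ring
  · simp only [if_neg hk, exchange]; ring

/-! ### Differentiation along a curve of times -/

lemma hasDerivAt_phiSum_time (j : Fin N) {q z : ℂ → ℂ} {A : ℂ → Fin N → ℂ} {q' z' : ℂ}
    {A' : Fin N → ℂ} (hq : HasDerivAt q q' (t j)) (hz : HasDerivAt z z' (t j))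
    (hA : ∀ i, HasDerivAt (fun s => A s i) (A' i) (t j)) (hqn : q (t j) ∉ Λ.lattice)
    (hzn : ∀ i, z (t j) - t i ∉ Λ.lattice) :
    HasDerivAt (fun s => phiSum Λ (Function.update t j s) (q s) (A s) (z s))
      (q' * ∑ i, A (t j) i * phiU Λ (q (t j)) (z (t j) - t i)
        + phiSum Λ t (q (t j)) A' (z (t j))
        + z' * ∑ i, A (t j) i * phiZ Λ (q (t j)) (z (t j) - t i)
        - A (t j) j * phiZ Λ (q (t j)) (z (t j) - t j)) (t j) := by
  have h1 : ∀ i ∈ Finset.univ, HasDerivAt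
      (fun s => A s i * phi Λ (q s) (z s - Function.update t j s i))
      (A' i * phi Λ (q (t j)) (z (t j) - t i) + A (t j) i *
        (phiU Λ (q (t j)) (z (t j) - t i) * q' + phiZ Λ (q (t j)) (z (t j) - t i) *
          (z' - if i = j then 1 else 0))) (t j) := by
    intro i _
    have hu := hasDerivAt_update (a := t) j i (t j)
    have h2 := hasDerivAt_phi_comp Λ hq (hz.fun_sub hu) hqn (by
      rw [Function.update_eq_self]; exact hzn i)
    refine ((hA i).fun_mul h2).congr_deriv ?_
    simp only [Function.update_eq_self]
  refine (HasDerivAt.fun_sum h1).congr_deriv ?_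
  simp only [phiSum, mul_add, mul_sub, Finset.sum_add_distrib, Finset.sum_sub_distrib,
    Finset.mul_sum]
  simp only [mul_ite, mul_one, mul_zero, Finset.sum_ite_eq', Finset.mem_univ, if_true]
  have h3 : ∀ i, A (t j) i * (phiU Λ (q (t j)) (z (t j) - t i) * q')
      = q' * (A (t j) i * phiU Λ (q (t j)) (z (t j) - t i)) := fun i => by ring
  have h4 : ∀ i, A (t j) i * (phiZ Λ (q (t j)) (z (t j) - t i) * z')
      = z' * (A (t j) i * phiZ Λ (q (t j)) (z (t j) - t i)) := fun i => by ring
  simp only [h3, h4]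
  ring

lemma hasDerivAt_sum_zeta_time (j : Fin N) {z : ℂ → ℂ} {A : ℂ → Fin N → ℂ} {z' : ℂ}
    {A' : Fin N → ℂ} (hz : HasDerivAt z z' (t j))
    (hA : ∀ i, HasDerivAt (fun s => A s i) (A' i) (t j))
    (hzn : ∀ i, z (t j) - t i ∉ Λ.lattice) :
    HasDerivAt (fun s => ∑ i, A s i * zeta Λ (z s - Function.update t j s i))
      (∑ i, A' i * zeta Λ (z (t j) - t i) - z' * ∑ i, A (t j) i * Λ.weierstrassP (z (t j) - t i)
        + A (t j) j * Λ.weierstrassP (z (t j) - t j)) (t j) := by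
  have h1 : ∀ i ∈ Finset.univ, HasDerivAt
      (fun s => A s i * zeta Λ (z s - Function.update t j s i))
      (A' i * zeta Λ (z (t j) - t i) + A (t j) i *
        (-Λ.weierstrassP (z (t j) - t i) * (z' - if i = j then 1 else 0))) (t j) := by
    intro i _
    have hu := hasDerivAt_update (a := t) j i (t j)
    have h2 := hasDerivAt_zeta_comp (Λ := Λ) (hz.fun_sub hu) (by
      rw [Function.update_eq_self]; exact hzn i)
    refine ((hA i).fun_mul h2).congr_deriv ?_
    simp only [Function.update_eq_self]
  refine (HasDerivAt.fun_sum h1).congr_deriv ?_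
  simp only [mul_sub, Finset.sum_add_distrib, Finset.sum_sub_distrib, Finset.mul_sum]
  simp only [mul_ite, mul_one, mul_zero, Finset.sum_ite_eq', Finset.mem_univ, if_true]
  have h3 : ∀ i, A (t j) i * (-Λ.weierstrassP (z (t j) - t i) * z')
      = -(z' * (A (t j) i * Λ.weierstrassP (z (t j) - t i))) := fun i => by ring
  simp only [h3, Finset.sum_neg_distrib]
  ring

end

section

variable {N : ℕ} {Λ : PeriodPair} {t l : Fin N → ℂ}

/-! ### From the isomonodromic system to the Hamiltonian system -/

/-- A continuous solution of `f (y, g y) = 0` is differentiable where `∂f/∂z ≠ 0`. Unlike the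
implicit function theorem, this asks for no strict differentiability of `f`. -/
lemma differentiableAt_of_implicit {E : Type*} [NormedAddCommGroup E] [NormedSpace ℂ E]
    {f : E × ℂ → ℂ} {g : E → ℂ} {x : E} (hg : ContinuousAt g x)
    (hf : DifferentiableAt ℂ f (x, g x)) (hc : deriv (fun z => f (x, z)) (g x) ≠ 0)
    (h0 : ∀ᶠ y in 𝓝 x, f (y, g y) = 0) : DifferentiableAt ℂ g x := by
  -- `f(y, g y) = 0` reads `g y - g x - L (y - x) = o(|y - x| + |g y - g x|)`. Hence first
  -- `g y - g x = O(|y - x|)`, and then the error is `o(|y - x|)`.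
  set F := fderiv ℂ f (x, g x) with hF
  set c := F (0, 1) with hcdef
  have hc' : c ≠ 0 := by
    have h1 : HasFDerivAt (fun z : ℂ => (x, z)) (ContinuousLinearMap.inr ℂ E ℂ) (g x) :=
      hasFDerivAt_prodMk_right x (g x)
    have h2 := (hf.hasFDerivAt.comp (g x) h1).hasDerivAt
    have h3 := h2.deriv
    rw [show (f ∘ fun z : ℂ => (x, z)) = fun z => f (x, z) from rfl] at h3
    rw [h3] at hc
    simpa using hc
  set L : E →L[ℂ] ℂ := (-c⁻¹) • F.comp (ContinuousLinearMap.inl ℂ E ℂ) with hL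
  have hlin : ∀ v : E, ∀ u : ℂ, F (v, u) = c * (u - L v) := by
    intro v u
    have h1 : (v, u) = (v, (0 : ℂ)) + u • ((0 : E), (1 : ℂ)) := by simp
    rw [h1, map_add, map_smul]
    simp only [hL, _root_.smul_apply, ContinuousLinearMap.comp_apply,
      ContinuousLinearMap.inl_apply, smul_eq_mul, ← hcdef]
    field_simp
    ring
  have h1 : (fun y => (g y - g x) - L (y - x)) =o[𝓝 x] fun y => (y - x, g y - g x) := by
    have h2 := hf.hasFDerivAt.isLittleO.comp_tendsto
      (k := fun y => (y, g y)) (l' := 𝓝 x) (continuousAt_id.prodMk hg)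
    have h3 := (h2.neg_left.const_mul_left c⁻¹)
    refine (h3.congr' ?_ (.of_forall fun y => rfl))
    filter_upwards [h0] with y hy
    have h4 := hlin (y - x) (g y - g x)
    simp only [Function.comp_apply, hy, h0.self_of_nhds, Prod.mk_sub_mk]
    rw [← hF, h4]
    field_simp
    ring
  have h2 : (fun y => g y - g x) =O[𝓝 x] fun y => y - x := by
    refine Asymptotics.IsBigO.of_bound (1 + 2 * ‖L‖) ?_
    filter_upwards [h1.def (show (0 : ℝ) < 1 / 2 by norm_num)] with y hy
    have h3 : ‖(y - x, g y - g x)‖ ≤ ‖y - x‖ + ‖g y - g x‖ :=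
      max_le (le_add_of_nonneg_right (norm_nonneg _)) (le_add_of_nonneg_left (norm_nonneg _))
    have h4 : ‖g y - g x‖ ≤ ‖(g y - g x) - L (y - x)‖ + ‖L (y - x)‖ := by
      simpa using norm_add_le ((g y - g x) - L (y - x)) (L (y - x))
    have h5 := L.le_opNorm (y - x)
    linarith
  have h3 : (fun y => (y - x, g y - g x)) =O[𝓝 x] fun y => y - x :=
    (Asymptotics.isBigO_refl _ _).prod_left h2
  exact (HasFDerivAt.of_isLittleO (h1.trans_isBigO h3)).differentiableAt

lemma hasDerivAt_curve {U : Set (Fin N → ℂ)} (hU : IsOpen U) (ht : t ∈ U) {f : (Fin N → ℂ) → ℂ}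
    (hf : DifferentiableOn ℂ f U) (j : Fin N) :
    HasDerivAt (fun s => f (Function.update t j s)) (pderiv j f t) (t j) := by
  have h1 : DifferentiableAt ℂ f (Function.update t j (t j)) := by
    rw [Function.update_eq_self]; exact (hf t ht).differentiableAt (hU.mem_nhds ht)
  exact (h1.comp (t j) (differentiableAt_update j (t j))).hasDerivAt

lemma eventually_update_mem {U : Set (Fin N → ℂ)} (hU : IsOpen U) (ht : t ∈ U) (j : Fin N) :
    ∀ᶠ s in 𝓝 (t j), Function.update t j s ∈ U :=
  (differentiableAt_update (a := t) j (t j)).continuousAt.eventually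
    (by beta_reduce; rw [Function.update_eq_self]; exact hU.mem_nhds ht)

lemma hasDerivAt_phiSum (t : Fin N → ℂ) (u : ℂ) (A : Fin N → ℂ) {z : ℂ}
    (hz : ∀ i, z - t i ∉ Λ.lattice) :
    HasDerivAt (phiSum Λ t u A) (∑ i, A i * phiZ Λ u (z - t i)) z :=
  HasDerivAt.fun_sum fun i _ =>
    ((hasDerivAt_phi_right Λ u (hz i)).comp_sub_const z (t i)).const_mul (A i)

lemma eventually_sub_notMem {z : ℂ} (hz : ∀ i, z - t i ∉ Λ.lattice) :
    ∀ᶠ y in 𝓝 z, ∀ i, y - t i ∉ Λ.lattice :=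
  eventually_all.mpr fun i => ((continuous_id.sub continuous_const).continuousAt
    (f := fun z : ℂ => z - t i) (x := z)).eventually (Λ.isClosed_lattice.isOpen_compl.mem_nhds (hz i))

/-- The derivative of `L₁₂` at `λ_k`. -/
lemma HasSpectralCoordinates.sum_phiZ {θ μ : Fin N → ℂ} {x : Phase N} {a : ℂ}
    (h : HasSpectralCoordinates Λ θ t x l μ a) (k : Fin N) :
    ∑ i, x.Am i * phiZ Λ x.q (l k - t i) = a * ratioDeriv Λ t l k := by
  have hz : ∀ i, l k - t i ∉ Λ.lattice := fun i => h.regular.zeros_ne_times i k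
  have h1 : HasDerivAt (laxUpper Λ t x) (∑ i, x.Am i * phiZ Λ x.q (l k - t i)) (l k) :=
    hasDerivAt_phiSum t x.q x.Am hz
  have h2 := (hasDerivAt_ratio_zero h.regular k).const_mul a
  refine h1.unique (h2.congr_of_eventuallyEq ?_)
  filter_upwards [eventually_sub_notMem hz] with z hz'
  exact h.laxUpper_eq hz'

variable {θ : Fin N → ℂ} {U : Set (Fin N → ℂ)} {X : (Fin N → ℂ) → Phase N}
  {m lam mu : Fin N → (Fin N → ℂ) → ℂ}

lemma spinMatrix_leaf (x : Phase N) (j : Fin N) :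
    (1 / 2) * (spinMatrix x j ^ 2).trace = x.A3 j ^ 2 + x.Ap j * x.Am j := by
  rw [spinMatrix, pow_two, Matrix.trace_fin_two]
  simp [Matrix.mul_apply]
  ring

lemma IsSpectralDarboux.isRegular (hS : IsSpectralDarboux Λ U X lam mu)
    (hX : IsIsomonodromicSolution Λ θ U X m) (ht : t ∈ U) :
    IsRegular Λ t (fun k => lam k t) where
  times_distinct := hX.times_distinct t ht
  zeros_distinct := hS.zeros_distinct t ht
  zeros_ne_times := hS.zeros_ne_times t ht
  sum_notMem := by
    rw [hS.sum_eq t ht]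
    exact hX.q_notMem t ht

/-- The zeros of `L₁₂` determine it up to a constant `a`, which is not zero since `L₁₂` vanishes only
at the `λ_k`. -/
lemma IsSpectralDarboux.exists_hasSpectralCoordinates (hS : IsSpectralDarboux Λ U X lam mu)
    (hX : IsIsomonodromicSolution Λ θ U X m) (ht : t ∈ U) :
    ∃ a, a ≠ 0 ∧ HasSpectralCoordinates Λ θ t (X t) (fun k => lam k t) (fun k => mu k t) a := by
  have hreg := hS.isRegular hX ht
  have hq : (X t).q = charge t (fun k => lam k t) := (hS.sum_eq t ht).symm
  have hup : ∀ z, laxMatrix Λ t (X t) z 0 1 = laxUpper Λ t (X t) z := fun z => by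
    rw [laxMatrix_eq]; rfl
  obtain ⟨a, ha⟩ := exists_eq_mul_ratioRes hreg (A := (X t).Am) fun k => by
    have h1 := (hS.zeros t ht (lam k t) fun j => hS.zeros_ne_times t ht j k).mpr
      ⟨k, by rw [sub_self]; exact zero_mem _⟩
    rwa [hup, laxUpper, hq] at h1
  refine ⟨a, ?_, ⟨hreg, hq, hX.spin_constraint t ht, fun i => ?_, ha, fun k => ?_⟩⟩
  · rintro rfl
    obtain ⟨z, hz⟩ := exists_isGeneric Λ t (fun k => lam k t)
    have h1 : laxMatrix Λ t (X t) z 0 1 = 0 := by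
      rw [hup, laxUpper]
      exact Finset.sum_eq_zero fun i _ => by rw [ha, zero_mul, zero_mul]
    obtain ⟨k, hk⟩ := (hS.zeros t ht z hz.1).mp h1
    exact hz.2 k hk
  · rw [← spinMatrix_leaf]; exact hX.leaf t ht i
  · rw [hS.mu_eq t ht k, laxMatrix_eq]; rfl

lemma differentiableAt_phiSum {E : Type*} [NormedAddCommGroup E] [NormedSpace ℂ E]
    {T A : E → Fin N → ℂ} {q z : E → ℂ} {x : E} (hT : DifferentiableAt ℂ T x)
    (hA : DifferentiableAt ℂ A x) (hq : DifferentiableAt ℂ q x) (hz : DifferentiableAt ℂ z x)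
    (hqn : q x ∉ Λ.lattice) (hzn : ∀ i, z x - T x i ∉ Λ.lattice) :
    DifferentiableAt ℂ (fun x => phiSum Λ (T x) (q x) (A x) (z x)) x := by
  simp only [phiSum]
  refine DifferentiableAt.fun_sum fun i _ => ?_
  have h1 := differentiableAt_phi_comp (g := fun x => z x - T x i) hq
    (hz.fun_sub (differentiableAt_pi.mp hT i)) hqn (hzn i)
  exact (differentiableAt_pi.mp hA i).fun_mul h1

/-- The `λ_k` are continuous solutions of `L₁₂(λ_k) = 0`, and simple zeros. -/
lemma IsSpectralDarboux.differentiableAt_lam (hU : IsOpen U) (hS : IsSpectralDarboux Λ U X lam mu)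
    (hX : IsIsomonodromicSolution Λ θ U X m) (ht : t ∈ U) (k : Fin N) :
    DifferentiableAt ℂ (lam k) t := by
  obtain ⟨a, ha, h⟩ := hS.exists_hasSpectralCoordinates hX ht
  have hz : ∀ i, lam k t - t i ∉ Λ.lattice := fun i => hS.zeros_ne_times t ht i k
  have hnhds := hU.mem_nhds ht
  refine differentiableAt_of_implicit (f := fun p => laxUpper Λ p.1 (X p.1) p.2)
    ((hS.continuousOn k).continuousAt hnhds) ?_ ?_ ?_
  · have hcomp : ∀ {f : (Fin N → ℂ) → ℂ}, DifferentiableOn ℂ f U →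
        DifferentiableAt ℂ (fun p : (Fin N → ℂ) × ℂ => f p.1) (t, lam k t) := fun {f} hf =>
      DifferentiableAt.comp (g := f) (t, lam k t) ((hf t ht).differentiableAt hnhds)
        differentiableAt_fst
    exact differentiableAt_phiSum (x := (t, lam k t)) (T := fun p => p.1) (A := fun p => (X p.1).Am)
      (q := fun p => (X p.1).q) (z := fun p => p.2) differentiableAt_fst
      (differentiableAt_pi.mpr fun i => hcomp (hX.diff_Am i)) (hcomp hX.diff_q)
      differentiableAt_snd h.q_notMem hz
  · have h1 : HasDerivAt (laxUpper Λ t (X t)) _ (lam k t) :=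
      hasDerivAt_phiSum t (X t).q (X t).Am hz
    have h2 : deriv (fun z => laxUpper Λ t (X t) z) (lam k t) = _ := h1.deriv
    refine h2.trans_ne ?_
    rw [h.sum_phiZ k]
    exact mul_ne_zero ha (ratioDeriv_ne_zero h.regular k)
  · filter_upwards [hnhds] with s hs
    obtain ⟨b, -, h'⟩ := hS.exists_hasSpectralCoordinates hX hs
    exact h'.laxUpper_zero k

lemma IsSpectralDarboux.mu_eq_laxDiag (hS : IsSpectralDarboux Λ U X lam mu) (ht : t ∈ U)
    (k : Fin N) : mu k t = laxDiag Λ t (X t) (lam k t) := by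
  rw [hS.mu_eq t ht k, laxMatrix_eq]; rfl

lemma IsSpectralDarboux.differentiableAt_mu (hU : IsOpen U) (hS : IsSpectralDarboux Λ U X lam mu)
    (hX : IsIsomonodromicSolution Λ θ U X m) (ht : t ∈ U) (k : Fin N) :
    DifferentiableAt ℂ (mu k) t := by
  have hnhds := hU.mem_nhds ht
  have h1 : DifferentiableAt ℂ (fun t => laxDiag Λ t (X t) (lam k t)) t := by
    simp only [laxDiag]
    refine ((hX.diff_p t ht).differentiableAt hnhds).fun_add (DifferentiableAt.fun_sum fun i _ =>
      ((hX.diff_A3 i t ht).differentiableAt hnhds).fun_mul (differentiableAt_zeta_comp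
        ((hS.differentiableAt_lam hU hX ht k).fun_sub (differentiableAt_apply i t)) ?_))
    exact hS.zeros_ne_times t ht i k
  refine h1.congr_of_eventuallyEq ?_
  filter_upwards [hnhds] with s hs using hS.mu_eq_laxDiag hs k

/-- `∂λ_k / ∂t_j`, from `L₁₂(λ_k) = 0` and the Lax equation for `L₁₂` at `z = λ_k`. -/
lemma IsSpectralDarboux.pderiv_lam (hU : IsOpen U) (hS : IsSpectralDarboux Λ U X lam mu)
    (hX : IsIsomonodromicSolution Λ θ U X m) (ht : t ∈ U) (j k : Fin N) :
    pderiv j (lam k) t = 2 * mu k t * lagrangeRes Λ t (fun k => lam k t) j k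
      + lagrangeZRes Λ t (fun k => lam k t) j k := by
  obtain ⟨a, ha, h⟩ := hS.exists_hasSpectralCoordinates hX ht
  have hz : ∀ i, lam k t - t i ∉ Λ.lattice := fun i => hS.zeros_ne_times t ht i k
  have hlam := hasDerivAt_curve hU ht (fun t ht =>
    (hS.differentiableAt_lam hU hX ht k).differentiableWithinAt) j
  have hself : Function.update t j (t j) = t := Function.update_eq_self j t
  have h1 := hasDerivAt_phiSum_time (Λ := Λ) (t := t) j (A := fun s i => (X (Function.update t j s)).Am i)
    (hasDerivAt_curve hU ht hX.diff_q j) hlam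
    (fun i => hasDerivAt_curve hU ht (hX.diff_Am i) j) (by rw [hself]; exact h.q_notMem)
    (by rw [hself]; exact hz)
  have h2 : (fun s => phiSum Λ (Function.update t j s) (X (Function.update t j s)).q
      (fun i => (X (Function.update t j s)).Am i) (lam k (Function.update t j s)))
        =ᶠ[𝓝 (t j)] fun _ => 0 := by
    filter_upwards [eventually_update_mem hU ht j] with s hs
    obtain ⟨b, -, h'⟩ := hS.exists_hasSpectralCoordinates hX hs
    exact h'.laxUpper_zero k
  have h3 := h1.unique ((hasDerivAt_const (t j) (0 : ℂ)).congr_of_eventuallyEq h2)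
  have hd := h.regular.times_distinct
  rw [hself, h.sum_phiZ k, hX.flow_q t ht j, modBracket_q hd h.q_notMem] at h3
  have h4 : (fun i => pderiv j (fun t => (X t).Am i) t) = flowAm Λ t (X t) (2 * m j t) j := by
    ext i
    exact (hX.flow_Am t ht j i).trans (modBracket_Am hd h.q_notMem _ _ _)
  rw [h4, laxUpper_flow hd h.q_notMem h.spin_constraint _ _ hz, h.laxUpper_zero k, h.diag k,
    h.upper j] at h3
  have h5 := phi_neg_left Λ (X t).q (t j - lam k t)
  have h6 := phiZ_neg_neg Λ (X t).q (lam k t - t j)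
  rw [neg_sub] at h5 h6
  rw [lagrangeRes, lagrangeZRes, ← h.charge_eq, h5, h6]
  have h7 := ratioDeriv_ne_zero h.regular k
  have h8 : a * (pderiv j (lam k) t * ratioDeriv Λ t (fun k => lam k t) k
      + 2 * mu k t * phi Λ (X t).q (lam k t - t j) * ratioRes Λ t (fun k => lam k t) j
      - ratioRes Λ t (fun k => lam k t) j * phiZ Λ (X t).q (lam k t - t j)) = 0 := by
    linear_combination h3
  have h9 := (mul_eq_zero.mp h8).resolve_left ha
  field_simp
  linear_combination h9

/-- `∂μ_k / ∂t_j`, from `μ_k = L₁₁(λ_k)` and the Lax equation for `L₁₁` at `z = λ_k`. -/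
lemma IsSpectralDarboux.pderiv_mu (hU : IsOpen U) (hS : IsSpectralDarboux Λ U X lam mu)
    (hX : IsIsomonodromicSolution Λ θ U X m) (ht : t ∈ U) {a : ℂ}
    (h : HasSpectralCoordinates Λ θ t (X t) (fun k => lam k t) (fun k => mu k t) a)
    (j k : Fin N) :
    pderiv j (mu k) t =
      momentumVelocity Λ t (X t) (fun k => lam k t) (fun k => mu k t) a j k := by
  have hz : ∀ i, lam k t - t i ∉ Λ.lattice := fun i => hS.zeros_ne_times t ht i k
  have hlam := hasDerivAt_curve hU ht (fun t ht =>
    (hS.differentiableAt_lam hU hX ht k).differentiableWithinAt) j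
  have hself : Function.update t j (t j) = t := Function.update_eq_self j t
  have h1 := (hasDerivAt_curve hU ht hX.diff_p j).fun_add (hasDerivAt_sum_zeta_time (Λ := Λ) (t := t) j
    (A := fun s i => (X (Function.update t j s)).A3 i) hlam
    (fun i => hasDerivAt_curve hU ht (hX.diff_A3 i) j) (by rw [hself]; exact hz))
  have h2 : (fun s => mu k (Function.update t j s)) =ᶠ[𝓝 (t j)] fun s =>
      (X (Function.update t j s)).p + ∑ i, (X (Function.update t j s)).A3 i
        * zeta Λ (lam k (Function.update t j s) - Function.update t j s i) := by
    filter_upwards [eventually_update_mem hU ht j] with s hs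
    exact hS.mu_eq_laxDiag hs k
  have h3 : pderiv j (mu k) t = _ := h2.deriv_eq.trans h1.deriv
  have hd := h.regular.times_distinct
  have h4 : ∀ i, pderiv j (fun t => (X t).A3 i) t = flowA3 Λ t (X t) j i := fun i =>
    (hX.flow_A3 t ht j i).trans (modBracket_A3 hd h.q_notMem _ _ _)
  have h5 := laxDiag_flow hd h.q_notMem j hz
  rw [h3, hself, hX.flow_p t ht j, modBracket_p hd h.q_notMem, hS.pderiv_lam hU hX ht,
    momentumVelocity, laxDiagDeriv, lagrangeRes]
  simp only [h4]
  have h6 := phi_neg_left Λ (X t).q (t j - lam k t)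
  have h7 : Λ.weierstrassP (t j - lam k t) = Λ.weierstrassP (lam k t - t j) := by
    rw [← Λ.weierstrassP_neg, neg_sub]
  rw [neg_sub] at h6
  have h8 : laxUpper Λ t (X t) (lam k t) = 0 := h.laxUpper_zero k
  have h9 := ratioDeriv_ne_zero h.regular k
  rw [h8, h.upper j] at h5
  rw [← h.charge_eq, h6, h7]
  set D := ratioDeriv Λ t (fun k => lam k t) k
  have h10 : D * D⁻¹ = 1 := mul_inv_cancel₀ h9
  linear_combination h5 + a * laxLower Λ t (X t) (lam k t) * phi Λ (X t).q (lam k t - t j)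
    * ratioRes Λ t (fun k => lam k t) j * h10

lemma IsSpectralDarboux.isHamiltonianSolution (hU : IsOpen U) (hS : IsSpectralDarboux Λ U X lam mu)
    (hX : IsIsomonodromicSolution Λ θ U X m) : IsHamiltonianSolution Λ θ U lam mu where
  regular t ht := hS.isRegular hX ht
  diff_lam k t ht := (hS.differentiableAt_lam hU hX ht k).differentiableWithinAt
  diff_mu k t ht := (hS.differentiableAt_mu hU hX ht k).differentiableWithinAt
  eq_lam t ht j k := by
    rw [hS.pderiv_lam hU hX ht, pderiv_specHam_momentum (hS.isRegular hX ht)]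
  eq_mu t ht j k := by
    obtain ⟨a, -, h⟩ := hS.exists_hasSpectralCoordinates hX ht
    rw [hS.pderiv_mu hU hX ht h, h.neg_pderiv_specHam_position]

lemma IsSpectralDarboux.specHam_eq (hS : IsSpectralDarboux Λ U X lam mu)
    (hX : IsIsomonodromicSolution Λ θ U X m) (ht : t ∈ U) (j : Fin N) :
    specHam Λ θ j (fun k => lam k t) (fun k => mu k t) t =
      quadHam Λ t j (X t) + (X t).p
        - (X t).A3 j * (∑ k, zeta Λ (t j - lam k t) - ∑ k ∈ Finset.univ.erase j, zeta Λ (t j - t k))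
        + ∑ k ∈ Finset.univ.erase j, zeta Λ (t j - t k) * (X t).A3 k := by
  obtain ⟨a, -, h⟩ := hS.exists_hasSpectralCoordinates hX ht
  rw [h.specHam_eq, laxDiagConst, logRatioPole]
  simp only [mul_comm ((X t).A3 _) (zeta Λ _)]
  ring

/-! ### Uniqueness up to diagonal gauge transformations -/

/-- `q` is the sum of the `λ_k - t_k`, `L₁₁` is determined by its values at the `λ_k`, `L₁₂` by its
zeros up to a factor, and then the `A_j⁺` by `(A_j³)² + A_j⁺ A_j⁻ = C_j`. -/
lemma IsSpectralDarboux.gauge_unique {Y : (Fin N → ℂ) → Phase N} {n : Fin N → (Fin N → ℂ) → ℂ}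
    (hX : IsIsomonodromicSolution Λ θ U X m) (hY : IsIsomonodromicSolution Λ θ U Y n)
    (hSX : IsSpectralDarboux Λ U X lam mu) (hSY : IsSpectralDarboux Λ U Y lam mu) (ht : t ∈ U) :
    (Y t).q = (X t).q ∧ (Y t).p = (X t).p ∧ (Y t).A3 = (X t).A3 ∧
      ∃ g : ℂ, g ≠ 0 ∧ ∀ j, (Y t).Am j = g * (X t).Am j ∧ (Y t).Ap j = g⁻¹ * (X t).Ap j := by
  obtain ⟨a, ha, h⟩ := hSX.exists_hasSpectralCoordinates hX ht
  obtain ⟨b, hb, h'⟩ := hSY.exists_hasSpectralCoordinates hY ht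
  have h1 := eq_of_values_eq h.regular (x := (Y t).A3) (y := (X t).A3) (x₀ := (Y t).p)
    (y₀ := (X t).p) (by rw [h.spin_constraint, h'.spin_constraint]) fun k => by
      have h2 := h.diag k
      have h3 := h'.diag k
      rw [laxDiag] at h2 h3
      linear_combination h3 - h2
  refine ⟨by rw [h.charge_eq, h'.charge_eq], h1.2, funext h1.1, b / a, div_ne_zero hb ha,
    fun j => ⟨?_, ?_⟩⟩
  · rw [h.upper, h'.upper]; field_simp
  · have h2 := h.leaf j
    have h3 := h'.leaf j
    rw [h.upper] at h2
    rw [h'.upper, h1.1 j] at h3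
    have h4 := ratioRes_ne_zero h.regular j
    rw [inv_div]
    refine mul_right_cancel₀ (mul_ne_zero hb h4) ?_
    have h5 : a / b * (X t).Ap j * (b * ratioRes Λ t (fun k => lam k t) j)
        = (X t).Ap j * (a * ratioRes Λ t (fun k => lam k t) j) := by field_simp
    rw [h5]
    linear_combination h3 - h2

end

section

variable {N : ℕ} {Λ : PeriodPair} {t l : Fin N → ℂ}

/-! ### Compatibility of the flows -/

lemma pderiv_eq_fderiv {f : (Fin N → ℂ) → ℂ} (hf : DifferentiableAt ℂ f t) (j : Fin N) :
    pderiv j f t = fderiv ℂ f t (Pi.single j 1) := by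
  have h1 : HasFDerivAt f (fderiv ℂ f t) (Function.update t j (t j)) := by
    rw [Function.update_eq_self]; exact hf.hasFDerivAt
  exact (h1.comp_hasDerivAt (t j) (_root_.hasDerivAt_update t j (t j))).deriv

lemma fderiv_apply_eq_sum {f : (Fin N → ℂ) → ℂ} (hf : DifferentiableAt ℂ f t) (v : Fin N → ℂ) :
    fderiv ℂ f t v = ∑ j, v j * pderiv j f t := by
  have h1 := LinearMap.pi_apply_eq_sum_univ (fderiv ℂ f t : (Fin N → ℂ) →ₗ[ℂ] ℂ) v
  rw [ContinuousLinearMap.coe_coe] at h1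
  rw [h1]
  refine Finset.sum_congr rfl fun j _ => ?_
  rw [pderiv_eq_fderiv hf, smul_eq_mul]
  congr 2
  ext i
  simp [Pi.single_apply, eq_comm]

/-- Mixed partial derivatives commute, for functions whose partial derivatives are explicitly
holomorphic. -/
lemma pderiv_comm {U : Set (Fin N → ℂ)} (hU : IsOpen U) (ht : t ∈ U) {f : (Fin N → ℂ) → ℂ}
    {g : Fin N → (Fin N → ℂ) → ℂ} (hf : DifferentiableOn ℂ f U)
    (hfg : ∀ t ∈ U, ∀ j, pderiv j f t = g j t) (hg : ∀ j, DifferentiableAt ℂ (g j) t)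
    (j k : Fin N) : pderiv j (g k) t = pderiv k (g j) t := by
  set f' : (Fin N → ℂ) → ((Fin N → ℂ) →L[ℂ] ℂ) := fun y =>
    ∑ i, g i y • (ContinuousLinearMap.proj i : (Fin N → ℂ) →L[ℂ] ℂ) with hf'
  have h1 : ∀ᶠ y in 𝓝 t, HasFDerivAt f (f' y) y := by
    filter_upwards [hU.mem_nhds ht] with y hy
    have h2 := (hf y hy).differentiableAt (hU.mem_nhds hy)
    have h3 : fderiv ℂ f y = f' y := by
      ext v
      rw [fderiv_apply_eq_sum h2]
      simp only [hf', _root_.sum_apply, _root_.smul_apply,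
        ContinuousLinearMap.proj_apply, smul_eq_mul]
      exact Finset.sum_congr rfl fun i _ => by rw [hfg y hy, mul_comm]
    exact h3 ▸ h2.hasFDerivAt
  have h2 : HasFDerivAt f' (∑ i, (fderiv ℂ (g i) t).smulRight
      (ContinuousLinearMap.proj i : (Fin N → ℂ) →L[ℂ] ℂ)) t :=
    HasFDerivAt.fun_sum fun i _ => (hg i).hasFDerivAt.smul_const
      (ContinuousLinearMap.proj i : (Fin N → ℂ) →L[ℂ] ℂ)
  have h3 := second_derivative_symmetric_of_eventually h1 h2 (Pi.single j 1) (Pi.single k 1)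
  rw [pderiv_eq_fderiv (hg k), pderiv_eq_fderiv (hg j)]
  simpa [_root_.sum_apply, Pi.single_apply] using h3

/-- The derivative of the three-term relation `phiU_add_zeta_mul_phi` under simultaneous
translation of `x` and `y`. -/
lemma phiUZ_add_zeta_mul_phiZ {u x y : ℂ} (hu : u ∉ Λ.lattice) (hx : x ∉ Λ.lattice)
    (hy : y ∉ Λ.lattice) (hyx : y - x ∉ Λ.lattice) :
    phiUZ Λ u x + (zeta Λ y - zeta Λ (y - x)) * phiZ Λ u x - Λ.weierstrassP y * phi Λ u x
      + phiZ Λ u y * phi Λ (-u) (y - x) = 0 := by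
  set F : ℂ → ℂ := fun s => phiU Λ u s + (zeta Λ (s + (y - x)) - zeta Λ (y - x)) * phi Λ u s
    + phi Λ u (s + (y - x)) * phi Λ (-u) (y - x) with hF
  have e : x + (y - x) = y := by ring
  have h0 : F =ᶠ[𝓝 x] fun _ => 0 := by
    have h1 : ∀ᶠ s in 𝓝 x, s + (y - x) ∉ Λ.lattice :=
      ((continuous_id.add continuous_const).continuousAt (f := fun s : ℂ => s + (y - x))
        (x := x)).eventually (Λ.isClosed_lattice.isOpen_compl.mem_nhds (by simpa [e] using hy))
    filter_upwards [h1, Λ.isClosed_lattice.isOpen_compl.mem_nhds hx] with s h2 h3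
    have h4 := phiU_add_zeta_mul_phi Λ hu h3 h2 (by rwa [add_sub_cancel_left])
    rwa [add_sub_cancel_left] at h4
  have h1 : HasDerivAt (fun s => zeta Λ (s + (y - x))) (-Λ.weierstrassP y) x := by
    have h2 := hasDerivAt_zeta Λ hy
    rw [← e] at h2
    have h3 := h2.comp_add_const x (y - x)
    rwa [e] at h3
  have h2 : HasDerivAt (fun s => phi Λ u (s + (y - x))) (phiZ Λ u y) x := by
    have h2 := hasDerivAt_phi_right Λ u hy
    rw [← e] at h2
    have h3 := h2.comp_add_const x (y - x)
    rwa [e] at h3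
  have h3 := ((hasDerivAt_phiU_right Λ hu hx).fun_add ((h1.sub_const (zeta Λ (y - x))).fun_mul
    (hasDerivAt_phi_right Λ u hx))).fun_add (h2.mul_const (phi Λ (-u) (y - x)))
  have h4 := h3.unique ((hasDerivAt_const x (0 : ℂ)).congr_of_eventuallyEq h0)
  rw [e] at h4
  linear_combination h4

/-- The differential equations of the isomonodromic system for `q`, `p`, `A_k³`, `A_k⁻`, with the
brackets evaluated. -/
structure SatisfiesFlows (Λ : PeriodPair) (U : Set (Fin N → ℂ)) (X : (Fin N → ℂ) → Phase N)
    (m : Fin N → (Fin N → ℂ) → ℂ) : Prop where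
  times_distinct : ∀ t ∈ U, ∀ j k, j ≠ k → t j - t k ∉ Λ.lattice
  q_notMem : ∀ t ∈ U, (X t).q ∉ Λ.lattice
  diff_q : DifferentiableOn ℂ (fun t => (X t).q) U
  diff_p : DifferentiableOn ℂ (fun t => (X t).p) U
  diff_A3 : ∀ k, DifferentiableOn ℂ (fun t => (X t).A3 k) U
  diff_Am : ∀ k, DifferentiableOn ℂ (fun t => (X t).Am k) U
  diff_m : ∀ k, DifferentiableOn ℂ (m k) U
  spin_constraint : ∀ t ∈ U, ∑ k, (X t).A3 k = 0
  flow_q : ∀ t ∈ U, ∀ j, pderiv j (fun t => (X t).q) t = 2 * (X t).A3 j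
  flow_p : ∀ t ∈ U, ∀ j, pderiv j (fun t => (X t).p) t = flowP Λ t (X t) j
  flow_A3 : ∀ t ∈ U, ∀ j k, pderiv j (fun t => (X t).A3 k) t = flowA3 Λ t (X t) j k
  flow_Am : ∀ t ∈ U, ∀ j k, pderiv j (fun t => (X t).Am k) t = flowAm Λ t (X t) (2 * m j t) j k

/-- The velocity `∂L₁₂(z) / ∂t_j` at fixed `z`. -/
def laxUpperVelocity (Λ : PeriodPair) (t : Fin N → ℂ) (x : Phase N) (c z : ℂ) (j : Fin N) : ℂ :=
  2 * laxDiag Λ t x z * (phi Λ x.q (z - t j) * x.Am j)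
    - 2 * laxUpper Λ t x z * (zeta Λ (z - t j) * x.A3 j + c) - phiZ Λ x.q (z - t j) * x.Am j

variable {U : Set (Fin N → ℂ)} {X : (Fin N → ℂ) → Phase N} {m : Fin N → (Fin N → ℂ) → ℂ}

lemma SatisfiesFlows.hasDerivAt_laxUpper (h : SatisfiesFlows Λ U X m) (hU : IsOpen U) (ht : t ∈ U)
    {z : ℂ} (hz : ∀ i, z - t i ∉ Λ.lattice) (j : Fin N) :
    HasDerivAt (fun s => laxUpper Λ (Function.update t j s) (X (Function.update t j s)) z)
      (laxUpperVelocity Λ t (X t) (m j t) z j) (t j) := by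
  have hself : Function.update t j (t j) = t := Function.update_eq_self j t
  have h1 := hasDerivAt_phiSum_time (Λ := Λ) (t := t) j (z := fun _ => z)
    (A := fun s i => (X (Function.update t j s)).Am i)
    (hasDerivAt_curve hU ht h.diff_q j) (hasDerivAt_const _ z)
    (fun i => hasDerivAt_curve hU ht (h.diff_Am i) j) (by rw [hself]; exact h.q_notMem t ht) hz
  refine h1.congr_deriv ?_
  have h4 : (fun i => pderiv j (fun t => (X t).Am i) t) = flowAm Λ t (X t) (2 * m j t) j :=
    funext fun i => h.flow_Am t ht j i
  have h5 := laxUpper_flow (h.times_distinct t ht) (h.q_notMem t ht) (h.spin_constraint t ht)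
    (2 * m j t) j hz
  rw [hself, h.flow_q t ht j, h4, h5, laxUpperVelocity]
  ring

lemma SatisfiesFlows.hasDerivAt_laxDiag (h : SatisfiesFlows Λ U X m) (hU : IsOpen U) (ht : t ∈ U)
    {z : ℂ} (hz : ∀ i, z - t i ∉ Λ.lattice) (j : Fin N) :
    HasDerivAt (fun s => laxDiag Λ (Function.update t j s) (X (Function.update t j s)) z)
      (laxUpper Λ t (X t) z * (phi Λ (-(X t).q) (z - t j) * (X t).Ap j)
        - phi Λ (X t).q (z - t j) * (X t).Am j * laxLower Λ t (X t) z
        + (X t).A3 j * Λ.weierstrassP (z - t j)) (t j) := by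
  have hself : Function.update t j (t j) = t := Function.update_eq_self j t
  have h1 := (hasDerivAt_curve hU ht h.diff_p j).fun_add (hasDerivAt_sum_zeta_time (Λ := Λ) (t := t) j
    (A := fun s i => (X (Function.update t j s)).A3 i) (hasDerivAt_const _ z)
    (fun i => hasDerivAt_curve hU ht (h.diff_A3 i) j) hz)
  refine h1.congr_deriv ?_
  have h5 := laxDiag_flow (h.times_distinct t ht) (h.q_notMem t ht) j hz
  rw [hself, h.flow_p t ht j, ← h5]
  simp only [h.flow_A3 t ht]
  ring

/-- The zero curvature equation for the multipliers follows from the other equations where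
`L₁₂` does not vanish identically: it expresses the equality of the mixed derivatives of
`L₁₂(z)`. -/
theorem SatisfiesFlows.zero_curvature (h : SatisfiesFlows Λ U X m) (hU : IsOpen U) (ht : t ∈ U)
    {z : ℂ} (hz : ∀ i, z - t i ∉ Λ.lattice) (hne : laxUpper Λ t (X t) z ≠ 0) {j k : Fin N}
    (hjk : j ≠ k) :
    pderiv j (m k) t - pderiv k (m j) t
      + phiU Λ (X t).q (t j - t k) * (X t).Ap j * (X t).Am k
      - phiU Λ (X t).q (t k - t j) * (X t).Am j * (X t).Ap k = 0 := by
  set V : Set (Fin N → ℂ) := U ∩ {t | ∀ i, z - t i ∉ Λ.lattice} with hV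
  have hVo : IsOpen V := by
    refine hU.inter ?_
    have : {t : Fin N → ℂ | ∀ i, z - t i ∉ Λ.lattice} = ⋂ i, {t | z - t i ∉ Λ.lattice} := by
      ext; simp
    rw [this]
    exact isOpen_iInter_of_finite fun i => isOpen_notMem Λ (by fun_prop)
  have htV : t ∈ V := ⟨ht, hz⟩
  have hq := h.q_notMem t ht
  have hat : ∀ {f : (Fin N → ℂ) → ℂ}, DifferentiableOn ℂ f U → ∀ s ∈ U, DifferentiableAt ℂ f s :=
    fun hf s hs => (hf s hs).differentiableAt (hU.mem_nhds hs)
  have hsub : ∀ (i : Fin N) (s : Fin N → ℂ), DifferentiableAt ℂ (fun s : Fin N → ℂ => z - s i) s :=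
    fun i s => (differentiableAt_const z).fun_sub (differentiableAt_apply i s)
  have hfd : ∀ s ∈ V, DifferentiableAt ℂ (fun s => laxUpper Λ s (X s) z) s := fun s hs =>
    differentiableAt_phiSum (T := fun s => s) (A := fun s => (X s).Am) (q := fun s => (X s).q)
      (z := fun _ => z) differentiableAt_id
      (differentiableAt_pi.mpr fun i => hat (h.diff_Am i) s hs.1) (hat h.diff_q s hs.1)
      (differentiableAt_const z) (h.q_notMem s hs.1) hs.2
  have hPd : DifferentiableAt ℂ (fun s => laxDiag Λ s (X s) z) t := by
    simp only [laxDiag]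
    exact (hat h.diff_p t ht).fun_add (DifferentiableAt.fun_sum fun i _ =>
      (hat (h.diff_A3 i) t ht).fun_mul (differentiableAt_zeta_comp (hsub i t) (hz i)))
  have hgd : ∀ i, DifferentiableAt ℂ (fun s => laxUpperVelocity Λ s (X s) (m i s) z i) t := by
    intro i
    simp only [laxUpperVelocity]
    have hAm := hat (h.diff_Am i) t ht
    have h1 := differentiableAt_phi_comp (Λ := Λ) (hat h.diff_q t ht) (hsub i t) hq (hz i)
    have h2 := differentiableAt_phiZ_comp (Λ := Λ) (hat h.diff_q t ht) (hsub i t) hq (hz i)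
    have h3 := differentiableAt_zeta_comp (Λ := Λ) (hsub i t) (hz i)
    exact (((hPd.const_mul 2).fun_mul (h1.fun_mul hAm)).fun_sub (((hfd t htV).const_mul 2).fun_mul
      ((h3.fun_mul (hat (h.diff_A3 i) t ht)).fun_add (hat (h.diff_m i) t ht)))).fun_sub
      (h2.fun_mul hAm)
  have hcomm := pderiv_comm hVo htV (f := fun s => laxUpper Λ s (X s) z)
    (g := fun i s => laxUpperVelocity Λ s (X s) (m i s) z i)
    (fun s hs => (hfd s hs).differentiableWithinAt)
    (fun s hs i => (h.hasDerivAt_laxUpper hU hs.1 hs.2 i).deriv) hgd j k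
  -- The derivative of `laxUpperVelocity` in another time, by the product rule and the flows.
  have hder : ∀ j k : Fin N, j ≠ k →
      pderiv k (fun s => laxUpperVelocity Λ s (X s) (m j s) z j) t =
      2 * (laxUpper Λ t (X t) z * (phi Λ (-(X t).q) (z - t k) * (X t).Ap k)
        - phi Λ (X t).q (z - t k) * (X t).Am k * laxLower Λ t (X t) z
        + (X t).A3 k * Λ.weierstrassP (z - t k)) * (phi Λ (X t).q (z - t j) * (X t).Am j)
      + 2 * laxDiag Λ t (X t) z * (phiU Λ (X t).q (z - t j) * (2 * (X t).A3 k) * (X t).Am j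
        + phi Λ (X t).q (z - t j) * flowAm Λ t (X t) (2 * m k t) k j)
      - 2 * laxUpperVelocity Λ t (X t) (m k t) z k * (zeta Λ (z - t j) * (X t).A3 j + m j t)
      - 2 * laxUpper Λ t (X t) z * (zeta Λ (z - t j) * flowA3 Λ t (X t) k j + pderiv k (m j) t)
      - (phiUZ Λ (X t).q (z - t j) * (2 * (X t).A3 k) * (X t).Am j
        + phiZ Λ (X t).q (z - t j) * flowAm Λ t (X t) (2 * m k t) k j) := by
    intro j k hjk
    have hself : Function.update t k (t k) = t := Function.update_eq_self k t
    have hP := h.hasDerivAt_laxDiag hU ht hz k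
    have hf := h.hasDerivAt_laxUpper hU ht hz k
    have hm := hasDerivAt_curve hU ht (h.diff_m j) k
    have hA3 := hasDerivAt_curve hU ht (h.diff_A3 j) k
    have hAm := hasDerivAt_curve hU ht (h.diff_Am j) k
    have hqc := hasDerivAt_curve hU ht h.diff_q k
    rw [h.flow_q t ht] at hqc
    rw [h.flow_A3 t ht] at hA3
    rw [h.flow_Am t ht] at hAm
    have hphi : HasDerivAt (fun s => phi Λ (X (Function.update t k s)).q (z - t j))
        (phiU Λ (X t).q (z - t j) * (2 * (X t).A3 k)) (t k) := by
      have h1 := hasDerivAt_phiU Λ hq (z - t j)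
      rw [← hself] at h1
      have h2 := HasDerivAt.comp (t k) h1 hqc
      rwa [hself] at h2
    have hphiZ : HasDerivAt (fun s => phiZ Λ (X (Function.update t k s)).q (z - t j))
        (phiUZ Λ (X t).q (z - t j) * (2 * (X t).A3 k)) (t k) := by
      have h1 := hasDerivAt_phiZ_left Λ hq (hz j)
      rw [← hself] at h1
      have h2 := HasDerivAt.comp (t k) h1 hqc
      rwa [hself] at h2
    have htj : ∀ s, Function.update t k s j = t j := fun s => by simp [hjk]
    have h1 := ((((hP.const_mul 2).fun_mul (hphi.fun_mul hAm))).fun_sub ((hf.const_mul 2).fun_mul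
      ((hA3.const_mul (zeta Λ (z - t j))).fun_add hm))).fun_sub (hphiZ.fun_mul hAm)
    rw [pderiv]
    simp only [laxUpperVelocity, htj] at h1 ⊢
    rw [h1.deriv]
    simp only [hself]
    ring
  beta_reduce at hcomm
  rw [hder k j hjk.symm, hder j k hjk] at hcomm
  have e1 : (z - t k) - (z - t j) = t j - t k := by ring
  have e2 : (z - t j) - (z - t k) = t k - t j := by ring
  have hd1 := h.times_distinct t ht j k hjk
  have hd2 := h.times_distinct t ht k j hjk.symm
  have k1 := phiU_add_zeta_mul_phi Λ hq (hz j) (hz k) (by rw [e1]; exact hd1)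
  have k2 := phiU_add_zeta_mul_phi Λ hq (hz k) (hz j) (by rw [e2]; exact hd2)
  have k3 := phiUZ_add_zeta_mul_phiZ hq (hz j) (hz k) (by rw [e1]; exact hd1)
  have k4 := phiUZ_add_zeta_mul_phiZ hq (hz k) (hz j) (by rw [e2]; exact hd2)
  have k5 := phi_mul_phi_neg Λ hq (hz j) (hz k) (by rw [e2]; exact hd2)
  have k6 := phi_mul_phi_neg Λ hq (hz k) (hz j) (by rw [e1]; exact hd1)
  rw [e1] at k1 k3 k6
  rw [e2] at k2 k4 k5
  have k7 := phi_neg_left Λ (X t).q (t j - t k)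
  have k8 := phi_neg_left Λ (X t).q (t k - t j)
  rw [neg_sub] at k7 k8
  have k9 : zeta Λ (t k - t j) = -zeta Λ (t j - t k) := by rw [← zeta_neg, neg_sub]
  simp only [laxUpperVelocity, flowAm, flowA3, exchange, if_neg hjk, if_neg hjk.symm] at hcomm
  rw [k7] at k1 k3 hcomm
  rw [k8] at k2 k4 hcomm
  rw [k9] at k2 k4 hcomm
  -- The difference of the mixed derivatives is `2 L₁₂(z)` times the zero curvature expression, by
  -- the addition formulas `k1`, …, `k6`.
  refine (mul_eq_zero.mp ?_).resolve_left (mul_ne_zero two_ne_zero hne)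
  linear_combination -hcomm - 2 * laxDiag Λ t (X t) z * (2 * (X t).A3 k * (X t).Am j * k1
    - 2 * (X t).A3 j * (X t).Am k * k2) + (2 * (X t).A3 k * (X t).Am j * k3
    - 2 * (X t).A3 j * (X t).Am k * k4) - 2 * laxUpper Λ t (X t) z
    * ((X t).Ap k * (X t).Am j * k5 - (X t).Ap j * (X t).Am k * k6)

end

section

variable {N : ℕ} {Λ : PeriodPair} {t l : Fin N → ℂ}

/-! ### Reconstruction of the isomonodromic system -/

lemma sum_time_lagrangeRes (h : IsRegular Λ t l) (m : Fin N) : ∑ i, lagrangeRes Λ t l i m = 0 := by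
  simpa using ((hasPoles_lagrange h m).expand h).1

lemma sum_time_lagrangeZRes (h : IsRegular Λ t l) (m : Fin N) :
    ∑ i, lagrangeZRes Λ t l i m = 1 := by
  have h1 := ((hasPoles_lagrangeZ h m).expand h).1
  simp only [Finset.sum_ite_eq', Finset.mem_univ, if_true] at h1
  linear_combination h1

/-- The sum of the `lagrangeZ m` has the same poles and constant terms at the `λ_k` as the
logarithmic derivative of `P / Q`, hence the same residues at the `t_i`. -/
lemma sum_zero_lagrangeZRes (h : IsRegular Λ t l) (i : Fin N) :
    ∑ m, lagrangeZRes Λ t l i m = 1 := by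
  have h1 := (HasPoles.sum Finset.univ fun m _ => hasPoles_lagrangeZ h m).congr_val (s' := 0)
    (r' := fun i => ∑ m, lagrangeZRes Λ t l i m) (ρ' := fun _ => -1)
    (γ' := fun k => -logRatioZero Λ t l k) (by simp) (fun i => rfl) (fun k => by simp)
    (fun k => by simp)
  obtain ⟨h2, b, -, h3⟩ := h1.expand h
  refine (eq_of_values_eq h (x := fun i => ∑ m, lagrangeZRes Λ t l i m) (y := fun _ => 1) (x₀ := b)
    (y₀ := 0) ?_ fun k => ?_).1 i
  · simp only [Finset.sum_neg_distrib] at h2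
    linear_combination h2
  · have h4 := h3 k
    simp only [logRatioZero, neg_mul, one_mul, Finset.sum_neg_distrib] at h4 ⊢
    linear_combination -h4

/-- The point of the phase space with spectral coordinates `l`, `μ` and `L₁₂ = Q / P`. The momentum
`p` is written as the mean over `k` of the expressions `μ_k - ∑ A_i³ ζ(λ_k - t_i)`, which are all
equal. -/
def spectralPhase (Λ : PeriodPair) (θ t l μ : Fin N → ℂ) : Phase N where
  q := charge t l
  p := (N : ℂ)⁻¹ * ∑ k, (μ k - ∑ i, (∑ m, μ m * lagrangeRes Λ t l i m) * zeta Λ (l k - t i))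
  A3 i := ∑ m, μ m * lagrangeRes Λ t l i m
  Ap i := (θ i ^ 2 / 4 - (∑ m, μ m * lagrangeRes Λ t l i m) ^ 2) / ratioRes Λ t l i
  Am i := ratioRes Λ t l i

lemma hasSpectralCoordinates_spectralPhase (h : IsRegular Λ t l) (θ μ : Fin N → ℂ) :
    HasSpectralCoordinates Λ θ t (spectralPhase Λ θ t l μ) l μ 1 := by
  have h1 := (HasPoles.sum Finset.univ fun m _ => (hasPoles_lagrange h m).const_mul (μ m)).congr_val
    (s' := 0) (r' := fun i => ∑ m, μ m * lagrangeRes Λ t l i m) (ρ' := fun _ => 0) (γ' := μ)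
    (by simp) (fun i => rfl) (fun k => by simp) (fun k => by simp)
  obtain ⟨h2, b, -, h3⟩ := h1.expand h
  simp only [zero_mul, Finset.sum_const_zero, add_zero] at h2 h3
  refine ⟨h, rfl, h2, fun i => ?_, fun i => (one_mul _).symm, fun k => ?_⟩
  · have := ratioRes_ne_zero h i
    simp only [spectralPhase]
    field_simp
    ring
  · have h4 : (spectralPhase Λ θ t l μ).p = b := by
      have h5 : ∀ k, μ k - ∑ i, (∑ m, μ m * lagrangeRes Λ t l i m) * zeta Λ (l k - t i) = b :=
        fun k => by linear_combination h3 k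
      have hN : (N : ℂ) ≠ 0 := Nat.cast_ne_zero.mpr fun h0 => by
        subst h0; exact Fin.elim0 k
      simp only [spectralPhase, h5, Finset.sum_const, Finset.card_univ, Fintype.card_fin, nsmul_eq_mul]
      field_simp
    rw [laxDiag, h4]
    simp only [spectralPhase]
    linear_combination -(h3 k)

/-- The velocity `∂λ_k / ∂t_j`. -/
def positionVelocity (Λ : PeriodPair) (t l μ : Fin N → ℂ) (j k : Fin N) : ℂ :=
  2 * μ k * lagrangeRes Λ t l j k + lagrangeZRes Λ t l j k

/-- The multiplier determined by the evolution of `A_j⁻ = Q(t_j) / P'(t_j)`. -/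
def spectralMultiplier (Λ : PeriodPair) (θ t l μ : Fin N → ℂ) (j : Fin N) : ℂ :=
  laxDiagConst Λ t (spectralPhase Λ θ t l μ) j
    - (spectralPhase Λ θ t l μ).A3 j * (∑ i ∈ Finset.univ.erase j,
      phi Λ (charge t l) (t j - t i) * ratioRes Λ t l i) / ratioRes Λ t l j
    - 1 / 2 * (∑ k, zeta Λ (t j - l k) * (1 - positionVelocity Λ t l μ j k)
      - ∑ k ∈ Finset.univ.erase j, zeta Λ (t j - t k))

lemma hasDerivAt_prod_sigma {ι : Type*} [DecidableEq ι] (S : Finset ι) {f : ι → ℂ → ℂ} {f' : ι → ℂ}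
    {s : ℂ} (hf : ∀ i ∈ S, HasDerivAt (f i) (f' i) s) (hs : ∀ i ∈ S, f i s ∉ Λ.lattice) :
    HasDerivAt (fun s => ∏ i ∈ S, sigma Λ (f i s))
      ((∏ i ∈ S, sigma Λ (f i s)) * ∑ i ∈ S, zeta Λ (f i s) * f' i) s := by
  induction S using Finset.induction_on with
  | empty => simpa using hasDerivAt_const s (1 : ℂ)
  | insert a S ha ih =>
    simp only [Finset.prod_insert ha, Finset.sum_insert ha]
    have h1 : HasDerivAt (fun s => sigma Λ (f a s)) (deriv (sigma Λ) (f a s) * f' a) s :=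
      (hasDerivAt_sigma Λ (f a s)).comp s (hf a (Finset.mem_insert_self a S))
    have h2 := ih (fun i hi => hf i (Finset.mem_insert_of_mem hi))
      fun i hi => hs i (Finset.mem_insert_of_mem hi)
    refine (h1.fun_mul h2).congr_deriv ?_
    rw [deriv_sigma_eq Λ (hs a (Finset.mem_insert_self a S))]
    ring

/-- The derivative of `Q(t_i) / P'(t_i)` along a curve. -/
lemma hasDerivAt_ratioRes {T L : ℂ → Fin N → ℂ} {T' L' : Fin N → ℂ} {s : ℂ}
    (hT : ∀ i, HasDerivAt (fun s => T s i) (T' i) s) (hL : ∀ k, HasDerivAt (fun s => L s k) (L' k) s)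
    (h : IsRegular Λ (T s) (L s)) (i : Fin N) :
    HasDerivAt (fun s => ratioRes Λ (T s) (L s) i) (ratioRes Λ (T s) (L s) i *
      (∑ k, zeta Λ (T s i - L s k) * (T' i - L' k)
        - ∑ k ∈ Finset.univ.erase i, zeta Λ (T s i - T s k) * (T' i - T' k))) s := by
  have h1 := hasDerivAt_prod_sigma (Λ := Λ) Finset.univ (f := fun k s => T s i - L s k)
    (fun k _ => (hT i).fun_sub (hL k)) (fun k _ => h.sub_time i k)
  have h2 := hasDerivAt_prod_sigma (Λ := Λ) (Finset.univ.erase i) (f := fun k s => T s i - T s k)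
    (fun k _ => (hT i).fun_sub (hT k))
    (fun k hk => h.times_distinct i k (Finset.ne_of_mem_erase hk).symm)
  have h3 : ∏ k ∈ Finset.univ.erase i, sigma Λ (T s i - T s k) ≠ 0 :=
    sigmaProdErase_ne_zero fun k hk => h.times_distinct i k hk
  refine (h1.fun_div h2 h3).congr_deriv ?_
  simp only [ratioRes, sigmaProd, sigmaProdErase]
  field_simp

section Solution

variable {θ : Fin N → ℂ} {U : Set (Fin N → ℂ)} {lam mu : Fin N → (Fin N → ℂ) → ℂ}

/-- The phase space curve reconstructed from a solution of the Hamiltonian system. -/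
def solutionPhase (Λ : PeriodPair) (θ : Fin N → ℂ) (lam mu : Fin N → (Fin N → ℂ) → ℂ)
    (t : Fin N → ℂ) : Phase N :=
  spectralPhase Λ θ t (fun k => lam k t) (fun k => mu k t)

/-- The multipliers reconstructed from a solution of the Hamiltonian system. -/
def solutionMultiplier (Λ : PeriodPair) (θ : Fin N → ℂ) (lam mu : Fin N → (Fin N → ℂ) → ℂ)
    (j : Fin N) (t : Fin N → ℂ) : ℂ :=
  spectralMultiplier Λ θ t (fun k => lam k t) (fun k => mu k t) j

lemma IsHamiltonianSolution.coordinates (h : IsHamiltonianSolution Λ θ U lam mu) (ht : t ∈ U) :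
    HasSpectralCoordinates Λ θ t (solutionPhase Λ θ lam mu t) (fun k => lam k t)
      (fun k => mu k t) 1 :=
  hasSpectralCoordinates_spectralPhase (h.regular t ht) _ _

lemma IsHamiltonianSolution.pderiv_lam (h : IsHamiltonianSolution Λ θ U lam mu) (ht : t ∈ U)
    (j k : Fin N) : pderiv j (lam k) t =
      positionVelocity Λ t (fun k => lam k t) (fun k => mu k t) j k := by
  rw [h.eq_lam t ht, pderiv_specHam_momentum (h.regular t ht), positionVelocity]

lemma IsHamiltonianSolution.pderiv_mu (h : IsHamiltonianSolution Λ θ U lam mu) (ht : t ∈ U)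
    (j k : Fin N) : pderiv j (mu k) t = momentumVelocity Λ t (solutionPhase Λ θ lam mu t)
      (fun k => lam k t) (fun k => mu k t) 1 j k := by
  rw [h.eq_mu t ht, (h.coordinates ht).neg_pderiv_specHam_position]

lemma IsHamiltonianSolution.differentiableAt_pi_lam (h : IsHamiltonianSolution Λ θ U lam mu)
    (hU : IsOpen U) (ht : t ∈ U) : DifferentiableAt ℂ (fun t k => lam k t) t :=
  differentiableAt_pi.mpr fun k => (h.diff_lam k t ht).differentiableAt (hU.mem_nhds ht)

lemma IsHamiltonianSolution.differentiableAt_mu (h : IsHamiltonianSolution Λ θ U lam mu)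
    (hU : IsOpen U) (ht : t ∈ U) (k : Fin N) : DifferentiableAt ℂ (mu k) t :=
  (h.diff_mu k t ht).differentiableAt (hU.mem_nhds ht)

lemma IsHamiltonianSolution.differentiableAt_q (h : IsHamiltonianSolution Λ θ U lam mu)
    (hU : IsOpen U) (ht : t ∈ U) : DifferentiableAt ℂ (fun t => (solutionPhase Λ θ lam mu t).q) t :=
  differentiableAt_charge differentiableAt_id (h.differentiableAt_pi_lam hU ht)

lemma IsHamiltonianSolution.differentiableAt_Am (h : IsHamiltonianSolution Λ θ U lam mu)
    (hU : IsOpen U) (ht : t ∈ U) (i : Fin N) :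
    DifferentiableAt ℂ (fun t => (solutionPhase Λ θ lam mu t).Am i) t :=
  differentiableAt_ratioRes differentiableAt_id (h.differentiableAt_pi_lam hU ht) (h.regular t ht) i

lemma IsHamiltonianSolution.differentiableAt_A3 (h : IsHamiltonianSolution Λ θ U lam mu)
    (hU : IsOpen U) (ht : t ∈ U) (i : Fin N) :
    DifferentiableAt ℂ (fun t => (solutionPhase Λ θ lam mu t).A3 i) t := by
  simp only [solutionPhase, spectralPhase]
  exact DifferentiableAt.fun_sum fun k _ => (h.differentiableAt_mu hU ht k).fun_mul
    (differentiableAt_lagrangeRes (T := fun t => t) (L := fun t k => lam k t) differentiableAt_id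
      (h.differentiableAt_pi_lam hU ht) (h.regular t ht) i k)

lemma IsHamiltonianSolution.differentiableAt_Ap (h : IsHamiltonianSolution Λ θ U lam mu)
    (hU : IsOpen U) (ht : t ∈ U) (i : Fin N) :
    DifferentiableAt ℂ (fun t => (solutionPhase Λ θ lam mu t).Ap i) t :=
  differentiableAt_fun_div ((differentiableAt_const (θ i ^ 2 / 4)).fun_sub
    ((h.differentiableAt_A3 hU ht i).fun_pow 2)) (h.differentiableAt_Am hU ht i)
    (ratioRes_ne_zero (h.regular t ht) i)

lemma IsHamiltonianSolution.differentiableAt_p (h : IsHamiltonianSolution Λ θ U lam mu)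
    (hU : IsOpen U) (ht : t ∈ U) : DifferentiableAt ℂ (fun t => (solutionPhase Λ θ lam mu t).p) t := by
  refine DifferentiableAt.const_mul (DifferentiableAt.fun_sum fun k _ =>
    (h.differentiableAt_mu hU ht k).fun_sub (DifferentiableAt.fun_sum fun i _ =>
      (h.differentiableAt_A3 hU ht i).fun_mul ?_)) _
  exact differentiableAt_zeta_comp (f := fun t => lam k t - t i)
    ((differentiableAt_pi.mp (h.differentiableAt_pi_lam hU ht) k).fun_sub (differentiableAt_apply i t))
    ((h.regular t ht).zeros_ne_times i k)

lemma IsHamiltonianSolution.differentiableAt_multiplier (h : IsHamiltonianSolution Λ θ U lam mu)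
    (hU : IsOpen U) (ht : t ∈ U) (j : Fin N) :
    DifferentiableAt ℂ (solutionMultiplier Λ θ lam mu j) t := by
  have hL := h.differentiableAt_pi_lam hU ht
  have hreg := h.regular t ht
  have hζ : ∀ i k, i ≠ k → DifferentiableAt ℂ (fun t : Fin N → ℂ => zeta Λ (t i - t k)) t :=
    fun i k hik => differentiableAt_zeta_comp (f := fun t : Fin N → ℂ => t i - t k)
      ((differentiableAt_apply i t).fun_sub (differentiableAt_apply k t)) (hreg.times_distinct i k hik)
  have h1 : DifferentiableAt ℂ (fun t => laxDiagConst Λ t (solutionPhase Λ θ lam mu t) j) t := by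
    simp only [laxDiagConst]
    exact (h.differentiableAt_p hU ht).fun_add (DifferentiableAt.fun_sum fun k hk =>
      (h.differentiableAt_A3 hU ht k).fun_mul (hζ j k (Finset.ne_of_mem_erase hk).symm))
  have h2 : DifferentiableAt ℂ (fun t => ∑ i ∈ Finset.univ.erase j,
      phi Λ (solutionPhase Λ θ lam mu t).q (t j - t i) * (solutionPhase Λ θ lam mu t).Am i) t :=
    DifferentiableAt.fun_sum fun i hi => (differentiableAt_phi_comp
      (g := fun t : Fin N → ℂ => t j - t i) (h.differentiableAt_q hU ht)
      ((differentiableAt_apply j t).fun_sub (differentiableAt_apply i t)) hreg.charge_notMem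
      (hreg.times_distinct j i (Finset.ne_of_mem_erase hi).symm)).fun_mul
      (h.differentiableAt_Am hU ht i)
  have h3 : DifferentiableAt ℂ (fun t => ∑ k, zeta Λ (t j - lam k t)
      * (1 - positionVelocity Λ t (fun k => lam k t) (fun k => mu k t) j k)) t := by
    simp only [positionVelocity]
    refine DifferentiableAt.fun_sum fun k _ => (differentiableAt_zeta_comp
      (f := fun t => t j - lam k t) ((differentiableAt_apply j t).fun_sub
        (differentiableAt_pi.mp hL k)) (hreg.sub_time j k)).fun_mul
      ((differentiableAt_const 1).fun_sub ((((h.differentiableAt_mu hU ht k).const_mul 2).fun_mul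
        (differentiableAt_lagrangeRes (T := fun t => t) (L := fun t k => lam k t)
          differentiableAt_id hL hreg j k)).fun_add (differentiableAt_lagrangeZRes
          (T := fun t => t) (L := fun t k => lam k t) differentiableAt_id hL hreg j k)))
  exact (h1.fun_sub (differentiableAt_fun_div ((h.differentiableAt_A3 hU ht j).fun_mul h2)
    (h.differentiableAt_Am hU ht j) (ratioRes_ne_zero hreg j))).fun_sub
    ((h3.fun_sub (DifferentiableAt.fun_sum fun k hk =>
      hζ j k (Finset.ne_of_mem_erase hk).symm)).const_mul (1 / 2))

lemma IsHamiltonianSolution.hasDerivAt_lam (h : IsHamiltonianSolution Λ θ U lam mu)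
    (hU : IsOpen U) (ht : t ∈ U) (j k : Fin N) :
    HasDerivAt (fun s => lam k (Function.update t j s))
      (positionVelocity Λ t (fun k => lam k t) (fun k => mu k t) j k) (t j) :=
  h.pderiv_lam ht j k ▸ hasDerivAt_curve hU ht (h.diff_lam k) j

lemma IsHamiltonianSolution.flow_q (h : IsHamiltonianSolution Λ θ U lam mu)
    (hU : IsOpen U) (ht : t ∈ U) (j : Fin N) :
    pderiv j (fun t => (solutionPhase Λ θ lam mu t).q) t =
      2 * (solutionPhase Λ θ lam mu t).A3 j := by
  have h1 := (HasDerivAt.fun_sum (u := Finset.univ) fun k _ => h.hasDerivAt_lam hU ht j k).fun_sub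
    (HasDerivAt.fun_sum (u := Finset.univ) fun k _ => hasDerivAt_update (a := t) j k (t j))
  have h2 : pderiv j (fun t => (solutionPhase Λ θ lam mu t).q) t = _ := h1.deriv
  rw [h2]
  simp only [positionVelocity, Finset.sum_add_distrib, sum_zero_lagrangeZRes (h.regular t ht),
    Finset.sum_ite_eq', Finset.mem_univ, if_true, solutionPhase, spectralPhase, mul_assoc,
    ← Finset.mul_sum]
  ring

lemma sum_flowA3 (t : Fin N → ℂ) (x : Phase N) (j : Fin N) : ∑ k, flowA3 Λ t x j k = 0 := by
  rw [← Finset.add_sum_erase _ _ (Finset.mem_univ j), flowA3, if_pos rfl, neg_add_eq_zero]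
  exact Finset.sum_congr rfl fun k hk => by rw [flowA3, if_neg (Finset.ne_of_mem_erase hk)]

/-- `L₁₁(λ_k) = μ_k` along a solution gives the diagonal part of the Lax equation at the points
`λ_k`, and the diagonal part is determined by its values there. -/
lemma IsHamiltonianSolution.flow_p_A3 (h : IsHamiltonianSolution Λ θ U lam mu)
    (hU : IsOpen U) (ht : t ∈ U) (j : Fin N) :
    (∀ k, pderiv j (fun t => (solutionPhase Λ θ lam mu t).A3 k) t =
      flowA3 Λ t (solutionPhase Λ θ lam mu t) j k) ∧
    pderiv j (fun t => (solutionPhase Λ θ lam mu t).p) t =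
      flowP Λ t (solutionPhase Λ θ lam mu t) j := by
  set X := solutionPhase Λ θ lam mu with hX
  have hc := h.coordinates ht
  have hreg := h.regular t ht
  have hself : Function.update t j (t j) = t := Function.update_eq_self j t
  have hA3 := fun i => hasDerivAt_curve hU ht
    (fun t ht => (h.differentiableAt_A3 hU ht i).differentiableWithinAt) j
  have hp := hasDerivAt_curve hU ht
    (fun t ht => (h.differentiableAt_p hU ht).differentiableWithinAt) j
  refine eq_of_values_eq hreg ?_ fun k => ?_
  · rw [sum_flowA3]
    have h1 := HasDerivAt.fun_sum (u := Finset.univ) fun i _ => hA3 i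
    refine h1.unique ((hasDerivAt_const (t j) (0 : ℂ)).congr_of_eventuallyEq ?_)
    filter_upwards [eventually_update_mem hU ht j] with s hs
    exact (h.coordinates hs).spin_constraint
  · have hz : ∀ i, lam k t - t i ∉ Λ.lattice := fun i => hreg.zeros_ne_times i k
    have h1 := hp.fun_add (hasDerivAt_sum_zeta_time (Λ := Λ) (t := t) j
      (A := fun s i => (X (Function.update t j s)).A3 i) (h.hasDerivAt_lam hU ht j k) hA3
      (by rw [hself]; exact hz))
    have h2 : (fun s => mu k (Function.update t j s)) =ᶠ[𝓝 (t j)] fun s =>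
        (X (Function.update t j s)).p + ∑ i, (X (Function.update t j s)).A3 i
          * zeta Λ (lam k (Function.update t j s) - Function.update t j s i) := by
      filter_upwards [eventually_update_mem hU ht j] with s hs
      exact ((h.coordinates hs).diag k).symm
    have h3 : pderiv j (mu k) t = _ := h2.deriv_eq.trans h1.deriv
    rw [h.pderiv_mu ht, hself, momentumVelocity, laxDiagDeriv, positionVelocity] at h3
    have h5 := laxDiag_flow hreg.times_distinct hc.q_notMem j hz
    have h6 := phi_neg_left Λ (X t).q (t j - lam k t)
    have h7 : Λ.weierstrassP (t j - lam k t) = Λ.weierstrassP (lam k t - t j) := by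
      rw [← Λ.weierstrassP_neg, neg_sub]
    rw [neg_sub] at h6
    have h8 : laxUpper Λ t (X t) (lam k t) = 0 := hc.laxUpper_zero k
    have h9 := ratioDeriv_ne_zero hreg k
    rw [h8, hc.upper j] at h5
    have h10 : ratioDeriv Λ t (fun k => lam k t) k * lagrangeRes Λ t (fun k => lam k t) j k
        = -(phi Λ (X t).q (lam k t - t j) * ratioRes Λ t (fun k => lam k t) j) := by
      rw [lagrangeRes, ← hc.charge_eq, h6]
      field_simp
    rw [h7] at h3
    linear_combination -h3 - h5 + laxLower Λ t (X t) (lam k t) * h10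

lemma flowAm_eq_sub (t : Fin N → ℂ) (x : Phase N) (c : ℂ) (j k : Fin N) :
    flowAm Λ t x c j k = flowAm Λ t x 0 j k - c * x.Am k := by
  rw [flowAm, flowAm]
  split_ifs with hk
  · subst hk; ring
  · ring

/-- `L₁₂(λ_k) = 0` along a solution gives the upper triangular part of the Lax equation at the
points `λ_k`, which determines it up to a multiple of `L₁₂`, accounted for by the multiplier. -/
lemma IsHamiltonianSolution.flow_Am (h : IsHamiltonianSolution Λ θ U lam mu)
    (hU : IsOpen U) (ht : t ∈ U) (j i : Fin N) :
    pderiv j (fun t => (solutionPhase Λ θ lam mu t).Am i) t =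
      flowAm Λ t (solutionPhase Λ θ lam mu t) (2 * solutionMultiplier Λ θ lam mu j t) j i := by
  set X := solutionPhase Λ θ lam mu with hX
  have hc := h.coordinates ht
  have hreg := h.regular t ht
  have hself : Function.update t j (t j) = t := Function.update_eq_self j t
  have hAm := fun i => hasDerivAt_curve hU ht
    (fun t ht => (h.differentiableAt_Am hU ht i).differentiableWithinAt) j
  have hq := hasDerivAt_curve hU ht
    (fun t ht => (h.differentiableAt_q hU ht).differentiableWithinAt) j
  have hvan : ∀ k, phiSum Λ t (charge t fun k => lam k t)
      (fun i => pderiv j (fun t => (X t).Am i) t - flowAm Λ t (X t) 0 j i) (lam k t) = 0 := by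
    intro k
    have hz : ∀ i, lam k t - t i ∉ Λ.lattice := fun i => hreg.zeros_ne_times i k
    have h1 := hasDerivAt_phiSum_time (Λ := Λ) (t := t) j
      (A := fun s i => (X (Function.update t j s)).Am i) hq (h.hasDerivAt_lam hU ht j k) hAm
      (by rw [hself]; exact hc.q_notMem) (by rw [hself]; exact hz)
    have h2 : (fun s => phiSum Λ (Function.update t j s) (X (Function.update t j s)).q
        (fun i => (X (Function.update t j s)).Am i) (lam k (Function.update t j s)))
          =ᶠ[𝓝 (t j)] fun _ => 0 := by
      filter_upwards [eventually_update_mem hU ht j] with s hs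
      exact (h.coordinates hs).laxUpper_zero k
    have h3 := h1.unique ((hasDerivAt_const (t j) (0 : ℂ)).congr_of_eventuallyEq h2)
    rw [hself, hc.sum_phiZ k, h.flow_q hU ht j] at h3
    have h4 := laxUpper_flow hreg.times_distinct hc.q_notMem hc.spin_constraint 0 j hz
    rw [hc.laxUpper_zero k, hc.diag k] at h4
    have h5 := phi_neg_left Λ (X t).q (t j - lam k t)
    have h6 := phiZ_neg_neg Λ (X t).q (lam k t - t j)
    rw [neg_sub] at h5 h6
    have h7 := ratioDeriv_ne_zero hreg k
    have h8 : positionVelocity Λ t (fun k => lam k t) (fun k => mu k t) j k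
        * ratioDeriv Λ t (fun k => lam k t) k = (phiZ Λ (X t).q (lam k t - t j)
          - 2 * mu k t * phi Λ (X t).q (lam k t - t j)) * (X t).Am j := by
      rw [positionVelocity, lagrangeRes, lagrangeZRes, ← hc.charge_eq, h5, h6, hc.upper j]
      have h9 := inv_mul_cancel₀ h7
      linear_combination (phiZ Λ (X t).q (lam k t - t j) - 2 * mu k t
        * phi Λ (X t).q (lam k t - t j)) * ratioRes Λ t (fun k => lam k t) j * h9
    have h9 : phiSum Λ t (charge t fun k => lam k t)
        (fun i => pderiv j (fun t => (X t).Am i) t - flowAm Λ t (X t) 0 j i) (lam k t)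
        = phiSum Λ t (X t).q (fun i => pderiv j (fun t => (X t).Am i) t) (lam k t)
          - phiSum Λ t (X t).q (flowAm Λ t (X t) 0 j) (lam k t) := by
      rw [← hc.charge_eq]
      simp only [phiSum, sub_mul, Finset.sum_sub_distrib]
      rfl
    rw [h9]
    linear_combination h3 - h4 - h8
  -- The factor `c` is identified by the component `i = j`.
  obtain ⟨c, hcc⟩ := exists_eq_mul_ratioRes hreg hvan
  have hcj := hcc j
  have h1 := hasDerivAt_ratioRes (Λ := Λ) (s := t j) (T := fun s => Function.update t j s)
    (L := fun s k => lam k (Function.update t j s))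
    (fun i => hasDerivAt_update (a := t) j i (t j)) (fun k => h.hasDerivAt_lam hU ht j k)
    (by rw [hself]; exact hreg) j
  have h2 : pderiv j (fun t => (X t).Am j) t = _ := h1.deriv
  have h3 := ratioRes_ne_zero hreg j
  have h4 : ∑ k ∈ Finset.univ.erase j, zeta Λ (t j - t k) * (1 - if k = j then (1 : ℂ) else 0)
      = ∑ k ∈ Finset.univ.erase j, zeta Λ (t j - t k) :=
    Finset.sum_congr rfl fun k hk => by rw [if_neg (Finset.ne_of_mem_erase hk), sub_zero, mul_one]
  have h5 : c = -(2 * solutionMultiplier Λ θ lam mu j t) := by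
    refine mul_right_cancel₀ h3 ?_
    rw [← hcj, h2, hself, flowAm, if_pos rfl, solutionMultiplier, spectralMultiplier]
    simp only [if_true, h4]
    rw [show (X t).Am j = ratioRes Λ t (fun k => lam k t) j from rfl,
      show (X t).q = charge t (fun k => lam k t) from rfl, hX, solutionPhase]
    simp only [show ∀ i, (spectralPhase Λ θ t (fun k => lam k t) (fun k => mu k t)).Am i
      = ratioRes Λ t (fun k => lam k t) i from fun i => rfl]
    field_simp
    ring
  have h6 := hcc i
  rw [h5] at h6
  rw [flowAm_eq_sub]
  rw [show (X t).Am i = ratioRes Λ t (fun k => lam k t) i from rfl]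
  linear_combination h6

/-- Since `A_i⁻ ≠ 0`, the flow of `A_i⁺` follows from the constraint `(A_i³)² + A_i⁺ A_i⁻ = C_i`. -/
lemma IsHamiltonianSolution.flow_Ap (h : IsHamiltonianSolution Λ θ U lam mu)
    (hU : IsOpen U) (ht : t ∈ U) (j i : Fin N) :
    pderiv j (fun t => (solutionPhase Λ θ lam mu t).Ap i) t =
      flowAp Λ t (solutionPhase Λ θ lam mu t) (2 * solutionMultiplier Λ θ lam mu j t) j i := by
  have hAm := hasDerivAt_curve hU ht
    (fun t ht => (h.differentiableAt_Am hU ht i).differentiableWithinAt) j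
  have hAp := hasDerivAt_curve hU ht
    (fun t ht => (h.differentiableAt_Ap hU ht i).differentiableWithinAt) j
  have hA3 := hasDerivAt_curve hU ht
    (fun t ht => (h.differentiableAt_A3 hU ht i).differentiableWithinAt) j
  have hself : Function.update t j (t j) = t := Function.update_eq_self j t
  have h1 := (hA3.fun_pow 2).fun_add (hAp.fun_mul hAm)
  have h2 := h1.unique ((hasDerivAt_const (t j) (θ i ^ 2 / 4)).congr_of_eventuallyEq (by
    filter_upwards [eventually_update_mem hU ht j] with s hs
    exact (h.coordinates hs).leaf i))
  rw [h.flow_Am hU ht, (h.flow_p_A3 hU ht j).1 i, hself] at h2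
  have h3 := leaf_flow (Λ := Λ) (t := t) (solutionPhase Λ θ lam mu t)
    (2 * solutionMultiplier Λ θ lam mu j t) j i
  have h4 : (solutionPhase Λ θ lam mu t).Am i ≠ 0 := ratioRes_ne_zero (h.regular t ht) i
  refine mul_right_cancel₀ h4 ?_
  simp only [Nat.cast_ofNat, Nat.add_one_sub_one, pow_one] at h2
  linear_combination h2 - h3

/-- The multipliers add up to `p`: under a common translation of all times the `λ_k` are
translated as well, so that the `A_i⁻` do not change. -/
lemma IsHamiltonianSolution.sum_multiplier (h : IsHamiltonianSolution Λ θ U lam mu)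
    (hU : IsOpen U) (ht : t ∈ U) :
    ∑ j, solutionMultiplier Λ θ lam mu j t = (solutionPhase Λ θ lam mu t).p := by
  set X := solutionPhase Λ θ lam mu with hX
  have hreg := h.regular t ht
  have hc := h.coordinates ht
  -- For `N = 0` the charge would be `0`, which is a period.
  have hN : Nonempty (Fin N) := by
    by_contra hN
    rw [not_nonempty_iff] at hN
    exact hreg.charge_notMem (by simp [charge])
  obtain ⟨i⟩ := hN
  have hcurve : HasDerivAt (fun s : ℂ => t + s • (1 : Fin N → ℂ)) 1 0 := by
    simpa using ((hasDerivAt_id' (0 : ℂ)).smul_const (1 : Fin N → ℂ)).const_add t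
  have e0 : t + (0 : ℂ) • (1 : Fin N → ℂ) = t := by simp
  have hdir : ∀ {f : (Fin N → ℂ) → ℂ}, DifferentiableAt ℂ f t →
      HasDerivAt (fun s : ℂ => f (t + s • (1 : Fin N → ℂ))) (∑ j, pderiv j f t) 0 := by
    intro f hf
    have h1 : HasFDerivAt f (fderiv ℂ f t) (t + (0 : ℂ) • (1 : Fin N → ℂ)) := by
      rw [e0]; exact hf.hasFDerivAt
    refine (h1.comp_hasDerivAt (0 : ℂ) hcurve).congr_deriv ?_
    rw [fderiv_apply_eq_sum hf]
    simp
  have hlam : ∀ k, HasDerivAt (fun s : ℂ => lam k (t + s • (1 : Fin N → ℂ))) 1 0 := by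
    intro k
    refine (hdir (differentiableAt_pi.mp (h.differentiableAt_pi_lam hU ht) k)).congr_deriv ?_
    simp only [h.pderiv_lam ht, positionVelocity, Finset.sum_add_distrib, ← Finset.mul_sum,
      sum_time_lagrangeRes hreg, sum_time_lagrangeZRes hreg]
    ring
  have h1 := hasDerivAt_ratioRes (Λ := Λ) (s := (0 : ℂ)) (T := fun s => t + s • (1 : Fin N → ℂ))
    (L := fun s k => lam k (t + s • (1 : Fin N → ℂ))) (T' := fun _ => 1) (L' := fun _ => 1)
    (fun i => hasDerivAt_pi.mp hcurve i) hlam (by rw [e0]; exact hreg) i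
  have h2 := (hdir (h.differentiableAt_Am hU ht i)).unique h1
  simp only [sub_self, mul_zero, Finset.sum_const_zero, h.flow_Am hU ht] at h2
  rw [← hX] at h2
  simp only [flowAm_eq_sub t (X t) (2 * _), Finset.sum_sub_distrib, ← Finset.sum_mul,
    ← Finset.mul_sum] at h2
  have h3 : ∑ j, flowAm Λ t (X t) 0 j i = 2 * (X t).p * (X t).Am i := by
    have h4 : ∀ j ∈ Finset.univ.erase i, flowAm Λ t (X t) 0 j i =
        2 * (X t).A3 i * (phi Λ (X t).q (t i - t j) * (X t).Am j)
          - 2 * (X t).Am i * ((X t).A3 j * zeta Λ (t i - t j)) := by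
      intro j hj
      have h5 := phi_neg_left Λ (X t).q (t j - t i)
      have h6 : zeta Λ (t j - t i) = -zeta Λ (t i - t j) := by rw [← zeta_neg, neg_sub]
      rw [neg_sub] at h5
      rw [flowAm, if_neg (Finset.ne_of_mem_erase hj).symm, h5, h6]
      ring
    rw [← Finset.add_sum_erase _ _ (Finset.mem_univ i), Finset.sum_congr rfl h4, flowAm, if_pos rfl,
      laxDiagConst, Finset.sum_sub_distrib, ← Finset.mul_sum, ← Finset.mul_sum]
    ring
  rw [h3] at h2
  have h4 : (X t).Am i ≠ 0 := ratioRes_ne_zero hreg i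
  refine mul_right_cancel₀ (mul_ne_zero two_ne_zero h4) ?_
  linear_combination -h2

lemma IsHamiltonianSolution.satisfiesFlows (h : IsHamiltonianSolution Λ θ U lam mu)
    (hU : IsOpen U) : SatisfiesFlows Λ U (solutionPhase Λ θ lam mu)
      (solutionMultiplier Λ θ lam mu) where
  times_distinct _ ht := (h.regular _ ht).times_distinct
  q_notMem _ ht := (h.coordinates ht).q_notMem
  diff_q _ ht := (h.differentiableAt_q hU ht).differentiableWithinAt
  diff_p _ ht := (h.differentiableAt_p hU ht).differentiableWithinAt
  diff_A3 k _ ht := (h.differentiableAt_A3 hU ht k).differentiableWithinAt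
  diff_Am k _ ht := (h.differentiableAt_Am hU ht k).differentiableWithinAt
  diff_m k _ ht := (h.differentiableAt_multiplier hU ht k).differentiableWithinAt
  spin_constraint _ ht := (h.coordinates ht).spin_constraint
  flow_q _ ht j := h.flow_q hU ht j
  flow_p _ ht j := (h.flow_p_A3 hU ht j).2
  flow_A3 _ ht j k := (h.flow_p_A3 hU ht j).1 k
  flow_Am _ ht j k := h.flow_Am hU ht j k

lemma IsHamiltonianSolution.isIsomonodromicSolution (h : IsHamiltonianSolution Λ θ U lam mu)
    (hU : IsOpen U) : IsIsomonodromicSolution Λ θ U (solutionPhase Λ θ lam mu)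
      (solutionMultiplier Λ θ lam mu) := by
  have hF := h.satisfiesFlows hU
  refine ⟨hF.times_distinct, hF.q_notMem, hF.diff_q, hF.diff_p, hF.diff_A3,
    fun k t ht => (h.differentiableAt_Ap hU ht k).differentiableWithinAt, hF.diff_Am, hF.diff_m,
    fun t ht j => ?_, hF.spin_constraint, fun t ht => h.sum_multiplier hU ht,
    fun t ht j => ?_, fun t ht j => ?_, fun t ht j k => ?_, fun t ht j k => ?_, fun t ht j k => ?_,
    fun t ht j k hjk => ?_⟩
  · rw [spinMatrix_leaf]; exact (h.coordinates ht).leaf j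
  · rw [hF.flow_q t ht, modBracket_q (hF.times_distinct t ht) (hF.q_notMem t ht)]
  · rw [hF.flow_p t ht, modBracket_p (hF.times_distinct t ht) (hF.q_notMem t ht)]
  · rw [hF.flow_A3 t ht, modBracket_A3 (hF.times_distinct t ht) (hF.q_notMem t ht)]
  · rw [h.flow_Ap hU ht, modBracket_Ap (hF.times_distinct t ht) (hF.q_notMem t ht)]
  · rw [hF.flow_Am t ht, modBracket_Am (hF.times_distinct t ht) (hF.q_notMem t ht)]
  · obtain ⟨z, hz⟩ := exists_isGeneric Λ t (fun k => lam k t)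
    refine hF.zero_curvature hU ht hz.1 ?_ hjk
    rw [(h.coordinates ht).laxUpper_eq hz.1, one_mul]
    exact ratio_ne_zero hz

lemma IsHamiltonianSolution.isSpectralDarboux (h : IsHamiltonianSolution Λ θ U lam mu) :
    IsSpectralDarboux Λ U (solutionPhase Λ θ lam mu) lam mu where
  continuousOn k := (h.diff_lam k).continuousOn
  zeros t ht z hz := by
    have h1 : laxMatrix Λ t (solutionPhase Λ θ lam mu t) z 0 1
        = laxUpper Λ t (solutionPhase Λ θ lam mu t) z := by rw [laxMatrix_eq]; rfl
    rw [h1, (h.coordinates ht).laxUpper_eq hz, one_mul]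
    exact ratio_eq_zero_iff hz
  zeros_distinct t ht := (h.regular t ht).zeros_distinct
  zeros_ne_times t ht := (h.regular t ht).zeros_ne_times
  sum_eq _ _ := rfl
  mu_eq t ht k := by
    rw [laxMatrix_eq]
    exact ((h.coordinates ht).diag k).symm

end Solution

end

end CalogeroGaudin

end

theorem theorem1 (Λ : PeriodPair) (N : ℕ) (θ : Fin N → ℂ) (U : Set (Fin N → ℂ)) (hU : IsOpen U) :
    -- the Hamiltonians are holomorphic in `(λ, μ, t)` in general position
    (∀ j : Fin N, DifferentiableOn ℂ
      (fun x : (Fin N → ℂ) × (Fin N → ℂ) × (Fin N → ℂ) =>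
        CalogeroGaudin.specHam Λ θ j x.1 x.2.1 x.2.2)
      {x | CalogeroGaudin.IsRegular Λ x.2.2 x.1}) ∧
    -- the isomonodromic system becomes the Hamiltonian system in the spectral coordinates
    (∀ (X : (Fin N → ℂ) → CalogeroGaudin.Phase N) (m lam mu : Fin N → (Fin N → ℂ) → ℂ),
      CalogeroGaudin.IsIsomonodromicSolution Λ θ U X m →
      CalogeroGaudin.IsSpectralDarboux Λ U X lam mu →
      CalogeroGaudin.IsHamiltonianSolution Λ θ U lam mu ∧
      ∀ t ∈ U, ∀ j : Fin N,
        CalogeroGaudin.specHam Λ θ j (fun k => lam k t) (fun k => mu k t) t =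
          CalogeroGaudin.quadHam Λ t j (X t) + (X t).p
            - (X t).A3 j * (∑ k, CalogeroGaudin.zeta Λ (t j - lam k t)
                - ∑ k ∈ Finset.univ.erase j, CalogeroGaudin.zeta Λ (t j - t k))
            + ∑ k ∈ Finset.univ.erase j, CalogeroGaudin.zeta Λ (t j - t k) * (X t).A3 k) ∧
    -- every solution of the Hamiltonian system arises in this way
    (∀ lam mu : Fin N → (Fin N → ℂ) → ℂ,
      CalogeroGaudin.IsHamiltonianSolution Λ θ U lam mu →
      ∃ (X : (Fin N → ℂ) → CalogeroGaudin.Phase N) (m : Fin N → (Fin N → ℂ) → ℂ),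
        CalogeroGaudin.IsIsomonodromicSolution Λ θ U X m ∧
        CalogeroGaudin.IsSpectralDarboux Λ U X lam mu) ∧
    -- and determines the solution of the isomonodromic system up to diagonal gauge transformations
    (∀ (X Y : (Fin N → ℂ) → CalogeroGaudin.Phase N) (m n lam mu : Fin N → (Fin N → ℂ) → ℂ),
      CalogeroGaudin.IsIsomonodromicSolution Λ θ U X m →
      CalogeroGaudin.IsIsomonodromicSolution Λ θ U Y n →
      CalogeroGaudin.IsSpectralDarboux Λ U X lam mu →
      CalogeroGaudin.IsSpectralDarboux Λ U Y lam mu →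
      ∀ t ∈ U, (Y t).q = (X t).q ∧ (Y t).p = (X t).p ∧ (Y t).A3 = (X t).A3 ∧
        ∃ g : ℂ, g ≠ 0 ∧ ∀ j, (Y t).Am j = g * (X t).Am j ∧ (Y t).Ap j = g⁻¹ * (X t).Ap j) := by
  refine ⟨fun j x hx => ?_, fun X m lam mu hX hS => ⟨hS.isHamiltonianSolution hU hX,
    fun t ht j => hS.specHam_eq hX ht j⟩, fun lam mu h => ?_,
    fun X Y m n lam mu hX hY hSX hSY t ht => hSX.gauge_unique hX hY hSY ht⟩
  · exact (CalogeroGaudin.differentiableAt_specHam θ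
      (T := fun x : (Fin N → ℂ) × (Fin N → ℂ) × (Fin N → ℂ) => x.2.2) (L := fun x => x.1)
      (M := fun x => x.2.1) (by fun_prop) (by fun_prop) (by fun_prop) hx j).differentiableWithinAt
  · exact ⟨_, _, h.isIsomonodromicSolution hU, h.isSpectralDarboux⟩
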